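/- A relation $R\subseteq\{0,1\}^k$ is closed under the minority operation if, for all $r,s,t\in R$, the tuple obtained from $r,s,t$ by applying coordinatewise the unique ternary operation $f$ on $\{0,1\}$ with $f(a,a,b)=f(a,b,a)=f(b,a,a)=b$ belongs to $R$. Let $\Gamma$ be a set of relations on $\{0,1\}$ (a constraint language), each of which is closed under the minority operation. An instance $\mathcal C$ of $\mathrm{CSP}(\Gamma)$ with $n$ variables is a finite set of constraints $R(x_{i_1},\dots,x_{i_k})$ with $R\in\Gamma$ of arity $k$ and $i_1,\dots,i_k\in\{1,\dots,n\}$; $\mathrm{Sol}(\mathcal C)\subseteq\{0,1\}^n$ is the set of assignments that satisfy all the constraints, and its combinatorial ideal is the vanishing ideal $\mathbf I(\mathrm{Sol}(\mathcal C))=\{f\in\mathbb R[x_1,\dots,x_n] : f(a)=0 \text{ for all } a\in \mathrm{Sol}(\mathcal C)\}$. Fix the graded lexicographic order with $x_1>\dots>x_n$. The $d$-truncated reduced Gröbner basis of an ideal is the set of those elements of its reduced Gröbner basis that have degree at most $d$. Theorem. There is an algorithm that, given $n$, $d$ and an instance $\mathcal C$ with $n$ variables whose constraints are closed under the minority operation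 (each constraint being given by its variables and the list of the tuples of its relation), computes the $d$-truncated reduced Gröbner basis of $\mathbf I(\mathrm{Sol}(\mathcal C))$, every element being output as the list of its nonzero terms with rational coefficients. For every finite language $\Gamma$ that is closed under the minority operation, it runs in time $n^{O(d)}$ on the instances of $\mathrm{CSP}(\Gamma)$, where the implied constant depends only on $\Gamma$. For instances over arbitrary (possibly infinite) languages closed under the minority operation it runs in time $s^{O(1)}\,n^{O(d)}$ with absolute constants, where $s$ is the bit length of the input. Here time is bit complexity on a machine model that is polynomially equivalent to Turing machines, and $n^{O(d)}$ means at most $\max(n,2)^{c\,\max(d,1)}$ for a constant $c$. -/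

import Mathlib

noncomputable section

namespace BoolIMP

/-! ### A machine model with a step count

Data are finite binary trees whose leaves are integers.  Programs are while-programs over such
trees, written without variables: a program transforms one tree (its store) into another one.
Time is measured by the logarithmic cost criterion: every elementary step costs the total bit
length of the data it is applied to.  (The size of every computed value is therefore bounded by
the time spent, and running times agree with those of multitape Turing machines up to a
polynomial.) -/

/-- Data: binary trees with integers at the leaves. -/
inductive Data : Type
  | int (z : ℤ) : Data
  | pair (a b : Data) : Data

namespace Data

/-- The bit length of a datum: an integer leaf `z` counts its binary digits and a sign bit,
an inner node counts `1`. -/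
def size : Data → ℕ
  | int z => Nat.size z.natAbs + 1
  | pair a b => a.size + b.size + 1

/-- Lists are coded by right-nested pairs, ended by the leaf `0`. -/
def list : List Data → Data
  | [] => int 0
  | a :: l => pair a (list l)

end Data

/-- The elementary operations. -/
inductive Op : Type
  | id | fst | snd | isPair | isPos | add | sub | mul | div

/-- The effect of the elementary operations.  Arithmetic acts on a pair of two integers, and
division is integer division; an operation applied to a datum of the wrong form returns `0`. -/
def Op.apply : Op → Data → Data
  | .id, x => x
  | .fst, .pair a _ => a
  | .snd, .pair _ b => b
  | .isPair, .pair _ _ => .int 1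
  | .isPos, .int z => if 0 < z then .int 1 else .int 0
  | .add, .pair (.int a) (.int b) => .int (a + b)
  | .sub, .pair (.int a) (.int b) => .int (a - b)
  | .mul, .pair (.int a) (.int b) => .int (a * b)
  | .div, .pair (.int a) (.int b) => .int (a / b)
  | _, _ => .int 0

/-- Programs: elementary operations, constants, pairing of two results, sequential composition
(first `p`, then `q`), branching and loops.  A test counts as true if its value is not `0`. -/
inductive Prog : Type
  | op (o : Op) : Prog
  | const (z : ℤ) : Prog
  | pair (p q : Prog) : Prog
  | seq (p q : Prog) : Prog
  | ite (c p q : Prog) : Prog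
  | while (c p : Prog) : Prog

/-- `Runs p x y t`: started on `x`, the program `p` halts with result `y` after time `t`. -/
inductive Runs : Prog → Data → Data → ℕ → Prop
  | op (o : Op) (x : Data) : Runs (.op o) x (o.apply x) (x.size + 1)
  | const (z : ℤ) (x : Data) : Runs (.const z) x (.int z) ((Data.int z).size + 1)
  | pair {p q : Prog} {x y z : Data} {s t : ℕ} :
      Runs p x y s → Runs q x z t → Runs (.pair p q) x (.pair y z) (s + t + 1)
  | seq {p q : Prog} {x y z : Data} {s t : ℕ} :
      Runs p x y s → Runs q y z t → Runs (.seq p q) x z (s + t + 1)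
  | ite_true {c p q : Prog} {x v y : Data} {s t : ℕ} :
      Runs c x v s → v ≠ .int 0 → Runs p x y t → Runs (.ite c p q) x y (s + t + x.size + 1)
  | ite_false {c p q : Prog} {x y : Data} {s t : ℕ} :
      Runs c x (.int 0) s → Runs q x y t → Runs (.ite c p q) x y (s + t + x.size + 1)
  | while_stop {c p : Prog} {x : Data} {s : ℕ} :
      Runs c x (.int 0) s → Runs (.while c p) x x (s + x.size + 1)
  | while_step {c p : Prog} {x v y z : Data} {s t u : ℕ} :
      Runs c x v s → v ≠ .int 0 → Runs p x y t → Runs (.while c p) y z u →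
        Runs (.while c p) x z (s + t + u + x.size + 1)

/-! ### Constraint satisfaction problems and polymorphisms -/

/-- A relation on `D`: an arity `k` and a set of `k`-tuples. -/
structure Relation (D : Type) where
  arity : ℕ
  tuples : Set (Fin arity → D)

/-- The `m`-ary operation `f` is a polymorphism of `R` (`R` is closed under `f`): applying `f`
coordinatewise to any `m` tuples of `R` gives a tuple of `R`. -/
def IsPolymorphism {D : Type} {m : ℕ} (f : (Fin m → D) → D) (R : Relation D) : Prop :=
  ∀ r : Fin m → Fin R.arity → D, (∀ i, r i ∈ R.tuples) →
    (fun j => f fun i => r i j) ∈ R.tuples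

/-- A ternary operation is a minority operation. -/
def IsMinority {D : Type} (f : (Fin 3 → D) → D) : Prop :=
  ∀ a b : D, f ![a, a, b] = b ∧ f ![a, b, a] = b ∧ f ![b, a, a] = b

/-- All relations of the constraint language `Γ` are closed under a minority operation. -/
def ClosedUnderMinority {D : Type} (Γ : Set (Relation D)) : Prop :=
  ∃ f : (Fin 3 → D) → D, IsMinority f ∧ ∀ R ∈ Γ, IsPolymorphism f R

/-- A constraint `R(x_{i₁}, …, x_{i_k})` on the variables `x_1, …, x_n`. -/
structure Constraint (D : Type) (n : ℕ) where
  rel : Relation D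
  scope : Fin rel.arity → Fin n

/-- An instance of `CSP(Γ)` with `n` variables: a finite set of constraints over `Γ`. -/
structure Instance {D : Type} (Γ : Set (Relation D)) (n : ℕ) where
  constraints : Set (Constraint D n)
  finite : constraints.Finite
  mem_language : ∀ c ∈ constraints, c.rel ∈ Γ

/-- The set of solutions of an instance. -/
def Sol {D : Type} {Γ : Set (Relation D)} {n : ℕ} (𝒞 : Instance Γ n) : Set (Fin n → D) :=
  {φ | ∀ c ∈ 𝒞.constraints, (fun j => φ (c.scope j)) ∈ c.rel.tuples}

/-- A Boolean assignment as a point of `{0, 1}ⁿ ⊆ ℝⁿ`. -/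
def toPoint {n : ℕ} (φ : Fin n → Bool) : Fin n → ℝ := fun i => if φ i then 1 else 0

/-- The combinatorial ideal of a Boolean instance: the vanishing ideal of its set of solutions. -/
def combIdeal {Γ : Set (Relation Bool)} {n : ℕ} (𝒞 : Instance Γ n) :
    Ideal (MvPolynomial (Fin n) ℝ) :=
  MvPolynomial.vanishingIdeal ℝ (toPoint '' Sol 𝒞)

/-! ### Gröbner bases -/

/-- `G` is a Gröbner basis of the ideal `I` for the monomial order `m`. -/
def IsGroebnerBasis {σ : Type} (m : MonomialOrder σ) (I : Ideal (MvPolynomial σ ℝ))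
    (G : Set (MvPolynomial σ ℝ)) : Prop :=
  G.Finite ∧ G ⊆ I ∧
    Ideal.span (m.leadingTerm '' G) = Ideal.span (m.leadingTerm '' {f | f ∈ I ∧ f ≠ 0})

/-- `G` is a reduced Gröbner basis of `I`: its elements are monic, and no term of one element is
divisible by the leading term of another one. -/
def IsReducedGroebnerBasis {σ : Type} (m : MonomialOrder σ) (I : Ideal (MvPolynomial σ ℝ))
    (G : Set (MvPolynomial σ ℝ)) : Prop :=
  IsGroebnerBasis m I G ∧ (∀ g ∈ G, m.leadingCoeff g = 1) ∧
    ∀ g ∈ G, ∀ f ∈ G, f ≠ g → ∀ a ∈ f.support, ¬ m.degree g ≤ a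

/-- The `d`-truncation: the elements of total degree at most `d`. -/
def truncate {σ : Type} (d : ℕ) (G : Set (MvPolynomial σ ℝ)) : Set (MvPolynomial σ ℝ) :=
  {g | g ∈ G ∧ g.totalDegree ≤ d}

/-! ### Codes of inputs and outputs -/

/-- `w` lists the elements of the set `S`, each exactly once and in any order, every one of them
by one of its codes. -/
def CodesSet {α : Type} (code : α → Data → Prop) (S : Set α) (w : Data) : Prop :=
  ∃ l : List α, l.Nodup ∧ (∀ a, a ∈ l ↔ a ∈ S) ∧
    ∃ ws : List Data, List.Forall₂ code l ws ∧ w = Data.list ws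

/-- The code of a vector of natural numbers. -/
def vecCode {k : ℕ} (v : Fin k → ℕ) : Data := Data.list (List.ofFn fun i => .int (v i))

/-- A Boolean tuple is coded by the vector of its bits. -/
def CodesTuple {k : ℕ} (t : Fin k → Bool) (w : Data) : Prop :=
  w = vecCode fun i => (t i).toNat

/-- A constraint is coded by the list of its variables and the list of the tuples of its
relation. -/
def CodesConstraint {n : ℕ} (c : Constraint Bool n) (w : Data) : Prop :=
  ∃ r, CodesSet CodesTuple c.rel.tuples r ∧
    w = .pair (vecCode fun j => (c.scope j : ℕ)) r

/-- The input: the number `n` of variables, the degree bound `d` and the list of constraints. -/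
def CodesInput {Γ : Set (Relation Bool)} {n : ℕ} (d : ℕ) (𝒞 : Instance Γ n) (w : Data) : Prop :=
  ∃ r, CodesSet CodesConstraint 𝒞.constraints r ∧ w = .pair (.int n) (.pair (.int d) r)

/-- A term of the polynomial `p`: its coefficient as a fraction of two integers, and its vector
of exponents. -/
def CodesTerm {n : ℕ} (p : MvPolynomial (Fin n) ℝ) (a : Fin n →₀ ℕ) (w : Data) : Prop :=
  ∃ x y : ℤ, y ≠ 0 ∧ p.coeff a = (x : ℝ) / (y : ℝ) ∧
    w = .pair (.pair (.int x) (.int y)) (vecCode a)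

/-- A polynomial is coded by the list of its nonzero terms. -/
def CodesPoly {n : ℕ} (p : MvPolynomial (Fin n) ℝ) (w : Data) : Prop :=
  CodesSet (CodesTerm p) (p.support : Set (Fin n →₀ ℕ)) w

/-- For every instance `𝒞` of `CSP(Γ)` and every `d`, the program `M` computes the `d`-truncation
of the reduced Gröbner basis of the combinatorial ideal of `𝒞` in the graded lexicographic order
with `x_1 > ⋯ > x_n`, within time `T n d s`, where `n` is the number of variables and `s` is the
bit length of the input. -/
def ComputesTruncatedBasis (M : Prog) (Γ : Set (Relation Bool)) (T : ℕ → ℕ → ℕ → ℕ) : Prop :=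
  ∀ (n d : ℕ) (𝒞 : Instance Γ n) (w : Data), CodesInput d 𝒞 w →
    ∃ (out : Data) (t : ℕ) (G : Set (MvPolynomial (Fin n) ℝ)),
      Runs M w out t ∧ t ≤ T n d w.size ∧
        IsReducedGroebnerBasis MonomialOrder.degLex (combIdeal 𝒞) G ∧
          CodesSet CodesPoly (truncate d G) out

end BoolIMP

end

/-! Over the field with two elements the minority operation is x + y + z, so the solution set S is
empty or an affine subspace. On such an S the characters chi_A(x) = ∏_{i ∈ A} (-1)^{x_i} are rigid:
any two of them are either proportional on S or orthogonal on S (`sum_chi_mul_chi_eq_zero`). Call a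
squarefree monomial standard if it is the smallest one in the proportionality class of its
character. Squarefree monomials and characters expand into each other along subsets
(`monVal_eq_sum`, `chi_eq_sum`), and standardness passes to subsets (`IsStandard.subset`).

This determines the reduced basis explicitly, without Buchberger's algorithm. If a member of the
vanishing ideal has a squarefree leading monomial, pairing it with the character of that monomial
shows that the monomial is not standard (`not_isStandard_of_degree_eq`). Conversely, write a
nonstandard monomial in characters, replace each character by the signed standard one of its class,
and expand back: the difference `nfPoly` lies in the ideal, keeps the leading monomial and has a
tail of standard monomials. The minimal nonstandard monomials give one part of the basis, and x_i^2
- x_i for the standard x_i the other (`isReducedGroebnerBasis_reducedBasis`).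

To compute this, S is represented by a list of points that generate it under minority. A constraint
is added by forming the product with its listed tuples, imposing the equations that identify
variables, and projecting (`Generates.addConstraint`). An equation never increases the number of
generators, so the list stays short without any elimination (`Bounded.addConstraint`).
Proportionality of characters is tested on the generators alone (`equivTest_iff`). Since the order
is graded, only monomials of degree at most d matter, and the first proportional one in an
increasing enumeration is the standard one (`BasisContext.rep_eq`).

The time bound comes from closure properties of `PolyTime`. The length of an `Input` is charged with
max(n,2)^max(d,1), the scale of the number of monomials, so polynomial time in that length is s^O(1)
n^O(d) (`exists_computes`). Over a finite language there are only polynomially many distinct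
constraints, hence s itself is n^O(d) (`exists_size_le`). -/

namespace BoolIMP

/-! ### Polynomial-time computable functions on coded types -/

/-- A coding of a type by data, with a length function that bounds the size of the codes. -/
class Code (α : Type) where
  enc : α → Data
  len : α → ℕ
  size_le : ∀ a, (enc a).size ≤ len a

open Code

/-- Both truth values get length 2, although the code of `false` has size 1; thus the length of a
Boolean vector depends only on its number of entries. -/
instance : Code Bool :=
  ⟨fun b => .int b.toNat, fun _ => 2, fun b => by cases b <;> simp [Data.size]⟩

instance : Code ℕ := ⟨fun n => .int n, fun n => Nat.size n + 1, fun n => by simp [Data.size]⟩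

instance : Code ℤ := ⟨fun z => .int z, fun z => Nat.size z.natAbs + 1, fun n => by simp [Data.size]⟩

instance {α β : Type} [Code α] [Code β] : Code (α × β) :=
  ⟨fun p => .pair (enc p.1) (enc p.2), fun p => len p.1 + len p.2 + 1,
    fun p => by
      have h1 := size_le p.1
      have h2 := size_le p.2
      simp only [Data.size]; omega⟩

theorem size_list_map_le {α : Type} [Code α] (l : List α) :
    (Data.list (l.map enc)).size ≤ (l.map fun a => len a + 1).sum + 1 := by
  induction l with
  | nil => simp [Data.list, Data.size]
  | cons a l ih =>
    have := size_le a
    simp only [List.map_cons, Data.list, Data.size, List.sum_cons]; omega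

instance {α : Type} [Code α] : Code (List α) :=
  ⟨fun l => Data.list (l.map enc), fun l => (l.map fun a => len a + 1).sum + 1, size_list_map_le⟩

section Basics

variable {α β γ : Type} [Code α] [Code β] [Code γ]

theorem enc_pair (a : α) (b : β) : enc (a, b) = .pair (enc a) (enc b) := rfl

theorem len_pair (a : α) (b : β) : len (a, b) = len a + len b + 1 := rfl

theorem enc_cons (a : α) (l : List α) : enc (a :: l) = .pair (enc a) (enc l) := rfl

theorem len_nil : len ([] : List α) = 1 := rfl

theorem len_cons (a : α) (l : List α) : len (a :: l) = len a + len l + 1 := by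
  simp only [len, List.map_cons, List.sum_cons]; omega

theorem len_append (l l' : List α) : len (l ++ l') + 1 = len l + len l' := by
  simp only [len, List.map_append, List.sum_append]; omega

theorem length_le_len (l : List α) : l.length ≤ len l := by
  induction l with
  | nil => simp
  | cons a l ih => rw [len_cons, List.length_cons]; omega

theorem len_le_of_mem {a : α} {l : List α} (h : a ∈ l) : len a ≤ len l := by
  induction l with
  | nil => simp at h
  | cons b l ih =>
    rw [len_cons]
    rcases List.mem_cons.1 h with rfl | h
    · omega
    · have := ih h; omega

theorem len_drop_le (l : List α) (k : ℕ) : len (l.drop k) ≤ len l := by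
  induction l generalizing k with
  | nil => simp
  | cons a l ih =>
    cases k with
    | zero => simp
    | succ k => rw [List.drop_succ_cons, len_cons]; have := ih k; omega

theorem len_take_le (l : List α) (k : ℕ) : len (l.take k) ≤ len l := by
  induction l generalizing k with
  | nil => simp
  | cons a l ih =>
    cases k with
    | zero => rw [List.take_zero, len_cons, len_nil]; omega
    | succ k => rw [List.take_succ_cons, len_cons, len_cons]; have := ih k; omega

theorem len_le_of_forall {l : List α} {N K : ℕ} (hl : l.length ≤ K) (h : ∀ a ∈ l, len a ≤ N) :
    len l ≤ K * (N + 1) + 1 := by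
  induction l generalizing K with
  | nil => rw [len_nil]; omega
  | cons a l ih =>
    rw [len_cons]
    obtain ⟨K, rfl⟩ : ∃ K', K = K' + 1 := ⟨K - 1, by simp at hl; omega⟩
    have h1 := ih (K := K) (by simpa using hl) fun b hb => h b (List.mem_cons_of_mem _ hb)
    have h2 := h a List.mem_cons_self
    rw [Nat.succ_mul]; omega

theorem one_le_size (x : Data) : 1 ≤ x.size := by
  cases x <;> simp [Data.size]

theorem one_le_len (a : α) : 1 ≤ len a := (one_le_size _).trans (size_le a)

/-- The function is bounded by a polynomial in the length of its argument. -/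
def PolyBdd (B : α → ℕ) : Prop := ∃ c, ∀ a, B a ≤ (len a + 1) ^ c

theorem PolyBdd.mono {B B' : α → ℕ} (h : PolyBdd B) (h' : ∀ a, B' a ≤ B a) : PolyBdd B' :=
  h.imp fun _ hc a => (h' a).trans (hc a)

/-- Lengths are positive, so the base `len a + 1` is at least 2 and constants are absorbed into the
exponent. -/
theorem PolyBdd.const (k : ℕ) : PolyBdd fun _ : α => k :=
  ⟨k, fun a => (Nat.lt_two_pow_self).le.trans (Nat.pow_le_pow_left (by have := one_le_len a; omega) k)⟩

theorem PolyBdd.add {B B' : α → ℕ} (h : PolyBdd B) (h' : PolyBdd B') :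
    PolyBdd fun a => B a + B' a := by
  obtain ⟨c, hc⟩ := h
  obtain ⟨c', hc'⟩ := h'
  refine ⟨max c c' + 1, fun a => ?_⟩
  have h1 : 0 < len a + 1 := by omega
  have h2 := (hc a).trans (Nat.pow_le_pow_right h1 (le_max_left c c'))
  have h3 := (hc' a).trans (Nat.pow_le_pow_right h1 (le_max_right c c'))
  have h4 := Nat.mul_le_mul_left ((len a + 1) ^ max c c') (show 2 ≤ len a + 1 by
    have := one_le_len a; omega)
  simp only [pow_succ]; omega

theorem PolyBdd.mul {B B' : α → ℕ} (h : PolyBdd B) (h' : PolyBdd B') :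
    PolyBdd fun a => B a * B' a := by
  obtain ⟨c, hc⟩ := h
  obtain ⟨c', hc'⟩ := h'
  exact ⟨c + c', fun a => by rw [pow_add]; exact Nat.mul_le_mul (hc a) (hc' a)⟩

theorem PolyBdd.pow {B : α → ℕ} (h : PolyBdd B) (k : ℕ) : PolyBdd fun a => B a ^ k := by
  obtain ⟨c, hc⟩ := h
  exact ⟨c * k, fun a => by rw [pow_mul]; exact Nat.pow_le_pow_left (hc a) k⟩

theorem PolyBdd.len : PolyBdd fun a : α => len a := ⟨1, fun a => by simp⟩

theorem PolyBdd.comp {f : α → β} {B : β → ℕ} (hB : PolyBdd B) (hf : PolyBdd fun a => Code.len (f a)) :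
    PolyBdd fun a => B (f a) := by
  obtain ⟨c, hc⟩ := hB
  exact ((hf.add (PolyBdd.const 1)).pow c).mono fun a => hc (f a)

/-- The program `p` computes `f` within time `B`; `B` also bounds the length of the values. -/
def Computes (p : Prog) (f : α → β) (B : α → ℕ) : Prop :=
  ∀ a, len (f a) ≤ B a ∧ ∃ t ≤ B a, Runs p (enc a) (enc (f a)) t

/-- The function is computed by a program in polynomial time. -/
def PolyTime (f : α → β) : Prop := ∃ p B, PolyBdd B ∧ Computes p f B

theorem PolyTime.len {f : α → β} (h : PolyTime f) : PolyBdd fun a => len (f a) := by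
  obtain ⟨p, B, hB, hp⟩ := h
  exact hB.mono fun a => (hp a).1

theorem PolyTime.of_op (o : Op) {f : α → β} (h : ∀ a, enc (f a) = o.apply (enc a))
    (hl : PolyBdd fun a => Code.len (f a)) : PolyTime f := by
  refine ⟨.op o, fun a => Code.len (f a) + (Code.len a + 1), hl.add (PolyBdd.len.add (PolyBdd.const 1)),
    fun a => ⟨by simp, (enc a).size + 1, ?_, ?_⟩⟩
  · have := size_le a; simp only; omega
  · rw [h]; exact Runs.op o _

/-- Functions with the same codes of values are computed by the same programs. -/
theorem PolyTime.congr_enc {f : α → β} {g : α → γ} (hf : PolyTime f)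
    (h : ∀ a, enc (g a) = enc (f a)) (hl : ∀ a, Code.len (g a) ≤ Code.len (f a)) : PolyTime g := by
  obtain ⟨p, B, hB, hp⟩ := hf
  exact ⟨p, B, hB, fun a => ⟨(hl a).trans (hp a).1, by rw [h]; exact (hp a).2⟩⟩

theorem PolyTime.of_eq {f g : α → β} (hf : PolyTime f) (h : ∀ a, g a = f a) : PolyTime g := by
  rwa [funext h]

theorem PolyTime.id : PolyTime fun a : α => a := .of_op .id (fun _ => rfl) PolyBdd.len

theorem exists_prog_const (d : Data) : ∃ p t, ∀ x, Runs p x d t := by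
  induction d with
  | int z => exact ⟨.const z, _, fun x => Runs.const z x⟩
  | pair a b iha ihb =>
    obtain ⟨p, s, hp⟩ := iha
    obtain ⟨q, t, hq⟩ := ihb
    exact ⟨.pair p q, _, fun x => Runs.pair (hp x) (hq x)⟩

theorem PolyTime.const (b : β) : PolyTime fun _ : α => b := by
  obtain ⟨p, t, hp⟩ := exists_prog_const (enc b)
  exact ⟨p, fun _ => Code.len b + t, PolyBdd.const _, fun a => ⟨by simp, t, by simp, hp _⟩⟩

theorem PolyTime.comp {g : β → γ} {f : α → β} (hg : PolyTime g) (hf : PolyTime f) :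
    PolyTime fun a => g (f a) := by
  have hl := hf.len
  obtain ⟨p, B, hB, hp⟩ := hf
  obtain ⟨q, C, hC, hq⟩ := hg
  refine ⟨.seq p q, fun a => B a + C (f a) + 1, (hB.add (hC.comp hl)).add (PolyBdd.const 1),
    fun a => ?_⟩
  obtain ⟨-, s, hs, hr⟩ := hp a
  obtain ⟨h2, t, ht, hr'⟩ := hq (f a)
  exact ⟨by simp only; omega, s + t + 1, by simp only; omega, Runs.seq hr hr'⟩

theorem PolyTime.pair {f : α → β} {g : α → γ} (hf : PolyTime f) (hg : PolyTime g) :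
    PolyTime fun a => (f a, g a) := by
  obtain ⟨p, B, hB, hp⟩ := hf
  obtain ⟨q, C, hC, hq⟩ := hg
  refine ⟨.pair p q, fun a => B a + C a + 1, (hB.add hC).add (PolyBdd.const 1), fun a => ?_⟩
  obtain ⟨h1, s, hs, hr⟩ := hp a
  obtain ⟨h2, t, ht, hr'⟩ := hq a
  exact ⟨by simp only [len_pair]; omega, s + t + 1, by simp only; omega, Runs.pair hr hr'⟩

theorem PolyTime.fst {f : α → β × γ} (hf : PolyTime f) : PolyTime fun a => (f a).1 :=
  PolyTime.comp (g := Prod.fst) (.of_op .fst (fun _ => rfl)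
    (PolyBdd.len.mono fun p => by rcases p with ⟨a, b⟩; rw [len_pair]; simp only; omega)) hf

theorem PolyTime.snd {f : α → β × γ} (hf : PolyTime f) : PolyTime fun a => (f a).2 :=
  PolyTime.comp (g := Prod.snd) (.of_op .snd (fun _ => rfl)
    (PolyBdd.len.mono fun p => by rcases p with ⟨a, b⟩; rw [len_pair]; simp only; omega)) hf

theorem PolyTime.ite {c : α → Bool} {f g : α → β} (hc : PolyTime c) (hf : PolyTime f)
    (hg : PolyTime g) : PolyTime fun a => bif c a then f a else g a := by
  obtain ⟨r, D, hD, hr⟩ := hc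
  obtain ⟨p, B, hB, hp⟩ := hf
  obtain ⟨q, C, hC, hq⟩ := hg
  refine ⟨.ite r p q, fun a => D a + B a + C a + Code.len a + 1,
    (((hD.add hB).add hC).add PolyBdd.len).add (PolyBdd.const 1), fun a => ?_⟩
  obtain ⟨-, u, hu, hru⟩ := hr a
  obtain ⟨h1, s, hs, hrs⟩ := hp a
  obtain ⟨h2, t, ht, hrt⟩ := hq a
  have := size_le a
  rcases hca : c a with _ | _
  · simp only [hca] at hru ⊢
    exact ⟨by simp only [cond_false]; omega,
      u + t + (enc a).size + 1, by omega,
      Runs.ite_false hru hrt⟩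
  · simp only [hca] at hru ⊢
    exact ⟨by simp only [cond_true]; omega,
      u + s + (enc a).size + 1, by omega,
      Runs.ite_true hru (by simp [enc]) hrs⟩

theorem PolyTime.cons {f : α → β} {g : α → List β} (hf : PolyTime f) (hg : PolyTime g) :
    PolyTime fun a => f a :: g a :=
  (hf.pair hg).congr_enc (fun _ => rfl) fun a => by rw [len_cons, len_pair]

theorem PolyTime.nil : PolyTime fun _ : α => ([] : List β) := .const _

theorem PolyTime.tail {f : α → List β} (hf : PolyTime f) : PolyTime fun a => (f a).tail :=
  PolyTime.comp (g := List.tail) (.of_op .snd (fun l => by cases l <;> rfl)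
    (PolyBdd.len.mono fun l => by cases l <;> simp [len_cons]; omega)) hf

theorem PolyTime.isCons {f : α → List β} (hf : PolyTime f) : PolyTime fun a => !(f a).isEmpty :=
  PolyTime.comp (g := fun l : List β => !l.isEmpty)
    (.of_op .isPair (fun l => by cases l <;> rfl) (PolyBdd.const 2)) hf

theorem PolyTime.not {f : α → Bool} (hf : PolyTime f) : PolyTime fun a => !(f a) :=
  (hf.ite (.const false) (.const true)).of_eq fun a => by cases f a <;> rfl

theorem PolyTime.and {f g : α → Bool} (hf : PolyTime f) (hg : PolyTime g) :
    PolyTime fun a => f a && g a :=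
  (hf.ite hg (.const false)).of_eq fun a => by cases f a <;> rfl

theorem PolyTime.or {f g : α → Bool} (hf : PolyTime f) (hg : PolyTime g) :
    PolyTime fun a => f a || g a :=
  (hf.ite (.const true) hg).of_eq fun a => by cases f a <;> rfl

theorem PolyTime.xor {f g : α → Bool} (hf : PolyTime f) (hg : PolyTime g) :
    PolyTime fun a => f a ^^ g a :=
  (hf.ite hg.not hg).of_eq fun a => by cases f a <;> simp

theorem PolyTime.isEmpty {f : α → List β} (hf : PolyTime f) : PolyTime fun a => (f a).isEmpty :=
  hf.isCons.not.of_eq fun a => by simp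

/-- The operation `fst` alone does not suffice: on the leaf that codes the empty list it returns 0,
so the program branches to produce the default. -/
theorem PolyTime.headD {f : α → List β} {g : α → β} (hf : PolyTime f) (hg : PolyTime g) :
    PolyTime fun a => (f a).headD (g a) := by
  obtain ⟨r, D, hD, hr⟩ := hf.isCons
  obtain ⟨p, B, hB, hp⟩ := hf
  obtain ⟨q, C, hC, hq⟩ := hg
  refine ⟨.ite r (.seq p (.op .fst)) q, fun a => D a + (2 * B a + 2) + C a + Code.len a + 1,
    (((hD.add (((PolyBdd.const 2).mul hB).add (PolyBdd.const 2))).add hC).add PolyBdd.len).add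
      (PolyBdd.const 1), fun a => ?_⟩
  obtain ⟨-, u, hu, hru⟩ := hr a
  obtain ⟨h1, s, hs, hrs⟩ := hp a
  obtain ⟨h2, t, ht, hrt⟩ := hq a
  have := size_le a
  rcases hfa : f a with _ | ⟨x, l⟩
  · simp only [hfa] at hru ⊢
    exact ⟨by simp only [List.headD_nil]; omega,
      u + t + (enc a).size + 1, by omega,
      Runs.ite_false hru hrt⟩
  · simp only [hfa] at hru hrs h1 ⊢
    have h3 := size_le (x :: l)
    rw [len_cons] at h1
    rw [len_cons] at h3
    exact ⟨by simp only [List.headD_cons]; omega,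
      u + (s + ((enc (x :: l)).size + 1) + 1) + (enc a).size + 1, by omega,
      Runs.ite_true hru (by simp [enc]) (Runs.seq hrs (Runs.op .fst _))⟩

end Basics

/-! ### Arithmetic -/

section Arithmetic

theorem size_add_le (m n : ℕ) : Nat.size (m + n) ≤ Nat.size m + Nat.size n + 1 := by
  rw [Nat.size_le]
  have h1 := Nat.lt_size_self m
  have h2 := Nat.lt_size_self n
  have h3 : 2 ^ m.size ≤ 2 ^ (m.size + n.size) := Nat.pow_le_pow_right (by omega) (by omega)
  have h4 : 2 ^ n.size ≤ 2 ^ (m.size + n.size) := Nat.pow_le_pow_right (by omega) (by omega)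
  rw [pow_succ]; omega

theorem size_mul_le (m n : ℕ) : Nat.size (m * n) ≤ Nat.size m + Nat.size n := by
  rw [Nat.size_le, pow_add]
  exact Nat.mul_lt_mul'' (Nat.lt_size_self m) (Nat.lt_size_self n)

theorem len_int_add_le (x y : ℤ) : len (x + y) ≤ len x + len y := by
  have h1 := size_add_le x.natAbs y.natAbs
  have h2 := Nat.size_le_size (Int.natAbs_add_le x y)
  simp only [len]; omega

theorem len_int_mul_le (x y : ℤ) : len (x * y) ≤ len x + len y := by
  have h1 := size_mul_le x.natAbs y.natAbs
  simp only [len, Int.natAbs_mul]; omega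

variable {α : Type} [Code α]

theorem PolyTime.add {f g : α → ℤ} (hf : PolyTime f) (hg : PolyTime g) :
    PolyTime fun a => f a + g a :=
  PolyTime.comp (g := fun p : ℤ × ℤ => p.1 + p.2) (.of_op .add (fun _ => rfl)
    (PolyBdd.len.mono fun p => by
      have := len_int_add_le p.1 p.2
      rcases p with ⟨x, y⟩; rw [len_pair]; simp only at *; omega)) (hf.pair hg)

theorem PolyTime.mul {f g : α → ℤ} (hf : PolyTime f) (hg : PolyTime g) :
    PolyTime fun a => f a * g a :=
  PolyTime.comp (g := fun p : ℤ × ℤ => p.1 * p.2) (.of_op .mul (fun _ => rfl)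
    (PolyBdd.len.mono fun p => by
      have := len_int_mul_le p.1 p.2
      rcases p with ⟨x, y⟩; rw [len_pair]; simp only at *; omega)) (hf.pair hg)

theorem PolyTime.neg {f : α → ℤ} (hf : PolyTime f) : PolyTime fun a => -f a :=
  ((PolyTime.const (-1)).mul hf).of_eq fun a => by simp

theorem PolyTime.sub {f g : α → ℤ} (hf : PolyTime f) (hg : PolyTime g) :
    PolyTime fun a => f a - g a :=
  (hf.add hg.neg).of_eq fun a => by ring

theorem PolyTime.pos {f : α → ℤ} (hf : PolyTime f) : PolyTime fun a => decide (0 < f a) :=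
  PolyTime.comp (g := fun z : ℤ => decide (0 < z)) (.of_op .isPos (fun z => by
    by_cases h : 0 < z <;> simp [enc, Op.apply, h]) (PolyBdd.const 2)) hf

theorem PolyTime.decide_lt {f g : α → ℤ} (hf : PolyTime f) (hg : PolyTime g) :
    PolyTime fun a => decide (f a < g a) :=
  (hg.sub hf).pos.of_eq fun a => by simp

theorem PolyTime.decide_eq {f g : α → ℤ} (hf : PolyTime f) (hg : PolyTime g) :
    PolyTime fun a => decide (f a = g a) :=
  ((hf.decide_lt hg).not.and (hg.decide_lt hf).not).of_eq fun a => by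
    rw [Bool.eq_iff_iff]; simp; omega

theorem PolyTime.natCast {f : α → ℕ} (hf : PolyTime f) : PolyTime fun a => (f a : ℤ) :=
  hf.congr_enc (fun _ => rfl) fun a => by simp [Code.len]

theorem PolyTime.of_natCast {f : α → ℕ} (hf : PolyTime fun a => (f a : ℤ)) : PolyTime f :=
  hf.congr_enc (fun _ => rfl) fun a => by simp [Code.len]

theorem PolyTime.pred {f : α → ℕ} (hf : PolyTime f) : PolyTime fun a => f a - 1 :=
  ((hf.natCast.pos.ite (hf.natCast.sub (.const 1)) (.const 0)).of_eq
    (g := fun a => ((f a - 1 : ℕ) : ℤ)) fun a => by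
      rcases Nat.eq_zero_or_pos (f a) with h | h
      · simp [h]
      · simp [h]).of_natCast

theorem PolyTime.nat_beq {f g : α → ℕ} (hf : PolyTime f) (hg : PolyTime g) :
    PolyTime fun a => f a == g a :=
  (hf.natCast.decide_eq hg.natCast).of_eq fun a => by
    rw [Bool.eq_iff_iff]; simp

end Arithmetic

/-! ### Loops -/

section Loops

variable {α β γ σ : Type} [Code α] [Code β] [Code γ] [Code σ]

/-- Each of the k rounds, and the final failing test, costs at most L + 1 because L covers the test,
the body and the size of the store. -/
theorem runs_while {p q : Prog} {c : σ → Bool} {b : σ → σ} {B : σ → ℕ} {C : σ → ℕ}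
    (hc : Computes q c C) (hb : Computes p b B) {L : ℕ} (k : ℕ) :
    ∀ s, (∀ i < k, c (b^[i] s) = true) → c (b^[k] s) = false →
      (∀ i ≤ k, len (b^[i] s) + B (b^[i] s) + C (b^[i] s) ≤ L) →
      ∃ t ≤ (k + 1) * (L + 1), Runs (.while q p) (enc s) (enc (b^[k] s)) t := by
  induction k with
  | zero =>
    intro s _ h hL
    obtain ⟨-, t, ht, hr⟩ := hc s
    rw [Function.iterate_zero, id] at h
    rw [h] at hr
    have h1 := hL 0 le_rfl
    have h2 := size_le s
    simp only [Function.iterate_zero, id] at h1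
    exact ⟨t + (enc s).size + 1, by omega, Runs.while_stop hr⟩
  | succ k ih =>
    intro s h0 h hL
    have h3 : ∀ i, b^[i] (b s) = b^[i + 1] s := fun i => (Function.iterate_succ_apply b i s).symm
    obtain ⟨t, ht, hr⟩ := ih (b s) (fun i hi => by rw [h3]; exact h0 _ (by omega))
      (by rw [h3]; exact h) (fun i hi => by rw [h3]; exact hL _ (by omega))
    obtain ⟨-, u, hu, hru⟩ := hc s
    obtain ⟨-, v, hv, hrv⟩ := hb s
    have h1 := hL 0 (by omega)
    have h2 := size_le s
    have h4 : c s = true := h0 0 (by omega)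
    simp only [Function.iterate_zero, id] at h1
    rw [h4] at hru
    refine ⟨u + v + t + (enc s).size + 1, ?_, ?_⟩
    · rw [Nat.succ_mul (k + 1)]; omega
    · rw [← h3]
      exact Runs.while_step hru (by simp [enc]) hrv hr

/-- A loop runs in polynomial time if the number of rounds and the length of the state are
polynomially bounded. -/
theorem PolyTime.while {c : σ → Bool} {b : σ → σ} {f : α → σ} {k : α → ℕ} {N : α → ℕ}
    (hc : PolyTime c) (hb : PolyTime b) (hf : PolyTime f) (hk : PolyBdd k) (hN : PolyBdd N)
    (h1 : ∀ a, ∀ i < k a, c (b^[i] (f a)) = true) (h0 : ∀ a, c (b^[k a] (f a)) = false)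
    (hlen : ∀ a, ∀ i ≤ k a, Code.len (b^[i] (f a)) ≤ N a) :
    PolyTime fun a => b^[k a] (f a) := by
  obtain ⟨q, C, ⟨m, hC⟩, hq⟩ := hc
  obtain ⟨p, B, ⟨l, hB⟩, hp⟩ := hb
  obtain ⟨r, A, hA, hr⟩ := hf
  set L : α → ℕ := fun a => N a + (N a + 1) ^ l + (N a + 1) ^ m with hL
  have hLb : PolyBdd L :=
    (hN.add ((hN.add (PolyBdd.const 1)).pow l)).add ((hN.add (PolyBdd.const 1)).pow m)
  refine ⟨.seq r (.while q p), fun a => N a + (A a + ((k a + 1) * (L a + 1)) + 1),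
    hN.add ((hA.add ((hk.add (PolyBdd.const 1)).mul (hLb.add (PolyBdd.const 1)))).add
      (PolyBdd.const 1)), fun a => ?_⟩
  obtain ⟨-, s, hs, hrs⟩ := hr a
  obtain ⟨t, ht, hrt⟩ := runs_while hq hp (L := L a) (k a) (f a) (h1 a) (h0 a) (fun i hi => by
    have h2 := hlen a i hi
    have h3 := (hB (b^[i] (f a))).trans (Nat.pow_le_pow_left (Nat.succ_le_succ h2) l)
    have h4 := (hC (b^[i] (f a))).trans (Nat.pow_le_pow_left (Nat.succ_le_succ h2) m)
    simp only [hL]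
    exact Nat.add_le_add (Nat.add_le_add h2 h3) h4)
  exact ⟨(hlen a _ le_rfl).trans (by simp), s + t + 1, by simp only; omega, Runs.seq hrs hrt⟩

/-- Folds run in polynomial time if the length of the state is polynomially bounded. -/
theorem PolyTime.foldl {l : α → List β} {i : α → σ} {h : α → σ → β → σ} (hl : PolyTime l)
    (hi : PolyTime i) (hh : PolyTime fun p : α × σ × β => h p.1 p.2.1 p.2.2)
    {N : α → ℕ} (hN : PolyBdd N)
    (hlen : ∀ a k, Code.len (((l a).take k).foldl (h a) (i a)) ≤ N a) :
    PolyTime fun a => (l a).foldl (h a) (i a) := by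
  classical
  rcases isEmpty_or_nonempty β with hβ | ⟨⟨x₀⟩⟩
  · refine hi.of_eq fun a => ?_
    rcases hla : l a with _ | ⟨x, _⟩
    · rfl
    · exact hβ.elim x
  -- Programs have no variables, so the loop state carries the parameter along with the accumulator
  -- and the unread part of the list. The default `x₀` is never read, since the head is taken of a
  -- nonempty list only.
  let b : α × σ × List β → α × σ × List β := fun p =>
    bif !p.2.2.isEmpty then (p.1, h p.1 p.2.1 (p.2.2.headD x₀), p.2.2.tail) else p
  have hb : PolyTime b := by
    have e1 : PolyTime fun p : α × σ × List β => p.1 := PolyTime.id.fst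
    have e2 : PolyTime fun p : α × σ × List β => p.2.1 := PolyTime.id.snd.fst
    have e3 : PolyTime fun p : α × σ × List β => p.2.2 := PolyTime.id.snd.snd
    exact e3.isCons.ite (e1.pair ((PolyTime.comp (g := fun p : α × σ × β => h p.1 p.2.1 p.2.2) hh
      (e1.pair (e2.pair (e3.headD (.const x₀))))).pair e3.tail)) .id
  have hit : ∀ a k, k ≤ (l a).length →
      b^[k] (a, i a, l a) = (a, ((l a).take k).foldl (h a) (i a), (l a).drop k) := by
    intro a k hk
    induction k with
    | zero => simp
    | succ k ih =>
      rw [Function.iterate_succ_apply', ih (by omega)]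
      have h2 : (l a).drop k = (l a)[k] :: (l a).drop (k + 1) := List.drop_eq_getElem_cons (by omega)
      simp only [b, h2, List.isEmpty_cons, Bool.not_false, cond_true, List.headD_cons, List.tail_cons]
      rw [List.take_succ_eq_append_getElem (by omega), List.foldl_append]
      rfl
  have key : PolyTime fun a => b^[(l a).length] (a, i a, l a) := by
    refine PolyTime.while (c := fun p : α × σ × List β => !p.2.2.isEmpty)
      (N := fun a => Code.len a + (N a + Code.len (l a) + 1) + 1)
      PolyTime.id.snd.snd.isCons hb (PolyTime.id.pair (hi.pair hl))
      (hl.len.mono fun a => length_le_len (l a))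
      ((PolyBdd.len.add ((hN.add hl.len).add (PolyBdd.const 1))).add (PolyBdd.const 1)) ?_ ?_ ?_
    · intro a k hk
      rw [hit a k hk.le]
      simp [hk]
    · intro a
      rw [hit a _ le_rfl]
      simp
    · intro a k hk
      rw [hit a k hk]
      simp only [len_pair]
      have h1 := hlen a k
      have h2 := len_drop_le (l a) k
      omega
  refine key.snd.fst.of_eq fun a => ?_
  rw [hit a _ le_rfl]
  simp

theorem len_foldl_le {σ β : Type} [Code σ] {h : σ → β → σ} {l : List β} {s : σ} {K : ℕ}
    (hK : ∀ s, ∀ x ∈ l, len (h s x) ≤ len s + K) :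
    len (l.foldl h s) ≤ len s + l.length * K := by
  induction l generalizing s with
  | nil => simp
  | cons x l ih =>
    have h1 := hK s x List.mem_cons_self
    have h2 := ih (s := h s x) fun s y hy => hK s y (List.mem_cons_of_mem _ hy)
    rw [List.foldl_cons, List.length_cons, Nat.succ_mul]; omega

/-- Folds run in polynomial time if every step lengthens the state by a bounded amount. -/
theorem PolyTime.foldl_of_add {l : α → List β} {i : α → σ} {h : α → σ → β → σ} (hl : PolyTime l)
    (hi : PolyTime i) (hh : PolyTime fun p : α × σ × β => h p.1 p.2.1 p.2.2)
    {K : α → ℕ} (hK : PolyBdd K)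
    (hstep : ∀ a s, ∀ x ∈ l a, Code.len (h a s x) ≤ Code.len s + K a) :
    PolyTime fun a => (l a).foldl (h a) (i a) := by
  refine hl.foldl hi hh (N := fun a => Code.len (i a) + Code.len (l a) * K a)
    (hi.len.add (hl.len.mul hK)) fun a k => ?_
  refine (len_foldl_le fun s x hx => hstep a s x (List.mem_of_mem_take hx)).trans ?_
  refine Nat.add_le_add_left (Nat.mul_le_mul_right _ ?_) _
  exact (length_le_len _).trans (len_take_le _ _)

theorem PolyTime.reverse {l : α → List β} (hl : PolyTime l) : PolyTime fun a => (l a).reverse := by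
  have e : PolyTime fun a => (l a).foldl (fun s x => x :: s) [] :=
    hl.foldl_of_add .nil (h := fun _ s x => x :: s) (PolyTime.id.snd.snd.cons PolyTime.id.snd.fst)
      (K := fun a => Code.len (l a) + 1) (hl.len.add (PolyBdd.const 1)) fun a s x hx => by
        have := len_le_of_mem hx
        rw [len_cons]; omega
  exact e.of_eq fun a => by simp

theorem PolyTime.append {l l' : α → List β} (hl : PolyTime l) (hl' : PolyTime l') :
    PolyTime fun a => l a ++ l' a := by
  have e : PolyTime fun a => (l a).reverse.foldl (fun s x => x :: s) (l' a) :=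
    hl.reverse.foldl_of_add hl' (h := fun _ s x => x :: s)
      (PolyTime.id.snd.snd.cons PolyTime.id.snd.fst)
      (K := fun a => Code.len (l a) + 1) (hl.len.add (PolyBdd.const 1)) fun a s x hx => by
        have := len_le_of_mem (List.mem_reverse.1 hx)
        rw [len_cons]; omega
  exact e.of_eq fun a => by simp

theorem PolyTime.flatten {l : α → List (List β)} (hl : PolyTime l) :
    PolyTime fun a => (l a).flatten := by
  have e : PolyTime fun a => (l a).foldl (fun s x => s ++ x) [] :=
    hl.foldl_of_add .nil (h := fun _ s x => s ++ x)
      (PolyTime.id.snd.fst.append PolyTime.id.snd.snd)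
      (K := fun a => Code.len (l a)) hl.len fun a s x hx => by
        have := len_le_of_mem hx
        have := len_append s x
        omega
  exact e.of_eq fun a => by
    have h : ∀ (m : List (List β)) (s : List β), m.foldl (fun s x => s ++ x) s = s ++ m.flatten := by
      intro m
      induction m with
      | nil => simp
      | cons x m ih => intro s; rw [List.foldl_cons, ih]; simp
    rw [h]; simp

theorem PolyTime.map {l : α → List β} {f : α → β → γ} (hl : PolyTime l)
    (hf : PolyTime fun p : α × β => f p.1 p.2) : PolyTime fun a => (l a).map (f a) := by
  obtain ⟨m, hm⟩ := hf.len
  have e : PolyTime fun a => (l a).foldl (fun s x => f a x :: s) [] :=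
    hl.foldl_of_add .nil (h := fun a s x => f a x :: s)
      (PolyTime.cons (PolyTime.comp (g := fun p : α × β => f p.1 p.2) hf
        (PolyTime.id.fst.pair PolyTime.id.snd.snd)) PolyTime.id.snd.fst)
      (K := fun a => (Code.len a + Code.len (l a) + 1 + 1) ^ m + 1)
      (((((PolyBdd.len.add hl.len).add (PolyBdd.const 1)).add (PolyBdd.const 1)).pow m).add
        (PolyBdd.const 1)) fun a s x hx => by
        have h1 := len_le_of_mem hx
        have h2 : Code.len (f a x) ≤ _ := hm (a, x)
        rw [len_pair] at h2
        have h3 := Nat.pow_le_pow_left (show Code.len a + Code.len x + 1 + 1 ≤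
          Code.len a + Code.len (l a) + 1 + 1 by omega) m
        rw [len_cons]; omega
  refine e.reverse.of_eq fun a => ?_
  have h : ∀ (m : List β) (s : List γ),
      m.foldl (fun s x => f a x :: s) s = (m.map (f a)).reverse ++ s := by
    intro m
    induction m with
    | nil => simp
    | cons x m ih => intro s; rw [List.foldl_cons, ih]; simp
  rw [h]; simp

theorem PolyTime.filter {l : α → List β} {f : α → β → Bool} (hl : PolyTime l)
    (hf : PolyTime fun p : α × β => f p.1 p.2) : PolyTime fun a => (l a).filter (f a) := by
  refine (PolyTime.flatten (hl.map (f := fun a x => bif f a x then [x] else [])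
    (hf.ite (PolyTime.id.snd.cons .nil) .nil))).of_eq fun a => ?_
  induction l a with
  | nil => rfl
  | cons x m ih => rw [List.filter_cons, ih]; cases h : f a x <;> simp [h]

theorem PolyTime.all {l : α → List β} {f : α → β → Bool} (hl : PolyTime l)
    (hf : PolyTime fun p : α × β => f p.1 p.2) : PolyTime fun a => (l a).all (f a) := by
  refine (hl.filter (f := fun a x => !f a x) hf.not).isEmpty.of_eq fun a => ?_
  rw [Bool.eq_iff_iff]; simp [List.isEmpty_iff]

theorem PolyTime.zip {l : α → List β} {l' : α → List γ} (hl : PolyTime l) (hl' : PolyTime l') :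
    PolyTime fun a => (l a).zip (l' a) := by
  rcases isEmpty_or_nonempty γ with hγ | ⟨⟨y₀⟩⟩
  · refine PolyTime.nil.of_eq fun a => ?_
    rcases l' a with _ | ⟨y, _⟩
    · simp
    · exact hγ.elim y
  have e : PolyTime fun a => (l a).foldl (fun (s : List (β × γ) × List γ) x =>
      bif !s.2.isEmpty then ((x, s.2.headD y₀) :: s.1, s.2.tail) else s) ([], l' a) := by
    refine hl.foldl_of_add (PolyTime.nil.pair hl') (h := fun _ (s : List (β × γ) × List γ) x =>
      bif !s.2.isEmpty then ((x, s.2.headD y₀) :: s.1, s.2.tail) else s) ?_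
      (K := fun a => Code.len (l a) + 1) (hl.len.add (PolyBdd.const 1)) fun a s x hx => ?_
    · have e1 : PolyTime fun p : α × (List (β × γ) × List γ) × β => p.2.1.1 :=
        PolyTime.id.snd.fst.fst
      have e2 : PolyTime fun p : α × (List (β × γ) × List γ) × β => p.2.1.2 :=
        PolyTime.id.snd.fst.snd
      have e3 : PolyTime fun p : α × (List (β × γ) × List γ) × β => p.2.2 := PolyTime.id.snd.snd
      exact e2.isCons.ite (((e3.pair (e2.headD (.const y₀))).cons e1).pair e2.tail)
        PolyTime.id.snd.fst
    · have := len_le_of_mem hx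
      rcases s with ⟨s, _ | ⟨y, m⟩⟩
      · simp
      · simp only [List.isEmpty_cons, Bool.not_false, cond_true, List.headD_cons, List.tail_cons,
          len_pair, len_cons]
        omega
  refine e.fst.reverse.of_eq fun a => ?_
  have h : ∀ (m : List β) (s : List (β × γ)) (r : List γ),
      (m.foldl (fun (s : List (β × γ) × List γ) x =>
        bif !s.2.isEmpty then ((x, s.2.headD y₀) :: s.1, s.2.tail) else s) (s, r)).1 =
        (m.zip r).reverse ++ s := by
    intro m
    induction m with
    | nil => simp
    | cons x m ih =>
      intro s r
      rcases r with _ | ⟨y, r⟩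
      · rw [List.foldl_cons]
        simp only [List.isEmpty_nil, Bool.not_true, cond_false]
        rw [ih]; simp
      · rw [List.foldl_cons]
        simp only [List.isEmpty_cons, Bool.not_false, cond_true, List.headD_cons, List.tail_cons]
        rw [ih]; simp
  rw [h]; simp

theorem PolyTime.sum {l : α → List ℤ} (hl : PolyTime l) : PolyTime fun a => (l a).sum := by
  have e : PolyTime fun a => (l a).foldl (fun s x => s + x) 0 :=
    hl.foldl_of_add (.const 0) (h := fun _ s x => s + x)
      (PolyTime.id.snd.fst.add PolyTime.id.snd.snd)
      (K := fun a => Code.len (l a)) hl.len fun a s x hx => by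
        have := len_le_of_mem hx
        have := len_int_add_le s x
        omega
  exact e.of_eq fun a => List.sum_eq_foldl ..

theorem PolyTime.prod {l : α → List ℤ} (hl : PolyTime l) : PolyTime fun a => (l a).prod := by
  have e : PolyTime fun a => (l a).foldl (fun s x => s * x) 1 :=
    hl.foldl_of_add (.const 1) (h := fun _ s x => s * x)
      (PolyTime.id.snd.fst.mul PolyTime.id.snd.snd)
      (K := fun a => Code.len (l a)) hl.len fun a s x hx => by
        have := len_le_of_mem hx
        have := len_int_mul_le s x
        omega
  exact e.of_eq fun a => List.prod_eq_foldl ..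

/-- Numbers are coded in binary, so the value itself has to be polynomially bounded, not only its
length. The list is built by counting down, which makes prepending give the right order. -/
theorem PolyTime.range {n : α → ℕ} (hn : PolyTime n) (hb : PolyBdd n) :
    PolyTime fun a => List.range (n a) := by
  let b : ℕ × List ℕ → ℕ × List ℕ := fun s => (s.1 - 1, (s.1 - 1) :: s.2)
  have hit : ∀ a k, k ≤ n a → b^[k] (n a, []) = (n a - k, (List.range k).map (n a - k + ·)) := by
    intro a k hk
    induction k with
    | zero => simp
    | succ k ih =>
      rw [Function.iterate_succ_apply', ih (by omega)]
      simp only [b, List.range_succ_eq_map, List.map_cons, List.map_map, Prod.mk.injEq,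
        List.cons.injEq, List.map_inj_left]
      refine ⟨by omega, by omega, fun x _ => ?_⟩
      simp only [Function.comp]; omega
  have hlen : ∀ {m N : ℕ}, m ≤ N → Code.len m ≤ N + 1 := fun {m N} h => by
    have : Nat.size m ≤ m := Nat.size_le.2 Nat.lt_two_pow_self
    simp only [Code.len]; omega
  have key : PolyTime fun a => b^[n a] (n a, []) := by
    refine PolyTime.while (c := fun s : ℕ × List ℕ => decide (0 < (s.1 : ℤ)))
      (N := fun a => n a + 1 + (n a * (n a + 1 + 1) + 1) + 1)
      PolyTime.id.fst.natCast.pos (PolyTime.id.fst.pred.pair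
        (PolyTime.id.fst.pred.cons PolyTime.id.snd)) (hn.pair .nil) hb
      (((hb.add (PolyBdd.const 1)).add ((hb.mul ((hb.add (PolyBdd.const 1)).add
        (PolyBdd.const 1))).add (PolyBdd.const 1))).add (PolyBdd.const 1)) ?_ ?_ ?_
    · intro a k hk
      rw [hit a k hk.le]
      simp [hk]
    · intro a
      rw [hit a _ le_rfl]
      simp
    · intro a k hk
      rw [hit a k hk, len_pair]
      have h1 := hlen (Nat.sub_le (n a) k)
      have h2 : Code.len ((List.range k).map (n a - k + ·)) ≤ n a * (n a + 1 + 1) + 1 := by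
        refine len_le_of_forall (by simpa using hk) fun x hx => ?_
        obtain ⟨j, hj, rfl⟩ := List.mem_map.1 hx
        have := List.mem_range.1 hj
        exact hlen (by omega)
      omega
  refine key.snd.of_eq fun a => ?_
  rw [hit a _ le_rfl]
  simp

end Loops

/-! ### The algorithm -/

namespace Alg

/-- The parity of the number of common ones of two Boolean vectors. -/
def parity (A v : List Bool) : Bool := (A.zip v).foldl (fun s p => s ^^ (p.1 && p.2)) false

def vadd (u v : List Bool) : List Bool := (u.zip v).map fun p => p.1 ^^ p.2

/-- Generators of the points of the affine span of `P` that satisfy the parity equation `E`. -/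
def restrict (P : List (List Bool)) (E : List Bool) : List (List Bool) :=
  bif (P.filter fun v => !parity E v).isEmpty then [] else
    (P.filter fun v => !parity E v) ++ (P.filter fun v => parity E v).map fun o =>
      vadd ((P.filter fun v => !parity E v).headD []) (vadd ((P.filter fun v => parity E v).headD []) o)

def unitVec (ns : List ℕ) (i : ℕ) : List Bool := ns.map fun j => j == i

/-- Generators of a product of two affine spaces. -/
def product (P R : List (List Bool)) : List (List Bool) :=
  bif P.isEmpty || R.isEmpty then [] else
    (P.map fun p => p ++ R.headD []) ++ R.map fun r => P.headD [] ++ r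

/-- The equations `x_{i_j} = y_j` that identify the variables of a constraint. -/
def equations (ns scope : List ℕ) : List (List Bool) :=
  (scope.zip (List.range scope.length)).map fun p =>
    unitVec ns p.1 ++ unitVec (List.range scope.length) p.2

/-- The points are pairs of an assignment and a tuple, cut down by the linking equations. Zipping
with `ns` truncates to the first coordinates, which is the projection back to assignments. -/
def addConstraint (ns : List ℕ) (P : List (List Bool)) (c : List ℕ × List (List Bool)) :
    List (List Bool) :=
  ((equations ns c.1).foldl restrict (product P c.2)).map fun v => (v.zip ns).map Prod.fst

/-- Generators of the affine space of all solutions. -/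
def generators (ns : List ℕ) (cs : List (List ℕ × List (List Bool))) : List (List Bool) :=
  cs.foldl (addConstraint ns) ((ns.map fun _ => false) :: ns.map (unitVec ns))

/-- From the Boolean vectors of length `k` sorted by weight to those of length `k + 1`. -/
def nextRows (rows : List (List (List Bool))) : List (List (List Bool)) :=
  (rows.zip ([] :: rows)).map fun p =>
    (p.1.map fun v => false :: v) ++ p.2.map fun v => true :: v

/-- Row j holds the vectors of weight j, as in Pascal's triangle. Only the lengths of `ns` and `ds`
matter; they serve as unary counters for n and d. -/
def monomialRows (ns ds : List ℕ) : List (List (List Bool)) :=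
  ns.foldl (fun rows _ => nextRows rows) ([[]] :: ds.map fun _ => [])

/-- The product of the two characters is compared at every generator with its value at the first
one. -/
def equivTest (P : List (List Bool)) (A B : List Bool) : Bool :=
  P.all fun v => !((parity A v ^^ parity B v) ^^ (parity A (P.headD []) ^^ parity B (P.headD [])))

def subset (A B : List Bool) : Bool := (A.zip B).all fun p => !p.1 || p.2

def vecEq (A B : List Bool) : Bool := (A.zip B).all fun p => !(p.1 ^^ p.2)

/-- The first monomial that agrees with `B` up to sign as a character of the affine span of `P`. -/
def rep (ms P : List (List Bool)) (B : List Bool) : List Bool :=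
  (ms.filter fun C => equivTest P B C).headD B

def isStd (ms P : List (List Bool)) (A : List Bool) : Bool := vecEq (rep ms P A) A

def weightedPow (c : ℤ) (A : List Bool) : ℤ := (A.map fun b => bif b then c else 1).prod

def weight (A : List Bool) : ℤ := (A.map fun b => bif b then (1 : ℤ) else 0).sum

/-- The factor of proportionality between the character of `B` and that of its representative can be
read off at any one point of the span; the first generator is used. -/
def signOf (ms P : List (List Bool)) (B : List Bool) : ℤ :=
  bif parity B (P.headD []) ^^ parity (rep ms P B) (P.headD []) then -1 else 1

/-- `2 ^ |A|` times the coefficient at `D` of the difference of the monomial `A` and its normal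
form. -/
def coef (ms P : List (List Bool)) (A D : List Bool) : ℤ :=
  (bif vecEq D A then weightedPow 2 A else 0) -
    ((ms.filter fun B => subset B A && subset D (rep ms P B)).map fun B =>
      weightedPow (-1) B * signOf ms P B * weightedPow (-2) D).sum

def poly (ms P : List (List Bool)) (A : List Bool) : List ((ℤ × ℤ) × List ℕ) :=
  (ms.filter fun D => !decide (coef ms P A D = 0)).map fun D =>
    ((coef ms P A D, weightedPow 2 A), D.map Bool.toNat)

def isMinimal (ms P : List (List Bool)) (A : List Bool) : Bool :=
  !isStd ms P A && ms.all fun B => !subset B A || (vecEq B A || isStd ms P B)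

def squares (ms P : List (List Bool)) : List (List ((ℤ × ℤ) × List ℕ)) :=
  (ms.filter fun A => decide (weight A = 1) && isStd ms P A).map fun A =>
    [((1, 1), A.map fun b => bif b then 2 else 0), ((-1, 1), A.map Bool.toNat)]

/-- Without generators there is no solution and the ideal is the whole ring, with reduced basis {1}.
The squares have degree 2 and are dropped when d < 2. -/
def basis (d : ℕ) (ns : List ℕ) (ms P : List (List Bool)) : List (List ((ℤ × ℤ) × List ℕ)) :=
  bif P.isEmpty then [[((1, 1), ns.map fun _ => 0)]] else
    (bif decide ((1 : ℤ) < d) then squares ms P else []) ++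
      (ms.filter fun A => isMinimal ms P A).map fun A => poly ms P A

end Alg

open Alg

section PolyTime

variable {α β : Type} [Code α] [Code β]

theorem PolyTime.of_fst {f : α → β} (hf : PolyTime f) {γ : Type} [Code γ] :
    PolyTime fun p : α × γ => f p.1 := hf.comp PolyTime.id.fst

theorem PolyTime.length {f : α → List β} (hf : PolyTime f) : PolyTime fun a => (f a).length :=
  ((hf.map (f := fun _ _ => (1 : ℤ)) (.const 1)).sum.of_eq fun a => by simp).of_natCast

theorem PolyTime.parity {f g : α → List Bool} (hf : PolyTime f) (hg : PolyTime g) :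
    PolyTime fun a => parity (f a) (g a) := by
  refine (hf.zip hg).foldl_of_add (.const false) ?_ (K := fun _ => 0) (PolyBdd.const 0)
    (fun a s x _ => le_rfl)
  exact PolyTime.id.snd.fst.xor (PolyTime.id.snd.snd.fst.and PolyTime.id.snd.snd.snd)

theorem PolyTime.vadd {f g : α → List Bool} (hf : PolyTime f) (hg : PolyTime g) :
    PolyTime fun a => vadd (f a) (g a) :=
  (hf.zip hg).map (PolyTime.id.snd.fst.xor PolyTime.id.snd.snd)

theorem PolyTime.restrict {f : α → List (List Bool)} {g : α → List Bool} (hf : PolyTime f)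
    (hg : PolyTime g) : PolyTime fun a => restrict (f a) (g a) := by
  have h1 : PolyTime fun a => (f a).filter fun v => !Alg.parity (g a) v :=
    hf.filter (hg.of_fst.parity PolyTime.id.snd).not
  have h2 : PolyTime fun a => (f a).filter fun v => Alg.parity (g a) v :=
    hf.filter (hg.of_fst.parity PolyTime.id.snd)
  refine h1.isEmpty.ite .nil (h1.append (h2.map ?_))
  exact (h1.headD .nil).of_fst.vadd ((h2.headD .nil).of_fst.vadd PolyTime.id.snd)

theorem PolyTime.unitVec {f : α → List ℕ} {g : α → ℕ} (hf : PolyTime f) (hg : PolyTime g) :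
    PolyTime fun a => unitVec (f a) (g a) :=
  hf.map (PolyTime.id.snd.nat_beq hg.of_fst)

theorem PolyTime.product {f g : α → List (List Bool)} (hf : PolyTime f) (hg : PolyTime g) :
    PolyTime fun a => product (f a) (g a) := by
  refine (hf.isEmpty.or hg.isEmpty).ite .nil ((hf.map ?_).append (hg.map ?_))
  · exact PolyTime.id.snd.append (hg.headD .nil).of_fst
  · exact (hf.headD .nil).of_fst.append PolyTime.id.snd

theorem PolyTime.equations {f g : α → List ℕ} (hf : PolyTime f) (hg : PolyTime g) :
    PolyTime fun a => equations (f a) (g a) := by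
  have h1 : PolyTime fun a => List.range (g a).length :=
    hg.length.range (hg.len.mono fun a => length_le_len _)
  refine (hg.zip h1).map ?_
  exact (hf.of_fst.unitVec PolyTime.id.snd.fst).append (h1.of_fst.unitVec PolyTime.id.snd.snd)

theorem length_vadd_le (u v : List Bool) : (Alg.vadd u v).length ≤ v.length := by
  simp [Alg.vadd]

/-- All vectors of the list have length at most `N`, and there are at most `K` of them. -/
def Bounded (N K : ℕ) (P : List (List Bool)) : Prop := P.length ≤ K ∧ ∀ v ∈ P, v.length ≤ N

theorem len_listBool (v : List Bool) : len v = 3 * v.length + 1 := by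
  induction v with
  | nil => rfl
  | cons b v ih => rw [len_cons, ih, List.length_cons]; simp only [len]; omega

theorem Bounded.len_le {N K : ℕ} {P : List (List Bool)} (h : Bounded N K P) :
    len P ≤ K * (3 * N + 2) + 1 :=
  len_le_of_forall h.1 fun v hv => by rw [len_listBool]; have := h.2 v hv; omega

theorem Bounded.mono {N K N' K' : ℕ} {P : List (List Bool)} (h : Bounded N K P) (hN : N ≤ N')
    (hK : K ≤ K') : Bounded N' K' P := ⟨h.1.trans hK, fun v hv => (h.2 v hv).trans hN⟩

/-- Every old generator yields at most one new one: it is kept if it satisfies the equation and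
translated otherwise. -/
theorem Bounded.restrict {N K : ℕ} {P : List (List Bool)} (h : Bounded N K P) (E : List Bool) :
    Bounded N K (restrict P E) := by
  unfold Alg.restrict
  cases (P.filter fun v => !Alg.parity E v).isEmpty
  · rw [cond_false]
    refine ⟨?_, fun v hv => ?_⟩
    · have h1 := List.length_eq_length_filter_add (l := P) (fun v => Alg.parity E v)
      have h2 := h.1
      simp only [List.length_append, List.length_map]
      omega
    · rcases List.mem_append.1 hv with hv | hv
      · exact h.2 v (List.mem_of_mem_filter hv)
      · obtain ⟨o, ho, rfl⟩ := List.mem_map.1 hv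
        exact (length_vadd_le _ _).trans ((length_vadd_le _ _).trans
          (h.2 o (List.mem_of_mem_filter ho)))
  · rw [cond_true]
    exact ⟨by simp, by simp⟩

theorem Bounded.foldl_restrict {N K : ℕ} {P : List (List Bool)} (h : Bounded N K P)
    (Es : List (List Bool)) : Bounded N K (Es.foldl Alg.restrict P) := by
  induction Es generalizing P with
  | nil => exact h
  | cons E Es ih => exact ih (h.restrict E)

theorem length_headD_nil_le {N : ℕ} {P : List (List Bool)} (h : ∀ v ∈ P, v.length ≤ N) :
    (P.headD []).length ≤ N := by
  rcases P with _ | ⟨p, P⟩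
  · simp
  · exact h p List.mem_cons_self

theorem Bounded.product {N K N' K' : ℕ} {P R : List (List Bool)} (h : Bounded N K P)
    (h' : Bounded N' K' R) : Bounded (N + N') (K + K') (product P R) := by
  unfold Alg.product
  cases P.isEmpty || R.isEmpty
  · rw [cond_false]
    refine ⟨?_, fun v hv => ?_⟩
    · have := h.1
      have := h'.1
      simp only [List.length_append, List.length_map]
      omega
    · rcases List.mem_append.1 hv with hv | hv
      · obtain ⟨p, hp, rfl⟩ := List.mem_map.1 hv
        rw [List.length_append]
        exact Nat.add_le_add (h.2 p hp) (length_headD_nil_le h'.2)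
      · obtain ⟨p, hp, rfl⟩ := List.mem_map.1 hv
        rw [List.length_append]
        exact Nat.add_le_add (length_headD_nil_le h.2) (h'.2 p hp)
  · rw [cond_true]
    exact ⟨by simp, by simp⟩

theorem bounded_len (P : List (List Bool)) : Bounded (len P) (len P) P :=
  ⟨length_le_len P, fun v hv => (length_le_len v).trans (len_le_of_mem hv)⟩

theorem PolyTime.foldl_restrict {f g : α → List (List Bool)} (hf : PolyTime f) (hg : PolyTime g) :
    PolyTime fun a => (g a).foldl Alg.restrict (f a) := by
  refine PolyTime.foldl (h := fun _ => Alg.restrict) hg hf ?_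
    (N := fun a => Code.len (f a) * (3 * Code.len (f a) + 2) + 1) ?_ fun a k =>
      ((bounded_len (f a)).foldl_restrict _).len_le
  · exact PolyTime.id.snd.fst.restrict PolyTime.id.snd.snd
  · exact (hf.len.mul (((PolyBdd.const 3).mul hf.len).add (PolyBdd.const 2))).add (PolyBdd.const 1)

theorem PolyTime.addConstraint {f : α → List ℕ} {g : α → List (List Bool)}
    {h : α → List ℕ × List (List Bool)} (hf : PolyTime f) (hg : PolyTime g) (hh : PolyTime h) :
    PolyTime fun a => addConstraint (f a) (g a) (h a) := by
  refine ((hg.product hh.snd).foldl_restrict (hf.equations hh.fst)).map ?_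
  exact (PolyTime.id.snd.zip hf.of_fst).map PolyTime.id.snd.fst

/-- The number of generators grows additively, by at most the length of the constraint, and the
projection resets the length of the vectors. This keeps the fold over all constraints polynomial. -/
theorem Bounded.addConstraint {N K : ℕ} {P : List (List Bool)} {ns : List ℕ}
    {c : List ℕ × List (List Bool)} (h : Bounded N K P) :
    Bounded ns.length (K + len c) (addConstraint ns P c) := by
  have h1 : len c.2 ≤ len c := by
    rcases c with ⟨s, R⟩; rw [len_pair]; simp only; omega
  refine ⟨?_, fun v hv => ?_⟩
  · rw [Alg.addConstraint, List.length_map]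
    exact ((((h.product (bounded_len c.2)).foldl_restrict _).mono le_rfl
      (Nat.add_le_add_left h1 K))).1
  · obtain ⟨u, -, rfl⟩ := List.mem_map.1 hv
    simp

theorem Bounded.foldl_addConstraint {K : ℕ} {P : List (List Bool)} {ns : List ℕ}
    (h : Bounded ns.length K P) (cs : List (List ℕ × List (List Bool))) :
    Bounded ns.length (K + len cs) (cs.foldl (Alg.addConstraint ns) P) := by
  induction cs generalizing P K with
  | nil => exact h.mono le_rfl (by omega)
  | cons c cs ih =>
    exact (ih (h.addConstraint (c := c))).mono le_rfl (by rw [len_cons]; omega)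

theorem PolyTime.generators {f : α → List ℕ} {g : α → List (List ℕ × List (List Bool))}
    (hf : PolyTime f) (hg : PolyTime g) : PolyTime fun a => generators (f a) (g a) := by
  refine hg.foldl (h := fun a => Alg.addConstraint (f a))
    ((hf.map (f := fun _ _ => false) (.const false)).cons
      (hf.map (hf.of_fst.unitVec PolyTime.id.snd)))
    (hf.of_fst.addConstraint PolyTime.id.snd.fst PolyTime.id.snd.snd)
    (N := fun a => (Code.len (f a) + 1 + Code.len (g a)) * (3 * Code.len (f a) + 2) + 1) ?_ fun a k => ?_
  · exact (((hf.len.add (PolyBdd.const 1)).add hg.len).mul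
      (((PolyBdd.const 3).mul hf.len).add (PolyBdd.const 2))).add (PolyBdd.const 1)
  · refine (((Bounded.foldl_addConstraint (K := Code.len (f a) + 1) ⟨?_, ?_⟩ _).mono
      (length_le_len (f a)) (Nat.add_le_add_left (len_take_le _ _) _))).len_le
    · simpa using length_le_len (f a)
    · intro v hv
      rcases List.mem_cons.1 hv with rfl | hv
      · simp
      · obtain ⟨i, -, rfl⟩ := List.mem_map.1 hv
        simp [Alg.unitVec]

theorem PolyTime.nextRows {f : α → List (List (List Bool))} (hf : PolyTime f) :
    PolyTime fun a => nextRows (f a) := by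
  refine (hf.zip (PolyTime.nil.cons hf)).map (PolyTime.append ?_ ?_)
  · exact PolyTime.id.snd.fst.map ((PolyTime.const false).cons PolyTime.id.snd)
  · exact PolyTime.id.snd.snd.map ((PolyTime.const true).cons PolyTime.id.snd)

theorem PolyTime.equivTest {f : α → List (List Bool)} {g h : α → List Bool} (hf : PolyTime f)
    (hg : PolyTime g) (hh : PolyTime h) : PolyTime fun a => equivTest (f a) (g a) (h a) := by
  have h0 := hf.headD .nil
  refine hf.all (PolyTime.not (PolyTime.xor ?_ ?_))
  · exact (hg.of_fst.parity PolyTime.id.snd).xor (hh.of_fst.parity PolyTime.id.snd)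
  · exact ((hg.parity h0).xor (hh.parity h0)).of_fst

theorem PolyTime.subset {f g : α → List Bool} (hf : PolyTime f) (hg : PolyTime g) :
    PolyTime fun a => subset (f a) (g a) :=
  (hf.zip hg).all (PolyTime.id.snd.fst.not.or PolyTime.id.snd.snd)

theorem PolyTime.vecEq {f g : α → List Bool} (hf : PolyTime f) (hg : PolyTime g) :
    PolyTime fun a => vecEq (f a) (g a) :=
  (hf.zip hg).all (PolyTime.id.snd.fst.xor PolyTime.id.snd.snd).not

theorem PolyTime.toNat {f : α → Bool} (hf : PolyTime f) : PolyTime fun a => (f a).toNat :=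
  (hf.ite (.const 1) (.const 0)).of_eq fun a => by cases f a <;> rfl

variable {m P : α → List (List Bool)} {f g : α → List Bool}

theorem PolyTime.rep (hm : PolyTime m) (hP : PolyTime P) (hf : PolyTime f) :
    PolyTime fun a => rep (m a) (P a) (f a) :=
  (hm.filter (hP.of_fst.equivTest hf.of_fst PolyTime.id.snd)).headD hf

theorem PolyTime.isStd (hm : PolyTime m) (hP : PolyTime P) (hf : PolyTime f) :
    PolyTime fun a => isStd (m a) (P a) (f a) :=
  (hm.rep hP hf).vecEq hf

theorem PolyTime.weightedPow (c : ℤ) (hf : PolyTime f) : PolyTime fun a => weightedPow c (f a) :=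
  (hf.map (PolyTime.id.snd.ite (.const c) (.const 1))).prod

theorem PolyTime.weight (hf : PolyTime f) : PolyTime fun a => weight (f a) :=
  (hf.map (PolyTime.id.snd.ite (.const 1) (.const 0))).sum

theorem PolyTime.signOf (hm : PolyTime m) (hP : PolyTime P) (hf : PolyTime f) :
    PolyTime fun a => signOf (m a) (P a) (f a) :=
  ((hf.parity (hP.headD .nil)).xor ((hm.rep hP hf).parity (hP.headD .nil))).ite (.const (-1))
    (.const 1)

theorem PolyTime.coef (hm : PolyTime m) (hP : PolyTime P) (hf : PolyTime f) (hg : PolyTime g) :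
    PolyTime fun a => coef (m a) (P a) (f a) (g a) := by
  refine ((hg.vecEq hf).ite (hf.weightedPow 2) (.const 0)).sub (PolyTime.sum (PolyTime.map
    (hm.filter (PolyTime.and ?_ ?_)) (PolyTime.mul (PolyTime.mul ?_ ?_) ?_)))
  · exact PolyTime.id.snd.subset hf.of_fst
  · exact hg.of_fst.subset (hm.of_fst.rep hP.of_fst PolyTime.id.snd)
  · exact PolyTime.id.snd.weightedPow (-1)
  · exact hm.of_fst.signOf hP.of_fst PolyTime.id.snd
  · exact hg.of_fst.weightedPow (-2)

theorem PolyTime.poly (hm : PolyTime m) (hP : PolyTime P) (hf : PolyTime f) :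
    PolyTime fun a => poly (m a) (P a) (f a) := by
  have hc : PolyTime fun p : α × List Bool => Alg.coef (m p.1) (P p.1) (f p.1) p.2 :=
    hm.of_fst.coef hP.of_fst hf.of_fst PolyTime.id.snd
  refine (hm.filter (hc.decide_eq (.const 0)).not).map
    ((hc.pair (hf.of_fst.weightedPow 2)).pair ?_)
  exact PolyTime.id.snd.map (f := fun _ => Bool.toNat) PolyTime.id.snd.toNat

theorem PolyTime.isMinimal (hm : PolyTime m) (hP : PolyTime P) (hf : PolyTime f) :
    PolyTime fun a => isMinimal (m a) (P a) (f a) := by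
  refine (hm.isStd hP hf).not.and (hm.all (PolyTime.or (PolyTime.not ?_) (PolyTime.or ?_ ?_)))
  · exact PolyTime.id.snd.subset hf.of_fst
  · exact PolyTime.id.snd.vecEq hf.of_fst
  · exact hm.of_fst.isStd hP.of_fst PolyTime.id.snd

theorem PolyTime.squares (hm : PolyTime m) (hP : PolyTime P) :
    PolyTime fun a => squares (m a) (P a) := by
  refine (hm.filter ((PolyTime.id.snd.weight.decide_eq (.const 1)).and
    (hm.of_fst.isStd hP.of_fst PolyTime.id.snd))).map
    (((PolyTime.const (1, 1)).pair ?_).cons (((PolyTime.const (-1, 1)).pair ?_).cons .nil))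
  · exact PolyTime.id.snd.map (f := fun _ b => bif b then 2 else 0)
      (PolyTime.id.snd.ite (.const 2) (.const 0))
  · exact PolyTime.id.snd.map (f := fun _ => Bool.toNat) PolyTime.id.snd.toNat

theorem PolyTime.basis {d : α → ℕ} {ns : α → List ℕ} (hd : PolyTime d) (hn : PolyTime ns)
    (hm : PolyTime m) (hP : PolyTime P) : PolyTime fun a => basis (d a) (ns a) (m a) (P a) := by
  refine hP.isEmpty.ite (((PolyTime.const (1, 1)).pair ?_ |>.cons .nil).cons .nil)
    (PolyTime.append (((PolyTime.const 1).decide_lt hd.natCast).ite (hm.squares hP) .nil) ?_)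
  · exact hn.map (f := fun _ _ => 0) (.const 0)
  · exact (hm.filter (hm.of_fst.isMinimal hP.of_fst PolyTime.id.snd)).map
      (hm.of_fst.poly hP.of_fst PolyTime.id.snd)

end PolyTime

/-! ### The program -/

/-- Inputs: the number of variables, the degree bound and the constraints. -/
structure Input where
  n : ℕ
  d : ℕ
  cs : List (List ℕ × List (List Bool))

/-- The length of an input takes the number of monomials of degree at most `d` into account. -/
instance : Code Input :=
  ⟨fun w => enc (w.n, w.d, w.cs), fun w => len (w.n, w.d, w.cs) + max w.n 2 ^ max w.d 1,
    fun w => (size_le (w.n, w.d, w.cs)).trans (Nat.le_add_right _ _)⟩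

/-- The Boolean vectors of length `k` with `j` ones, in increasing lexicographic order. -/
def vecsOfWeight : ℕ → ℕ → List (List Bool)
  | 0, 0 => [[]]
  | 0, _ + 1 => []
  | k + 1, 0 => (vecsOfWeight k 0).map fun v => false :: v
  | k + 1, j + 1 => ((vecsOfWeight k (j + 1)).map fun v => false :: v) ++
      (vecsOfWeight k j).map fun v => true :: v

/-- Pascal's recursion: the empty row put in front shifts the rows by one, so that each row meets
the row of the next smaller weight. -/
theorem nextRows_vecsOfWeight (k d : ℕ) :
    nextRows ((List.range (d + 1)).map (vecsOfWeight k)) =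
      (List.range (d + 1)).map (vecsOfWeight (k + 1)) := by
  refine List.ext_getElem (by simp [nextRows]) fun j h1 h2 => ?_
  rcases j with _ | j <;> simp [nextRows, vecsOfWeight]

theorem monomialRows_eq (ns ds : List ℕ) :
    monomialRows ns ds = (List.range (ds.length + 1)).map (vecsOfWeight ns.length) := by
  have h0 : ([[]] :: ds.map fun _ => []) = (List.range (ds.length + 1)).map (vecsOfWeight 0) := by
    refine List.ext_getElem (by simp) fun j h1 h2 => ?_
    rcases j with _ | j <;> simp [vecsOfWeight]
  have h : ∀ k, ns.foldl (fun rows _ => nextRows rows)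
      ((List.range (ds.length + 1)).map (vecsOfWeight k)) =
        (List.range (ds.length + 1)).map (vecsOfWeight (k + ns.length)) := by
    induction ns with
    | nil => simp
    | cons i ns ih =>
      intro k
      rw [List.foldl_cons, nextRows_vecsOfWeight, ih, List.length_cons]
      congr 2; omega
  rw [monomialRows, h0, h, zero_add]

theorem length_vecsOfWeight (k j : ℕ) : (vecsOfWeight k j).length = k.choose j := by
  induction k generalizing j with
  | zero => cases j <;> simp [vecsOfWeight]
  | succ k ih =>
    cases j with
    | zero => simp [vecsOfWeight, ih]
    | succ j => simp [vecsOfWeight, ih, Nat.choose_succ_succ, add_comm]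

theorem length_of_mem_vecsOfWeight {k j : ℕ} {v : List Bool} (h : v ∈ vecsOfWeight k j) :
    v.length = k := by
  induction k generalizing j v with
  | zero => cases j <;> simp_all [vecsOfWeight]
  | succ k ih =>
    cases j with
    | zero =>
      obtain ⟨u, hu, rfl⟩ := List.mem_map.1 h
      simp [ih hu]
    | succ j =>
      rcases List.mem_append.1 h with h | h <;>
      · obtain ⟨u, hu, rfl⟩ := List.mem_map.1 h
        simp [ih hu]

theorem choose_le_pow_max {k n j d : ℕ} (hk : k ≤ n) (hj : j ≤ d) :
    k.choose j ≤ max n 2 ^ max d 1 :=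
  calc k.choose j ≤ k ^ j := Nat.choose_le_pow _ _
    _ ≤ max n 2 ^ j := Nat.pow_le_pow_left (hk.trans (le_max_left _ _)) _
    _ ≤ max n 2 ^ max d 1 := Nat.pow_le_pow_right (by simp) (hj.trans (le_max_left _ _))

/-- The list `ns` may be shorter than n because the bound is also applied to prefixes, that is, to
the intermediate states of the fold. -/
theorem len_monomialRows_le (ns ds : List ℕ) {n : ℕ} (hn : ns.length ≤ n) :
    len (monomialRows ns ds) ≤ (ds.length + 1) *
      ((max n 2 ^ max ds.length 1 * (3 * n + 2) + 1) + 1) + 1 := by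
  rw [monomialRows_eq]
  refine len_le_of_forall (by simp) fun P hP => ?_
  obtain ⟨j, hj, rfl⟩ := List.mem_map.1 hP
  rw [List.mem_range] at hj
  refine len_le_of_forall ?_ fun v hv => ?_
  · rw [length_vecsOfWeight]
    exact choose_le_pow_max hn (by omega)
  · rw [len_listBool, length_of_mem_vecsOfWeight hv]; omega

theorem PolyTime.input_triple : PolyTime fun w : Input => (w.n, w.d, w.cs) :=
  PolyTime.id.congr_enc (fun _ => rfl) fun _ => Nat.le_add_right _ _

/-- The summand max(n,2)^max(d,1) of the length dominates the values of n and d, which justifies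
counting up to them although they are coded in binary. -/
theorem n_le_len (w : Input) : w.n ≤ len w :=
  calc w.n ≤ max w.n 2 := le_max_left _ _
    _ ≤ max w.n 2 ^ max w.d 1 := Nat.le_self_pow (by simp) _
    _ ≤ len w := Nat.le_add_left _ _

theorem d_le_len (w : Input) : w.d ≤ len w :=
  calc w.d ≤ max w.d 1 := le_max_left _ _
    _ ≤ 2 ^ max w.d 1 := Nat.lt_two_pow_self.le
    _ ≤ max w.n 2 ^ max w.d 1 := Nat.pow_le_pow_left (le_max_right _ _) _
    _ ≤ len w := Nat.le_add_left _ _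

theorem PolyTime.input_n : PolyTime fun w : Input => w.n := PolyTime.input_triple.fst

theorem PolyTime.input_d : PolyTime fun w : Input => w.d := PolyTime.input_triple.snd.fst

theorem PolyTime.input_cs : PolyTime fun w : Input => w.cs := PolyTime.input_triple.snd.snd

theorem PolyTime.range_n : PolyTime fun w : Input => List.range w.n :=
  PolyTime.input_n.range (PolyBdd.len.mono n_le_len)

theorem PolyTime.range_d : PolyTime fun w : Input => List.range w.d :=
  PolyTime.input_d.range (PolyBdd.len.mono d_le_len)

theorem PolyTime.monomialRows :
    PolyTime fun w : Input => monomialRows (List.range w.n) (List.range w.d) := by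
  refine PolyTime.range_n.foldl (h := fun _ rows _ => Alg.nextRows rows)
    ((PolyTime.const [[]]).cons (PolyTime.range_d.map (f := fun _ _ => []) .nil)) PolyTime.id.snd.fst.nextRows
    (N := fun w => (Code.len w + 1) * ((Code.len w * (3 * Code.len w + 2) + 1) + 1) + 1) ?_
    fun w k => ?_
  · have h : PolyBdd fun w : Input => Code.len w := PolyBdd.len
    exact ((h.add (.const 1)).mul (((h.mul (((PolyBdd.const 3).mul h).add (.const 2))).add
      (.const 1)).add (.const 1))).add (.const 1)
  · refine (len_monomialRows_le ((List.range w.n).take k) (List.range w.d) (n := w.n)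
      (by simp)).trans ?_
    have h1 := n_le_len w
    have h2 := d_le_len w
    have h3 : max w.n 2 ^ max w.d 1 ≤ Code.len w := Nat.le_add_left _ _
    rw [List.length_range]
    gcongr

/-- The output of the algorithm. -/
def output (w : Input) : List (List ((ℤ × ℤ) × List ℕ)) :=
  basis w.d (List.range w.n) (monomialRows (List.range w.n) (List.range w.d)).flatten
    (generators (List.range w.n) w.cs)

theorem PolyTime.output : PolyTime output :=
  PolyTime.input_d.basis PolyTime.range_n PolyTime.monomialRows.flatten
    (PolyTime.range_n.generators PolyTime.input_cs)

/-! ### Reduced Gröbner bases of affine Boolean spaces -/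

section Groebner

open MvPolynomial

variable {n : ℕ}

/-! ### Squarefree monomials and characters of the cube -/

/-- The exponent vector of a squarefree monomial. -/
noncomputable def expo (A : Finset (Fin n)) : Fin n →₀ ℕ :=
  Finsupp.equivFunOnFinite.symm fun i => if i ∈ A then 1 else 0

theorem expo_apply (A : Finset (Fin n)) (i : Fin n) : expo A i = if i ∈ A then 1 else 0 := rfl

theorem expo_le_iff {A : Finset (Fin n)} {a : Fin n →₀ ℕ} : expo A ≤ a ↔ A ⊆ a.support := by
  simp only [Finsupp.le_def, expo_apply, Finset.subset_iff, Finsupp.mem_support_iff]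
  refine forall_congr' fun i => ?_
  split_ifs with h
  · simp [h, Nat.one_le_iff_ne_zero]
  · simp [h]

theorem support_expo (A : Finset (Fin n)) : (expo A).support = A := by
  ext i; simp [expo_apply]

theorem expo_le_expo {A B : Finset (Fin n)} : expo A ≤ expo B ↔ A ⊆ B := by
  rw [expo_le_iff, support_expo]

theorem expo_injective : Function.Injective (expo (n := n)) := fun A B h => by
  rw [← support_expo A, h, support_expo]

theorem degree_expo (A : Finset (Fin n)) : (expo A).degree = A.card := by
  rw [Finsupp.degree_eq_sum]
  simp [expo_apply]

theorem eq_expo_or (a : Fin n →₀ ℕ) : a = expo a.support ∨ ∃ i, 2 ≤ a i := by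
  by_cases h : ∃ i, 2 ≤ a i
  · exact Or.inr h
  · left
    ext i
    have : a i < 2 := by
      by_contra h'
      exact h ⟨i, by omega⟩
    rw [expo_apply]
    by_cases hi : a i = 0 <;> simp [hi]
    omega

theorem expo_singleton (i : Fin n) : expo {i} = Finsupp.single i 1 := by
  ext j
  simp [expo_apply, Finsupp.single_apply, eq_comm]

/-- The value at a Boolean point of a squarefree monomial. -/
def monVal (A : Finset (Fin n)) (φ : Fin n → Bool) : ℝ := ∏ i ∈ A, if φ i then 1 else 0

/-- The value at a Boolean point of a character of the Boolean cube. -/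
def chi (A : Finset (Fin n)) (φ : Fin n → Bool) : ℝ := ∏ i ∈ A, if φ i then -1 else 1

theorem chi_mul_self (A : Finset (Fin n)) (φ : Fin n → Bool) : chi A φ * chi A φ = 1 := by
  rw [chi, ← Finset.prod_mul_distrib]
  exact Finset.prod_eq_one fun i _ => by split_ifs <;> norm_num

theorem chi_symmDiff (A B : Finset (Fin n)) (φ : Fin n → Bool) :
    chi (symmDiff A B) φ = chi A φ * chi B φ := by
  have h : ∀ C, chi C φ = ∏ i, if i ∈ C then (if φ i then (-1 : ℝ) else 1) else 1 := fun C => by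
    rw [chi, Finset.prod_ite_mem, Finset.univ_inter]
  rw [h, h, h, ← Finset.prod_mul_distrib]
  refine Finset.prod_congr rfl fun i _ => ?_
  simp only [Finset.mem_symmDiff]
  by_cases h1 : i ∈ A <;> by_cases h2 : i ∈ B <;> by_cases h3 : φ i <;> simp [h1, h2, h3]

/-- Expand the product of x = (1 - (-1)^x) / 2 over the variables. -/
theorem monVal_eq_sum (A : Finset (Fin n)) (φ : Fin n → Bool) :
    monVal A φ = ∑ B ∈ A.powerset, (1 / 2) ^ A.card * (-1) ^ B.card * chi B φ := by
  have h : monVal A φ = ∏ i ∈ A, (1 / 2 : ℝ) * (-(if φ i then -1 else 1) + 1) := by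
    refine Finset.prod_congr rfl fun i _ => ?_
    split_ifs <;> norm_num
  rw [h, Finset.prod_mul_distrib, Finset.prod_const, Finset.prod_add, Finset.mul_sum]
  refine Finset.sum_congr rfl fun B _ => ?_
  rw [Finset.prod_const_one, mul_one, Finset.prod_neg, chi]
  ring

/-- Expand the product of (-1)^x = 1 - 2x over the variables. -/
theorem chi_eq_sum (A : Finset (Fin n)) (φ : Fin n → Bool) :
    chi A φ = ∑ B ∈ A.powerset, (-2) ^ B.card * monVal B φ := by
  have h : chi A φ = ∏ i ∈ A, ((-2 : ℝ) * (if φ i then 1 else 0) + 1) := by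
    refine Finset.prod_congr rfl fun i _ => ?_
    split_ifs <;> norm_num
  rw [h, Finset.prod_add]
  refine Finset.sum_congr rfl fun B _ => ?_
  rw [Finset.prod_const_one, mul_one, Finset.prod_mul_distrib, Finset.prod_const, monVal]

/-- Positive powers of 0 and 1 do not depend on the exponent, so only the support counts. -/
theorem eval_monomial_toPoint (a : Fin n →₀ ℕ) (c : ℝ) (φ : Fin n → Bool) :
    eval (toPoint φ) (monomial a c) = c * monVal a.support φ := by
  rw [eval_monomial, Finsupp.prod, monVal]
  congr 1
  refine Finset.prod_congr rfl fun i hi => ?_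
  rw [toPoint]
  split_ifs
  · simp
  · simp [Finsupp.mem_support_iff.1 hi]

/-! ### Proportionality of characters on a set -/

/-- Two characters agree up to a constant factor on `S`. -/
def CharEquiv (S : Set (Fin n → Bool)) (A B : Finset (Fin n)) : Prop :=
  ∀ φ ∈ S, ∀ ψ ∈ S, chi A φ * chi B φ = chi A ψ * chi B ψ

theorem chi_eq_one_or (A : Finset (Fin n)) (φ : Fin n → Bool) : chi A φ = 1 ∨ chi A φ = -1 :=
  mul_self_eq_one_iff.1 (chi_mul_self A φ)

variable {S : Set (Fin n → Bool)} {A B C D : Finset (Fin n)}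

theorem CharEquiv.refl (S : Set (Fin n → Bool)) (A : Finset (Fin n)) : CharEquiv S A A :=
  fun φ _ ψ _ => by rw [chi_mul_self, chi_mul_self]

theorem CharEquiv.symm (h : CharEquiv S A B) : CharEquiv S B A :=
  fun φ hφ ψ hψ => by rw [mul_comm, h φ hφ ψ hψ, mul_comm]

theorem CharEquiv.trans (h : CharEquiv S A B) (h' : CharEquiv S B C) : CharEquiv S A C :=
  fun φ hφ ψ hψ => by
    have key : ∀ θ, chi A θ * chi C θ = (chi A θ * chi B θ) * (chi B θ * chi C θ) := fun θ => by
      linear_combination (-(chi A θ * chi C θ)) * chi_mul_self B θ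
    rw [key, key, h φ hφ ψ hψ, h' φ hφ ψ hψ]

theorem CharEquiv.symmDiff_right (h : CharEquiv S A B) (E : Finset (Fin n)) :
    CharEquiv S (symmDiff A E) (symmDiff B E) :=
  fun φ hφ ψ hψ => by
    have key : ∀ θ, chi (symmDiff A E) θ * chi (symmDiff B E) θ = chi A θ * chi B θ := fun θ => by
      rw [chi_symmDiff, chi_symmDiff]
      linear_combination (chi A θ * chi B θ) * chi_mul_self E θ
    rw [key, key, h φ hφ ψ hψ]

/-! ### Standard monomials -/

variable (m : MonomialOrder (Fin n))

/-- The squarefree monomial is minimal among those that agree with it as characters on `S`. -/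
def IsStandard (S : Set (Fin n → Bool)) (A : Finset (Fin n)) : Prop :=
  ∀ B, CharEquiv S A B → m.toSyn (expo A) ≤ m.toSyn (expo B)

theorem exists_standard (S : Set (Fin n → Bool)) (A : Finset (Fin n)) :
    ∃ B, CharEquiv S A B ∧ IsStandard m S B := by
  obtain ⟨B, hB, hmin⟩ := Set.exists_min_image {B | CharEquiv S A B} (fun B => m.toSyn (expo B))
    (Set.toFinite _) ⟨A, CharEquiv.refl S A⟩
  exact ⟨B, hB, fun C hC => hmin C (CharEquiv.trans hB hC)⟩

/-- The minimal monomial that agrees with `A` as a character on `S`. -/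
noncomputable def stdRep (S : Set (Fin n → Bool)) (A : Finset (Fin n)) : Finset (Fin n) :=
  (exists_standard m S A).choose

theorem charEquiv_stdRep (S : Set (Fin n → Bool)) (A : Finset (Fin n)) :
    CharEquiv S A (stdRep m S A) := (exists_standard m S A).choose_spec.1

theorem isStandard_stdRep (S : Set (Fin n → Bool)) (A : Finset (Fin n)) :
    IsStandard m S (stdRep m S A) := (exists_standard m S A).choose_spec.2

variable {m}

theorem IsStandard.eq_of_charEquiv (hA : IsStandard m S A) (hB : IsStandard m S B)
    (h : CharEquiv S A B) : A = B :=
  expo_injective (m.toSyn.injective (le_antisymm (hA B h) (hB A h.symm)))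

theorem stdRep_eq_iff : stdRep m S A = B ↔ CharEquiv S A B ∧ IsStandard m S B :=
  ⟨fun h => h ▸ ⟨charEquiv_stdRep m S A, isStandard_stdRep m S A⟩, fun h =>
    (isStandard_stdRep m S A).eq_of_charEquiv h.2 ((charEquiv_stdRep m S A).symm.trans h.1)⟩

theorem stdRep_eq_self_iff : stdRep m S A = A ↔ IsStandard m S A :=
  stdRep_eq_iff.trans ⟨fun h => h.2, fun h => ⟨CharEquiv.refl S A, h⟩⟩

theorem stdRep_le (m : MonomialOrder (Fin n)) (S : Set (Fin n → Bool)) (A : Finset (Fin n)) :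
    m.toSyn (expo (stdRep m S A)) ≤ m.toSyn (expo A) :=
  isStandard_stdRep m S A A (charEquiv_stdRep m S A).symm

theorem toSyn_expo_mono (h : A ⊆ B) : m.toSyn (expo A) ≤ m.toSyn (expo B) :=
  m.toSyn_monotone (expo_le_expo.2 h)

theorem expo_add_expo_sdiff (h : A ⊆ B) : expo A + expo (B \ A) = expo B := by
  ext i
  simp only [Finsupp.add_apply, expo_apply, Finset.mem_sdiff]
  by_cases h1 : i ∈ A
  · simp [h1, h h1]
  · simp [h1]

theorem expo_symmDiff_le (A B : Finset (Fin n)) : expo (symmDiff A B) ≤ expo A + expo B := by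
  rw [Finsupp.le_def]
  intro i
  simp only [Finsupp.add_apply, expo_apply, Finset.mem_symmDiff]
  by_cases h1 : i ∈ A <;> by_cases h2 : i ∈ B <;> simp [h1, h2]

/-- If C is equivalent to A, then C Δ (B \ A) is equivalent to B, hence not below it. Its exponent
vector is at most the sum of those of C and B \ A, and B \ A cancels from the resulting inequality.
-/
theorem IsStandard.subset (hB : IsStandard m S B) (h : A ⊆ B) : IsStandard m S A := by
  intro C hC
  have h1 : CharEquiv S B (symmDiff C (B \ A)) := by
    have h2 := hC.symmDiff_right (B \ A)
    rwa [show symmDiff A (B \ A) = B by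
      rw [Finset.disjoint_sdiff.symmDiff_eq_sup, Finset.sup_eq_union,
        Finset.union_sdiff_of_subset h]] at h2
  have h3 := (hB _ h1).trans (m.toSyn_monotone (expo_symmDiff_le C (B \ A)))
  rw [← expo_add_expo_sdiff h, map_add, map_add] at h3
  exact le_of_add_le_add_right h3

/-! ### Orthogonality on affine sets -/

/-- The set is closed under the coordinatewise minority operation. -/
def MinorityClosed (S : Set (Fin n → Bool)) : Prop :=
  ∀ φ ∈ S, ∀ ψ ∈ S, ∀ θ ∈ S, (fun i => φ i ^^ (ψ i ^^ θ i)) ∈ S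

theorem chi_xor (A : Finset (Fin n)) (φ ψ : Fin n → Bool) :
    chi A (fun i => φ i ^^ ψ i) = chi A φ * chi A ψ := by
  rw [chi, chi, chi, ← Finset.prod_mul_distrib]
  refine Finset.prod_congr rfl fun i _ => ?_
  cases φ i <;> cases ψ i <;> simp

-- If chi_A chi_B differs at two points φ, ψ of S, translation by φ + ψ permutes S and changes the
-- sign of every summand.
open scoped Classical in
theorem sum_chi_mul_chi_eq_zero (hS : MinorityClosed S) (h : ¬ CharEquiv S A B) :
    ∑ φ ∈ S.toFinset, chi A φ * chi B φ = 0 := by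
  simp only [CharEquiv, not_forall] at h
  obtain ⟨φ, hφ, ψ, hψ, hne⟩ := h
  have h1 : chi A φ * chi B φ * (chi A ψ * chi B ψ) = -1 := by
    rcases chi_eq_one_or A φ with h1 | h1 <;> rcases chi_eq_one_or B φ with h2 | h2 <;>
    rcases chi_eq_one_or A ψ with h3 | h3 <;> rcases chi_eq_one_or B ψ with h4 | h4 <;>
    simp [h1, h2, h3, h4] at hne ⊢
  have h2 : ∑ θ ∈ S.toFinset, chi A θ * chi B θ =
      ∑ θ ∈ S.toFinset, -(chi A θ * chi B θ) := by
    refine Finset.sum_nbij' (fun θ i => θ i ^^ (φ i ^^ ψ i)) (fun θ i => θ i ^^ (φ i ^^ ψ i))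
      ?_ ?_ ?_ ?_ ?_
    · intro θ hθ
      exact Set.mem_toFinset.2 (hS θ (Set.mem_toFinset.1 hθ) φ hφ ψ hψ)
    · intro θ hθ
      exact Set.mem_toFinset.2 (hS θ (Set.mem_toFinset.1 hθ) φ hφ ψ hψ)
    · intro θ _; ext i; simp
    · intro θ _; ext i; simp
    · intro θ _
      rw [chi_xor, chi_xor, chi_xor, chi_xor]
      linear_combination (chi A θ * chi B θ) * h1
  rw [Finset.sum_neg_distrib] at h2
  linarith

-- The characters occurring in the monomial A belong to subsets of A, hence lie strictly below C. As
-- C is minimal in its class, none of them is equivalent to it.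
open scoped Classical in
theorem sum_monVal_mul_chi_eq_zero (hS : MinorityClosed S) (hC : IsStandard m S C)
    (h : m.toSyn (expo A) < m.toSyn (expo C)) :
    ∑ φ ∈ S.toFinset, monVal A φ * chi C φ = 0 := by
  simp only [monVal_eq_sum, Finset.sum_mul]
  rw [Finset.sum_comm]
  refine Finset.sum_eq_zero fun B hB => ?_
  simp only [mul_assoc, ← Finset.mul_sum]
  rw [sum_chi_mul_chi_eq_zero hS, mul_zero, mul_zero]
  intro h'
  exact absurd (hC B h'.symm)
    (not_le.2 ((toSyn_expo_mono (Finset.mem_powerset.1 hB)).trans_lt h))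

-- Only the top character of the expansion pairs nontrivially with chi_C, and it contributes ±|S| /
-- 2^|C|.
open scoped Classical in
theorem sum_monVal_mul_chi_self_ne_zero (hS : MinorityClosed S) (hne : S.Nonempty)
    (hC : IsStandard m S C) : ∑ φ ∈ S.toFinset, monVal C φ * chi C φ ≠ 0 := by
  simp only [monVal_eq_sum, Finset.sum_mul]
  rw [Finset.sum_comm, Finset.sum_eq_single C]
  · simp only [mul_assoc, ← Finset.mul_sum, chi_mul_self]
    simpa using (show ∃ x, x ∈ S from hne)
  · intro B hB hBC
    simp only [mul_assoc, ← Finset.mul_sum]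
    rw [sum_chi_mul_chi_eq_zero hS, mul_zero, mul_zero]
    intro h'
    refine hBC (expo_injective (m.toSyn.injective (le_antisymm ?_ (hC B h'.symm))))
    exact toSyn_expo_mono (Finset.mem_powerset.1 hB)
  · simp

/-- Leading monomials of elements of the vanishing ideal are not standard. -/
theorem not_isStandard_of_degree_eq (hS : MinorityClosed S) (hne : S.Nonempty)
    {f : MvPolynomial (Fin n) ℝ} (hf : f ∈ vanishingIdeal ℝ (toPoint '' S)) (hf0 : f ≠ 0)
    (hC : m.degree f = expo C) : ¬ IsStandard m S C := by
  classical
  intro hstd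
  -- Pairing `f` with chi_C over S gives 0 because `f` vanishes there; computed term by term, only
  -- the leading term survives.
  have h0 : ∑ φ ∈ S.toFinset, eval (toPoint φ) f * chi C φ = 0 := by
    refine Finset.sum_eq_zero fun φ hφ => ?_
    have := (mem_vanishingIdeal_iff.1 hf) (toPoint φ) ⟨φ, Set.mem_toFinset.1 hφ, rfl⟩
    rw [show eval (toPoint φ) f = 0 by simpa [aeval_eq_eval] using this, zero_mul]
  have h1 : ∀ φ, eval (toPoint φ) f = ∑ a ∈ f.support, coeff a f * monVal a.support φ := fun φ => by
    conv_lhs => rw [f.as_sum, map_sum]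
    exact Finset.sum_congr rfl fun a _ => eval_monomial_toPoint _ _ _
  simp only [h1, Finset.sum_mul] at h0
  rw [Finset.sum_comm, Finset.sum_eq_single (expo C)] at h0
  · simp only [mul_assoc, ← Finset.mul_sum, support_expo] at h0
    rcases mul_eq_zero.1 h0 with h2 | h2
    · rw [← hC] at h2
      exact hf0 (m.coeff_degree_eq_zero_iff.1 h2)
    · exact sum_monVal_mul_chi_self_ne_zero hS hne hstd h2
  · intro a ha hne'
    simp only [mul_assoc, ← Finset.mul_sum]
    rw [sum_monVal_mul_chi_eq_zero hS hstd, mul_zero]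
    -- A term that is not squarefree has the values of its squarefree part, which divides it and is
    -- therefore no larger.
    refine (m.toSyn_monotone (expo_le_iff.2 subset_rfl)).trans_lt (lt_of_le_of_ne ?_ ?_)
    · rw [← hC]; exact m.le_degree ha
    · exact fun h => hne' (m.toSyn.injective h)
  · intro h
    rw [← hC] at h
    exact absurd (m.degree_mem_support hf0) h

/-! ### Normal forms and the polynomials x_i^2 - x_i -/

variable (m)

/-- The difference of the squarefree monomial `A` and its normal form; `p` is a point of `S`. -/
noncomputable def nfPoly (S : Set (Fin n → Bool)) (p : Fin n → Bool) (A : Finset (Fin n)) :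
    MvPolynomial (Fin n) ℝ :=
  monomial (expo A) 1 - ∑ B ∈ A.powerset, ∑ D ∈ (stdRep m S B).powerset,
    monomial (expo D) ((1 / 2) ^ A.card * (-1) ^ B.card *
      (chi B p * chi (stdRep m S B) p) * (-2) ^ D.card)

variable {m} {p : Fin n → Bool}

/-- The inner sum is a multiple of the character of the representative of B. On S the constant
chi_B(p) chi_rep(p) turns that character into chi_B, so the sum becomes the expansion of the
monomial A. -/
theorem eval_nfPoly (hp : p ∈ S) {φ : Fin n → Bool} (hφ : φ ∈ S) (A : Finset (Fin n)) :
    eval (toPoint φ) (nfPoly m S p A) = 0 := by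
  simp only [nfPoly, map_sub, map_sum, eval_monomial_toPoint, support_expo, one_mul]
  rw [monVal_eq_sum, sub_eq_zero]
  refine Finset.sum_congr rfl fun B _ => ?_
  simp only [mul_assoc, ← Finset.mul_sum]
  rw [← chi_eq_sum]
  have h1 := charEquiv_stdRep m S B φ hφ p hp
  have h2 := chi_mul_self (stdRep m S B) φ
  congr 2
  linear_combination (-chi B φ) * h2 + (chi (stdRep m S B) φ) * h1

theorem coeff_nfPoly (a : Fin n →₀ ℕ) : coeff a (nfPoly m S p A) =
    (if expo A = a then 1 else 0) - ∑ B ∈ A.powerset, ∑ D ∈ (stdRep m S B).powerset,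
      if expo D = a then (1 / 2) ^ A.card * (-1) ^ B.card *
      (chi B p * chi (stdRep m S B) p) * (-2) ^ D.card else 0 := by
  classical
  simp only [nfPoly, coeff_sub, coeff_sum, coeff_monomial]

theorem coeff_nfPoly_expo : coeff (expo D) (nfPoly m S p A) =
    (if D = A then 1 else 0) - ∑ B ∈ A.powerset with D ⊆ stdRep m S B,
      (1 / 2) ^ A.card * (-1) ^ B.card * (chi B p * chi (stdRep m S B) p) * (-2) ^ D.card := by
  rw [coeff_nfPoly, Finset.sum_filter]
  congr 1
  · simp [expo_injective.eq_iff, eq_comm]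
  · refine Finset.sum_congr rfl fun B _ => ?_
    simp only [expo_injective.eq_iff, Finset.sum_ite_eq', Finset.mem_powerset]

/-- Tail monomials are subsets of standard representatives of subsets of A; taking subsets or
representatives never goes up in the order. -/
theorem mem_support_nfPoly {a : Fin n →₀ ℕ} (ha : a ∈ (nfPoly m S p A).support) :
    a = expo A ∨ ∃ D, a = expo D ∧ IsStandard m S D ∧ m.toSyn (expo D) ≤ m.toSyn (expo A) := by
  rw [mem_support_iff, coeff_nfPoly] at ha
  by_cases h : expo A = a
  · exact Or.inl h.symm
  · right
    rw [if_neg h, zero_sub, neg_ne_zero] at ha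
    obtain ⟨B, hB, hne⟩ := Finset.exists_ne_zero_of_sum_ne_zero ha
    obtain ⟨D, hD, hne⟩ := Finset.exists_ne_zero_of_sum_ne_zero hne
    have h1 : expo D = a := by
      by_contra h1
      exact hne (if_neg h1)
    rw [Finset.mem_powerset] at hB hD
    exact ⟨D, h1.symm, (isStandard_stdRep m S B).subset hD,
      (toSyn_expo_mono hD).trans ((stdRep_le m S B).trans (toSyn_expo_mono hB))⟩

/-- The subtracted part involves standard monomials only, so it cannot touch a nonstandard A. -/
theorem coeff_nfPoly_self (hA : ¬ IsStandard m S A) : coeff (expo A) (nfPoly m S p A) = 1 := by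
  rw [coeff_nfPoly_expo, if_pos rfl, Finset.filter_false_of_mem, Finset.sum_empty, sub_zero]
  exact fun B _ h => hA ((isStandard_stdRep m S B).subset h)

theorem degree_nfPoly (hA : ¬ IsStandard m S A) : m.degree (nfPoly m S p A) = expo A := by
  refine m.toSyn.injective (le_antisymm (m.degree_le_iff.2 fun a ha => ?_) (m.le_degree ?_))
  · rcases mem_support_nfPoly ha with rfl | ⟨D, rfl, -, h⟩
    · exact le_rfl
    · exact h
  · rw [mem_support_iff, coeff_nfPoly_self hA]
    exact one_ne_zero

theorem leadingCoeff_nfPoly (hA : ¬ IsStandard m S A) : m.leadingCoeff (nfPoly m S p A) = 1 := by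
  rw [MonomialOrder.leadingCoeff, degree_nfPoly hA, coeff_nfPoly_self hA]

/-- The polynomial `x_i ^ 2 - x_i`. -/
noncomputable def sqPoly (i : Fin n) : MvPolynomial (Fin n) ℝ :=
  monomial (Finsupp.single i 2) 1 - monomial (Finsupp.single i 1) 1

theorem coeff_sqPoly (i : Fin n) (a : Fin n →₀ ℕ) : coeff a (sqPoly i) =
    (if Finsupp.single i 2 = a then 1 else 0) - if Finsupp.single i 1 = a then 1 else 0 := by
  classical
  simp only [sqPoly, coeff_sub, coeff_monomial]

theorem single_one_ne_single_two (i : Fin n) :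
    (Finsupp.single i 1 : Fin n →₀ ℕ) ≠ Finsupp.single i 2 := fun h => by
  simpa using DFunLike.congr_fun h i

theorem support_sqPoly (i : Fin n) :
    (sqPoly i).support = {Finsupp.single i 2, Finsupp.single i 1} := by
  ext a
  rw [mem_support_iff, coeff_sqPoly, Finset.mem_insert, Finset.mem_singleton, eq_comm (a := a),
    eq_comm (a := a)]
  have := single_one_ne_single_two i
  by_cases h1 : Finsupp.single i 2 = a
  · have h2 : Finsupp.single i 1 ≠ a := h1 ▸ this
    simp [h1, h2]
  · simp [h1]

theorem degree_sqPoly (i : Fin n) : m.degree (sqPoly i) = Finsupp.single i 2 := by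
  refine m.toSyn.injective (le_antisymm (m.degree_le_iff.2 fun a ha => ?_) (m.le_degree ?_))
  · rw [support_sqPoly, Finset.mem_insert, Finset.mem_singleton] at ha
    rcases ha with rfl | rfl
    · exact le_rfl
    · exact m.toSyn_monotone (Finsupp.single_mono (by norm_num))
  · simp [support_sqPoly]

theorem leadingCoeff_sqPoly (i : Fin n) : m.leadingCoeff (sqPoly i) = 1 := by
  rw [MonomialOrder.leadingCoeff, degree_sqPoly, coeff_sqPoly, if_pos rfl,
    if_neg (single_one_ne_single_two i), sub_zero]

theorem eval_sqPoly (i : Fin n) (φ : Fin n → Bool) : eval (toPoint φ) (sqPoly i) = 0 := by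
  rw [sqPoly, map_sub, eval_monomial_toPoint, eval_monomial_toPoint,
    Finsupp.support_single i two_ne_zero, Finsupp.support_single i one_ne_zero, sub_self]

/-! ### The reduced basis -/

variable (m)

/-- The monomial is minimal with respect to divisibility among the squarefree monomials that are
not standard. -/
def IsMinNonstandard (S : Set (Fin n → Bool)) (A : Finset (Fin n)) : Prop :=
  ¬ IsStandard m S A ∧ ∀ B ⊆ A, B ≠ A → IsStandard m S B

/-- The reduced Gröbner basis of the vanishing ideal of `S`; `p` is a point of `S`. -/
def reducedBasis (S : Set (Fin n → Bool)) (p : Fin n → Bool) : Set (MvPolynomial (Fin n) ℝ) :=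
  nfPoly m S p '' {A | IsMinNonstandard m S A} ∪ sqPoly '' {i | IsStandard m S {i}}

variable {m}

theorem exists_isMinNonstandard (hA : ¬ IsStandard m S A) : ∃ B ⊆ A, IsMinNonstandard m S B := by
  induction A using Finset.strongInduction with
  | H A ih =>
    by_cases h : ∃ B ⊂ A, ¬ IsStandard m S B
    · obtain ⟨B, hB, hB'⟩ := h
      obtain ⟨C, hC, hC'⟩ := ih B hB hB'
      exact ⟨C, hC.trans hB.1, hC'⟩
    · push Not at h
      exact ⟨A, subset_rfl, hA, fun B hB hne => h B (hB.ssubset_of_ne hne)⟩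

theorem isStandard_empty : IsStandard m S (∅ : Finset (Fin n)) :=
  fun B _ => m.toSyn_monotone (by rw [expo_le_iff]; simp)

theorem reducedBasis_subset (hp : p ∈ S) :
    reducedBasis m S p ⊆ (vanishingIdeal ℝ (toPoint '' S) : Set (MvPolynomial (Fin n) ℝ)) := by
  rintro f hf
  refine mem_vanishingIdeal_iff.2 ?_
  rintro _ ⟨φ, hφ, rfl⟩
  rw [aeval_eq_eval]
  rcases hf with ⟨A, -, rfl⟩ | ⟨i, -, rfl⟩
  · exact eval_nfPoly hp hφ A
  · exact eval_sqPoly i φ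

/-- A squarefree leading monomial is nonstandard and contains a minimal nonstandard one. Otherwise
it is divisible by some x_i^2; if x_i is standard the square polynomial serves, and if not then x_i
itself is minimal nonstandard. -/
theorem exists_reducedBasis_degree_le (hS : MinorityClosed S) (hp : p ∈ S)
    {f : MvPolynomial (Fin n) ℝ} (hf : f ∈ vanishingIdeal ℝ (toPoint '' S)) (hf0 : f ≠ 0) :
    ∃ g ∈ reducedBasis m S p, m.degree g ≤ m.degree f := by
  rcases eq_expo_or (m.degree f) with h | ⟨i, hi⟩
  · obtain ⟨B, hB, hB'⟩ :=
      exists_isMinNonstandard (not_isStandard_of_degree_eq hS ⟨p, hp⟩ hf hf0 h)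
    refine ⟨_, Or.inl ⟨B, hB', rfl⟩, ?_⟩
    rw [degree_nfPoly hB'.1, h]
    exact expo_le_expo.2 hB
  · have h2 : Finsupp.single i 2 ≤ m.degree f := Finsupp.single_le_iff.2 hi
    by_cases h : IsStandard m S {i}
    · exact ⟨_, Or.inr ⟨i, h, rfl⟩, by rwa [degree_sqPoly]⟩
    · refine ⟨_, Or.inl ⟨{i}, ⟨h, fun B hB hne => ?_⟩, rfl⟩, ?_⟩
      · rcases Finset.subset_singleton_iff.1 hB with rfl | rfl
        · exact isStandard_empty
        · exact absurd rfl hne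
      · rw [degree_nfPoly h, expo_singleton]
        exact (Finsupp.single_mono (by norm_num)).trans h2

theorem leadingCoeff_of_mem_reducedBasis {g : MvPolynomial (Fin n) ℝ}
    (hg : g ∈ reducedBasis m S p) : m.leadingCoeff g = 1 := by
  rcases hg with ⟨A, hA, rfl⟩ | ⟨i, -, rfl⟩
  · exact leadingCoeff_nfPoly hA.1
  · exact leadingCoeff_sqPoly i

theorem ne_zero_of_leadingCoeff_eq_one {g : MvPolynomial (Fin n) ℝ} (h : m.leadingCoeff g = 1) :
    g ≠ 0 := by
  rintro rfl
  simp at h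

theorem isGroebnerBasis_of_exists_degree_le {I : Ideal (MvPolynomial (Fin n) ℝ)}
    {G : Set (MvPolynomial (Fin n) ℝ)} (hfin : G.Finite) (hGI : G ⊆ I)
    (h1 : ∀ g ∈ G, m.leadingCoeff g = 1)
    (h : ∀ f ∈ I, f ≠ 0 → ∃ g ∈ G, m.degree g ≤ m.degree f) : IsGroebnerBasis m I G := by
  refine ⟨hfin, hGI, le_antisymm (Ideal.span_mono (Set.image_mono fun g hg =>
    ⟨hGI hg, ne_zero_of_leadingCoeff_eq_one (h1 g hg)⟩)) (Ideal.span_le.2 ?_)⟩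
  rintro _ ⟨f, ⟨hf, hf0⟩, rfl⟩
  obtain ⟨g, hg, hle⟩ := h f hf hf0
  have : m.leadingTerm f =
      monomial (m.degree f - m.degree g) (m.leadingCoeff f) * m.leadingTerm g := by
    rw [MonomialOrder.leadingTerm, MonomialOrder.leadingTerm, monomial_mul, h1 g hg, mul_one,
      tsub_add_cancel_of_le hle]
  rw [SetLike.mem_coe, this]
  exact Ideal.mul_mem_left _ _ (Ideal.subset_span ⟨g, hg, rfl⟩)

theorem eq_of_degree_le_expo (hA : IsMinNonstandard m S A) {g : MvPolynomial (Fin n) ℝ}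
    (hg : g ∈ reducedBasis m S p) (h : m.degree g ≤ expo A) : g = nfPoly m S p A := by
  rcases hg with ⟨B, hB, rfl⟩ | ⟨i, -, rfl⟩
  · rw [degree_nfPoly hB.1, expo_le_expo] at h
    by_contra hne
    exact hB.1 (hA.2 B h fun h' => hne (h' ▸ rfl))
  · rw [degree_sqPoly, Finsupp.single_le_iff, expo_apply] at h
    split_ifs at h <;> omega

theorem not_degree_le_of_isStandard (hA : IsStandard m S A) {g : MvPolynomial (Fin n) ℝ}
    (hg : g ∈ reducedBasis m S p) : ¬ m.degree g ≤ expo A := by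
  intro h
  rcases hg with ⟨B, hB, rfl⟩ | ⟨i, -, rfl⟩
  · rw [degree_nfPoly hB.1, expo_le_expo] at h
    exact hB.1 (hA.subset h)
  · rw [degree_sqPoly, Finsupp.single_le_iff, expo_apply] at h
    split_ifs at h <;> omega

/-- No leading monomial of the basis divides a standard monomial, which takes care of all tails.
Minimality, and the restriction of the squares to standard x_i, exclude divisibility between leading
monomials. -/
theorem isReducedGroebnerBasis_reducedBasis (hS : MinorityClosed S) (hp : p ∈ S) :
    IsReducedGroebnerBasis m (vanishingIdeal ℝ (toPoint '' S)) (reducedBasis m S p) := by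
  refine ⟨isGroebnerBasis_of_exists_degree_le ((Set.toFinite _).image _ |>.union
    ((Set.toFinite _).image _)) (reducedBasis_subset hp)
    (fun g hg => leadingCoeff_of_mem_reducedBasis hg)
    fun f hf hf0 => exists_reducedBasis_degree_le hS hp hf hf0,
    fun g hg => leadingCoeff_of_mem_reducedBasis hg, ?_⟩
  intro g hg f hf hne a ha hle
  rcases hf with ⟨A, hA, rfl⟩ | ⟨i, hi, rfl⟩
  · rcases mem_support_nfPoly ha with rfl | ⟨D, rfl, hD, -⟩
    · exact hne (eq_of_degree_le_expo hA hg hle).symm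
    · exact not_degree_le_of_isStandard hD hg hle
  · have hi' : IsStandard m S {i} := hi
    rw [support_sqPoly, Finset.mem_insert, Finset.mem_singleton] at ha
    rcases ha with rfl | rfl
    · rcases hg with ⟨B, hB, rfl⟩ | ⟨j, -, rfl⟩
      · rw [degree_nfPoly hB.1, expo_le_iff, Finsupp.support_single i two_ne_zero] at hle
        exact hB.1 (hi'.subset hle)
      · rw [degree_sqPoly, Finsupp.single_le_iff, Finsupp.single_apply] at hle
        split_ifs at hle with h
        · exact hne (h ▸ rfl)
        · omega
    · rw [← expo_singleton] at hle
      exact not_degree_le_of_isStandard hi' hg hle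

theorem isReducedGroebnerBasis_top : IsReducedGroebnerBasis m ⊤ {1} := by
  refine ⟨isGroebnerBasis_of_exists_degree_le (Set.finite_singleton _) (by simp)
    (by simp) fun f _ _ => ⟨1, rfl, by simp⟩, by simp, ?_⟩
  rintro g rfl f rfl h
  exact absurd rfl h

end Groebner

/-! ### Correctness of the computation of the solution space -/

/-- The closure of a set of Boolean vectors under the minority operation. -/
inductive MinSpan {ι : Type} (X : Set (ι → Bool)) : (ι → Bool) → Prop
  | mem {φ} : φ ∈ X → MinSpan X φ
  | minority {φ ψ θ} : MinSpan X φ → MinSpan X ψ → MinSpan X θ →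
      MinSpan X fun i => φ i ^^ (ψ i ^^ θ i)

theorem MinSpan.subset {ι : Type} {X Y : Set (ι → Bool)} (h : ∀ φ ∈ X, MinSpan Y φ) {φ : ι → Bool}
    (hφ : MinSpan X φ) : MinSpan Y φ := by
  induction hφ with
  | mem hφ => exact h _ hφ
  | minority _ _ _ h1 h2 h3 => exact .minority h1 h2 h3

theorem MinSpan.nonempty {ι : Type} {X : Set (ι → Bool)} {φ : ι → Bool} (hφ : MinSpan X φ) :
    X.Nonempty := by
  induction hφ with
  | mem hφ => exact ⟨_, hφ⟩
  | minority _ _ _ h1 _ _ => exact h1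

theorem MinSpan.image {ι κ : Type} {X : Set (ι → Bool)} {f : (ι → Bool) → κ → Bool}
    (hf : ∀ φ ψ θ, f (fun i => φ i ^^ (ψ i ^^ θ i)) = fun i => f φ i ^^ (f ψ i ^^ f θ i))
    {φ : ι → Bool} (hφ : MinSpan X φ) : MinSpan (f '' X) (f φ) := by
  induction hφ with
  | mem hφ => exact .mem ⟨_, hφ, rfl⟩
  | minority _ _ _ h1 h2 h3 => rw [hf]; exact .minority h1 h2 h3

theorem MinSpan.exists_of_image {ι κ : Type} {X : Set (ι → Bool)} {f : (ι → Bool) → κ → Bool}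
    (hf : ∀ φ ψ θ, f (fun i => φ i ^^ (ψ i ^^ θ i)) = fun i => f φ i ^^ (f ψ i ^^ f θ i))
    {φ : κ → Bool} (hφ : MinSpan (f '' X) φ) : ∃ ψ, MinSpan X ψ ∧ f ψ = φ := by
  induction hφ with
  | mem hφ =>
    obtain ⟨ψ, hψ, rfl⟩ := hφ
    exact ⟨ψ, .mem hψ, rfl⟩
  | minority _ _ _ h1 h2 h3 =>
    obtain ⟨a, ha, rfl⟩ := h1
    obtain ⟨b, hb, rfl⟩ := h2
    obtain ⟨c, hc, rfl⟩ := h3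
    exact ⟨_, .minority ha hb hc, hf a b c⟩

/-- Generators of the points of a span that satisfy an affine equation. -/
theorem minSpan_restrict_iff {ι : Type} {X Y : Set (ι → Bool)} {L : (ι → Bool) → Bool}
    (hL : ∀ φ ψ θ, L (fun i => φ i ^^ (ψ i ^^ θ i)) = (L φ ^^ (L ψ ^^ L θ)))
    {z o : ι → Bool} (hz : z ∈ X) (hz0 : L z = false)
    (ho : ∀ φ ∈ X, L φ = true → o ∈ X ∧ L o = true)
    (hY : ∀ φ, φ ∈ Y ↔ (φ ∈ X ∧ L φ = false) ∨
      ∃ ψ ∈ X, L ψ = true ∧ φ = fun i => z i ^^ (o i ^^ ψ i)) (φ : ι → Bool) :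
    MinSpan Y φ ↔ MinSpan X φ ∧ L φ = false := by
  constructor
  · intro h
    induction h with
    | mem h =>
      rcases (hY _).1 h with h | ⟨ψ, hψ, hψ1, rfl⟩
      · exact ⟨.mem h.1, h.2⟩
      · obtain ⟨ho1, ho2⟩ := ho ψ hψ hψ1
        exact ⟨.minority (.mem hz) (.mem ho1) (.mem hψ), by rw [hL, hz0, ho2, hψ1]; rfl⟩
    | minority _ _ _ h1 h2 h3 =>
      exact ⟨.minority h1.1 h2.1 h3.1, by rw [hL, h1.2, h2.2, h3.2]; rfl⟩
  · rintro ⟨h, h0⟩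
    -- The induction must also follow points that violate the equation; they are represented by
    -- their translates by z + o. In a minority of three points, two translations cancel, so the
    -- number of violating arguments modulo 2 decides which form appears.
    have key : ∀ {φ}, MinSpan X φ → (L φ = false → MinSpan Y φ) ∧
        (L φ = true → MinSpan Y fun i => z i ^^ (o i ^^ φ i)) := by
      intro φ h
      induction h with
      | mem h => exact ⟨fun h0 => .mem ((hY _).2 (Or.inl ⟨h, h0⟩)),
          fun h1 => .mem ((hY _).2 (Or.inr ⟨_, h, h1, rfl⟩))⟩
      | @minority a b c _ _ _ h1 h2 h3 =>
        rw [hL]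
        rcases ha : L a with _ | _ <;> rcases hb : L b with _ | _ <;> rcases hc : L c with _ | _ <;>
          simp only [ha, hb, hc, Bool.false_eq_true, Bool.true_eq_false, forall_true_left, false_imp_iff,
            true_and, and_true, Bool.xor_false, Bool.xor_true, Bool.not_true, Bool.not_false] at h1 h2 h3 ⊢ <;>
          · have h := MinSpan.minority h1 h2 h3
            convert h using 2 with i <;>
              (cases z i <;> cases o i <;> cases a i <;> cases b i <;> cases c i <;> rfl)
    exact (key h).1 h0

/-! ### Parity equations and generating lists -/

/-- The sign of a parity. -/
def sgn (b : Bool) : ℝ := if b then -1 else 1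

theorem sgn_xor (a b : Bool) : sgn (a ^^ b) = sgn a * sgn b := by
  cases a <;> cases b <;> simp [sgn]

theorem sgn_injective : Function.Injective sgn := by
  intro a b h
  cases a <;> cases b <;> norm_num [sgn] at h <;> rfl

theorem zip_ofFn {α β : Type} {k : ℕ} (f : Fin k → α) (g : Fin k → β) :
    (List.ofFn f).zip (List.ofFn g) = List.ofFn fun i => (f i, g i) :=
  List.ext_getElem (by simp) fun i h1 h2 => by simp

/-- Passing to signs turns the fold by exclusive or into a finite product, for which the usual
product lemmas apply. -/
theorem sgn_parity {k : ℕ} (e φ : Fin k → Bool) :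
    sgn (parity (List.ofFn e) (List.ofFn φ)) = ∏ i, sgn (e i && φ i) := by
  have h : ∀ (l : List (Bool × Bool)) (s : Bool), sgn (l.foldl (fun s p => s ^^ (p.1 && p.2)) s) =
      sgn s * (l.map fun p => sgn (p.1 && p.2)).prod := by
    intro l
    induction l with
    | nil => simp
    | cons p l ih => intro s; rw [List.foldl_cons, ih, sgn_xor, List.map_cons, List.prod_cons, mul_assoc]
  rw [parity, h, zip_ofFn, List.map_ofFn, List.prod_ofFn]
  simp [sgn]

theorem parity_minority {k : ℕ} (e φ ψ θ : Fin k → Bool) :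
    parity (List.ofFn e) (List.ofFn fun i => φ i ^^ (ψ i ^^ θ i)) =
      (parity (List.ofFn e) (List.ofFn φ) ^^
        (parity (List.ofFn e) (List.ofFn ψ) ^^ parity (List.ofFn e) (List.ofFn θ))) := by
  apply sgn_injective
  rw [sgn_xor, sgn_xor]
  simp only [sgn_parity, ← Finset.prod_mul_distrib]
  refine Finset.prod_congr rfl fun i _ => ?_
  rw [← sgn_xor, ← sgn_xor]
  congr 1
  cases e i <;> simp

theorem vadd_ofFn {k : ℕ} (φ ψ : Fin k → Bool) :
    vadd (List.ofFn φ) (List.ofFn ψ) = List.ofFn fun i => φ i ^^ ψ i := by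
  rw [vadd, zip_ofFn, List.map_ofFn]; rfl

/-- The list codes a set of Boolean vectors whose closure under minority is `S`. -/
def Generates {k : ℕ} (P : List (List Bool)) (S : Set (Fin k → Bool)) : Prop :=
  ∃ X : List (Fin k → Bool), P = X.map List.ofFn ∧ ∀ φ, MinSpan {x | x ∈ X} φ ↔ φ ∈ S

theorem Generates.restrict {k : ℕ} {P : List (List Bool)} {S : Set (Fin k → Bool)}
    (h : Generates P S) (e : Fin k → Bool) : Generates (restrict P (List.ofFn e))
      {φ | φ ∈ S ∧ parity (List.ofFn e) (List.ofFn φ) = false} := by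
  obtain ⟨X, rfl, hX⟩ := h
  set L : (Fin k → Bool) → Bool := fun φ => parity (List.ofFn e) (List.ofFn φ) with hL
  have hLadd : ∀ φ ψ θ, L (fun i => φ i ^^ (ψ i ^^ θ i)) = (L φ ^^ (L ψ ^^ L θ)) :=
    parity_minority e
  have hZ : ((X.map List.ofFn).filter fun v => !parity (List.ofFn e) v) =
      (X.filter fun φ => !L φ).map List.ofFn := by
    rw [List.filter_map]; rfl
  have hO : ((X.map List.ofFn).filter fun v => parity (List.ofFn e) v) =
      (X.filter fun φ => L φ).map List.ofFn := by
    rw [List.filter_map]; rfl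
  rw [Alg.restrict, hZ, hO]
  rcases hZ' : X.filter fun φ => !L φ with _ | ⟨z, Z⟩
  · refine ⟨[], by simp, fun φ => ⟨fun h => ?_, fun h => ?_⟩⟩
    · obtain ⟨ψ, hψ⟩ := h.nonempty
      simp at hψ
    · exfalso
      have h1 : ∀ φ ∈ X, L φ = true := fun φ hφ => by
        simpa using List.filter_eq_nil_iff.1 hZ' φ hφ
      -- If every generator violates the equation, so does the whole span, as a sum of three ones is
      -- one.
      have h2 : ∀ {φ}, MinSpan {x | x ∈ X} φ → L φ = true := by
        intro φ h
        induction h with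
        | mem h => exact h1 _ h
        | minority _ _ _ ha hb hc => rw [hLadd, ha, hb, hc]; rfl
      have h3 := h2 ((hX φ).2 h.1)
      rw [show L φ = false from h.2] at h3
      exact absurd h3 (by simp)
  · have hz : z ∈ X ∧ L z = false := by
      have : z ∈ X.filter fun φ => !L φ := hZ' ▸ List.mem_cons_self
      simpa using List.mem_filter.1 this
    rcases hO' : X.filter fun φ => L φ with _ | ⟨o, O⟩
    · refine ⟨z :: Z, by simp, fun φ => ?_⟩
      rw [minSpan_restrict_iff (X := {x | x ∈ X}) (o := z) hLadd hz.1 hz.2 ?_ ?_, hX]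
      · rfl
      · intro φ hφ hφ1
        exact absurd hφ1 (List.filter_eq_nil_iff.1 hO' φ hφ)
      · intro φ
        rw [Set.mem_ofPred_eq, ← hZ', List.mem_filter]
        constructor
        · intro h; exact Or.inl (by simpa using h)
        · rintro (h | ⟨ψ, hψ, hψ1, -⟩)
          · simpa using h
          · exact absurd hψ1 (List.filter_eq_nil_iff.1 hO' ψ hψ)
    · refine ⟨(z :: Z) ++ (o :: O).map fun ψ i => z i ^^ (o i ^^ ψ i), ?_, fun φ => ?_⟩
      · simp only [List.map_cons, List.map_append, List.headD_cons, vadd_ofFn, List.map_map,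
          Function.comp_def, List.isEmpty_cons, cond_false]
      rw [minSpan_restrict_iff (X := {x | x ∈ X}) (o := o) hLadd hz.1 hz.2 ?_ ?_, hX]
      · rfl
      · intro φ hφ hφ1
        have : o ∈ X.filter fun φ => L φ := hO' ▸ List.mem_cons_self
        exact List.mem_filter.1 this
      · intro φ
        rw [Set.mem_ofPred_eq, ← hZ', ← hO', List.mem_append, List.mem_filter, List.mem_map]
        simp only [List.mem_filter, Set.mem_ofPred_eq, Bool.not_eq_true', and_assoc]
        refine or_congr Iff.rfl (exists_congr fun ψ => ?_)
        rw [eq_comm (a := φ)]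

theorem Generates.foldl_restrict {k : ℕ} {P : List (List Bool)} {S : Set (Fin k → Bool)}
    (h : Generates P S) (es : List (Fin k → Bool)) :
    Generates ((es.map List.ofFn).foldl Alg.restrict P)
      {φ | φ ∈ S ∧ ∀ e ∈ es, parity (List.ofFn e) (List.ofFn φ) = false} := by
  induction es generalizing P S with
  | nil => simpa using h
  | cons e es ih =>
    have := ih (h.restrict e)
    simpa [and_assoc] using this

theorem Generates.congr {k : ℕ} {P : List (List Bool)} {S S' : Set (Fin k → Bool)}
    (h : Generates P S) (hS : ∀ φ, φ ∈ S ↔ φ ∈ S') : Generates P S' := by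
  rwa [← Set.ext hS]

theorem append_minority {k l : ℕ} (φ ψ θ : Fin k → Bool) (φ' ψ' θ' : Fin l → Bool) :
    (Fin.append (fun i => φ i ^^ (ψ i ^^ θ i)) fun i => φ' i ^^ (ψ' i ^^ θ' i)) = fun i =>
      Fin.append φ φ' i ^^ (Fin.append ψ ψ' i ^^ Fin.append θ θ' i) := by
  funext i
  refine Fin.addCases (fun j => ?_) (fun j => ?_) i <;> simp

theorem Generates.product {k l : ℕ} {P R : List (List Bool)} {S : Set (Fin k → Bool)}
    {T : Set (Fin l → Bool)} (h : Generates P S) (h' : Generates R T) :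
    Generates (product P R) {φ : Fin (k + l) → Bool |
      (fun i => φ (Fin.castAdd l i)) ∈ S ∧ (fun i => φ (Fin.natAdd k i)) ∈ T} := by
  obtain ⟨X, rfl, hX⟩ := h
  obtain ⟨Y, rfl, hY⟩ := h'
  rcases X with _ | ⟨x, X⟩
  · refine ⟨[], by simp [Alg.product], fun φ => ⟨fun h => ?_, fun h => ?_⟩⟩
    · simpa using h.nonempty
    · simpa using ((hX _).2 h.1).nonempty
  rcases Y with _ | ⟨y, Y⟩
  · refine ⟨[], by simp [Alg.product], fun φ => ⟨fun h => ?_, fun h => ?_⟩⟩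
    · simpa using h.nonempty
    · simpa using ((hY _).2 h.2).nonempty
  refine ⟨((x :: X).map fun φ => Fin.append φ y) ++ (y :: Y).map fun ψ => Fin.append x ψ, ?_,
    fun φ => ?_⟩
  · simp [Alg.product, List.ofFn_fin_append, Function.comp_def]
  constructor
  · intro h
    rw [Set.mem_ofPred_eq, ← hX, ← hY]
    induction h with
    | mem h =>
      rcases List.mem_append.1 h with h | h
      · obtain ⟨a, ha, rfl⟩ := List.mem_map.1 h
        simp only [Fin.append_left, Fin.append_right]
        exact ⟨.mem ha, .mem List.mem_cons_self⟩
      · obtain ⟨a, ha, rfl⟩ := List.mem_map.1 h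
        simp only [Fin.append_left, Fin.append_right]
        exact ⟨.mem List.mem_cons_self, .mem ha⟩
    | minority _ _ _ h1 h2 h3 => exact ⟨.minority h1.1 h2.1 h3.1, .minority h1.2 h2.2 h3.2⟩
  · rw [Set.mem_ofPred_eq, ← hX, ← hY]
    set W : Set (Fin (k + l) → Bool) := {ψ | ψ ∈ ((x :: X).map fun φ => Fin.append φ y) ++
      (y :: Y).map fun ψ => Fin.append x ψ} with hW
    rintro ⟨h1, h2⟩
    have e1 : ∀ {a}, MinSpan {z | z ∈ x :: X} a → MinSpan W (Fin.append a y) := by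
      intro a ha
      have := ha.image (f := fun a => Fin.append a y) fun a b c => by
        rw [← append_minority]; simp
      refine this.subset fun ψ hψ => .mem ?_
      obtain ⟨a, ha, rfl⟩ := hψ
      exact List.mem_append_left _ (List.mem_map.2 ⟨a, ha, rfl⟩)
    have e2 : ∀ {a}, MinSpan {z | z ∈ y :: Y} a → MinSpan W (Fin.append x a) := by
      intro a ha
      have := ha.image (f := fun a => Fin.append x a) fun a b c => by
        rw [← append_minority]; simp
      refine this.subset fun ψ hψ => .mem ?_
      obtain ⟨a, ha, rfl⟩ := hψ
      exact List.mem_append_right _ (List.mem_map.2 ⟨a, ha, rfl⟩)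
    -- This is (a, b) = (a, y) + (x, y) + (x, b).
    have e3 := MinSpan.minority (e1 h1) (e1 (.mem List.mem_cons_self)) (e2 h2)
    rw [← append_minority] at e3
    convert e3 using 1
    funext i
    refine Fin.addCases (fun j => ?_) (fun j => ?_) i <;> simp

theorem Generates.image {k l : ℕ} {P : List (List Bool)} {S : Set (Fin k → Bool)}
    (h : Generates P S) {f : (Fin k → Bool) → Fin l → Bool}
    (hf : ∀ φ ψ θ, f (fun i => φ i ^^ (ψ i ^^ θ i)) = fun i => f φ i ^^ (f ψ i ^^ f θ i))
    {g : List Bool → List Bool} (hg : ∀ φ, g (List.ofFn φ) = List.ofFn (f φ)) :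
    Generates (P.map g) (f '' S) := by
  obtain ⟨X, rfl, hX⟩ := h
  refine ⟨X.map f, by simp [Function.comp_def, hg], fun φ => ?_⟩
  rw [show {x | x ∈ X.map f} = f '' {x | x ∈ X} by ext; simp]
  constructor
  · intro h
    obtain ⟨ψ, hψ, rfl⟩ := MinSpan.exists_of_image hf h
    exact ⟨ψ, (hX ψ).1 hψ, rfl⟩
  · rintro ⟨ψ, hψ, rfl⟩
    exact MinSpan.image hf ((hX ψ).2 hψ)

theorem unitVec_range (k i : ℕ) :
    unitVec (List.range k) i = List.ofFn fun j : Fin k => (j : ℕ) == i :=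
  List.ext_getElem (by simp [unitVec]) fun j h1 h2 => by simp [unitVec]

theorem sgn_parity_unit {k : ℕ} (i : Fin k) (φ : Fin k → Bool) :
    ∏ j : Fin k, sgn (((j : ℕ) == (i : ℕ)) && φ j) = sgn (φ i) := by
  rw [Finset.prod_eq_single i]
  · simp
  · intro j _ hj
    have : ((j : ℕ) == (i : ℕ)) = false := by simpa [Fin.ext_iff] using hj
    rw [this]; simp [sgn]
  · simp

/-- The equation that identifies the coordinate `i` of the first vector with the coordinate `j`
of the second one. -/
def linkEq {k l : ℕ} (i : Fin k) (j : Fin l) : Fin (k + l) → Bool :=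
  Fin.append (fun a : Fin k => (a : ℕ) == (i : ℕ)) fun a : Fin l => (a : ℕ) == (j : ℕ)

theorem parity_linkEq {k l : ℕ} (i : Fin k) (j : Fin l) (φ : Fin (k + l) → Bool) :
    parity (List.ofFn (linkEq i j)) (List.ofFn φ) =
      (φ (Fin.castAdd l i) ^^ φ (Fin.natAdd k j)) := by
  apply sgn_injective
  rw [sgn_parity, sgn_xor, Fin.prod_univ_add]
  simp only [linkEq, Fin.append_left, Fin.append_right]
  rw [sgn_parity_unit i (fun a => φ (Fin.castAdd l a)),
    sgn_parity_unit j (fun a => φ (Fin.natAdd k a))]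

theorem equations_eq {k l : ℕ} (s : Fin l → Fin k) :
    equations (List.range k) (List.ofFn fun j => (s j : ℕ)) =
      (List.ofFn fun j => linkEq (s j) j).map List.ofFn := by
  refine List.ext_getElem (by simp [equations]) fun j h1 h2 => ?_
  simp [equations, unitVec_range, linkEq, List.ofFn_fin_append]

/-- The linking equations force the second component of a pair to be φ ∘ s, so projecting the
restricted product leaves exactly the φ ∈ S with φ ∘ s ∈ T. -/
theorem Generates.addConstraint {k l : ℕ} {P R : List (List Bool)} {S : Set (Fin k → Bool)}
    {T : Set (Fin l → Bool)} (h : Generates P S) (h' : Generates R T) (s : Fin l → Fin k) :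
    Generates (addConstraint (List.range k) P (List.ofFn fun j => (s j : ℕ), R))
      {φ | φ ∈ S ∧ (fun j => φ (s j)) ∈ T} := by
  rw [Alg.addConstraint, equations_eq]
  refine ((((h.product h').foldl_restrict _).image
    (f := fun φ i => φ (Fin.castAdd l i)) (fun _ _ _ => rfl) fun φ => ?_)).congr fun φ => ?_
  · refine List.ext_getElem (by simp) fun j h1 h2 => ?_
    simp [Fin.castAdd, Fin.castLE]
  · simp only [Set.mem_image, Set.mem_ofPred_eq, List.mem_ofFn, forall_exists_index,
      forall_apply_eq_imp_iff, parity_linkEq]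
    constructor
    · rintro ⟨ψ, ⟨⟨h1, h2⟩, h3⟩, rfl⟩
      refine ⟨h1, ?_⟩
      convert h2 using 2 with j
      simpa using h3 j
    · rintro ⟨h1, h2⟩
      refine ⟨Fin.append φ fun j => φ (s j), ⟨⟨?_, ?_⟩, fun j => ?_⟩, ?_⟩
      · simpa using h1
      · simpa using h2
      · simp
      · simp

theorem generates_univ (k : ℕ) : Generates (((List.range k).map fun _ => false) ::
    (List.range k).map (unitVec (List.range k))) (Set.univ : Set (Fin k → Bool)) := by
  refine ⟨(fun _ => false) :: List.ofFn fun i : Fin k => fun j : Fin k => (j : ℕ) == (i : ℕ), ?_,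
    fun φ => ⟨fun _ => trivial, fun _ => ?_⟩⟩
  · rw [List.map_cons]
    congr 1
    · exact List.ext_getElem (by simp) fun j h1 h2 => by simp
    · exact List.ext_getElem (by simp) fun j h1 h2 => by simp [unitVec_range]
  -- Minority with the zero vector as one argument is addition, so unit vectors can be added one at
  -- a time.
  · have key : ∀ s : Finset (Fin k), MinSpan {x | x ∈ (fun _ => false) :: List.ofFn
        fun i : Fin k => fun j : Fin k => (j : ℕ) == (i : ℕ)} fun i => decide (i ∈ s) := by
      intro s
      induction s using Finset.induction_on with
      | empty => exact .mem (by simp)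
      | insert a s ha ih =>
        have h1 := MinSpan.minority ih (.mem (φ := fun _ => false) List.mem_cons_self)
          (.mem (φ := fun j : Fin k => (j : ℕ) == (a : ℕ)) (List.mem_cons_of_mem _ (by simp)))
        convert h1 using 2 with i
        by_cases h : i = a
        · simp [h, ha]
        · have h' : ((i : ℕ) == (a : ℕ)) = false := by simpa [Fin.ext_iff] using h
          simp only [h', Finset.mem_insert, h, false_or, Bool.xor_false]
    convert key (Finset.univ.filter fun i => φ i = true) using 2 with i
    simp

/-! ### The enumeration of the monomials -/

/-- The lexicographic order of Boolean vectors, which are continued by zeros. -/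
def LexLt (v w : List Bool) : Prop :=
  ∃ i, (∀ j < i, v.getD j false = w.getD j false) ∧ v.getD i false = false ∧ w.getD i false = true

theorem LexLt.cons {v w : List Bool} (h : LexLt v w) (b : Bool) : LexLt (b :: v) (b :: w) := by
  obtain ⟨i, h1, h2, h3⟩ := h
  refine ⟨i + 1, fun j hj => ?_, by simpa using h2, by simpa using h3⟩
  rcases j with _ | j
  · simp
  · simpa using h1 j (by omega)

theorem lexLt_false_true (v w : List Bool) : LexLt (false :: v) (true :: w) :=
  ⟨0, by simp, by simp, by simp⟩

theorem pairwise_vecsOfWeight (k j : ℕ) : (vecsOfWeight k j).Pairwise LexLt := by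
  induction k generalizing j with
  | zero => cases j <;> simp [vecsOfWeight]
  | succ k ih =>
    cases j with
    | zero => exact List.pairwise_map.2 ((ih 0).imp fun h => h.cons false)
    | succ j =>
      refine List.pairwise_append.2 ⟨List.pairwise_map.2 ((ih _).imp fun h => h.cons false),
        List.pairwise_map.2 ((ih _).imp fun h => h.cons true), fun v hv w hw => ?_⟩
      obtain ⟨v, -, rfl⟩ := List.mem_map.1 hv
      obtain ⟨w, -, rfl⟩ := List.mem_map.1 hw
      exact lexLt_false_true v w

theorem mem_vecsOfWeight {k j : ℕ} {v : List Bool} :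
    v ∈ vecsOfWeight k j ↔ v.length = k ∧ v.count true = j := by
  induction k generalizing j v with
  | zero => cases j <;> cases v <;> simp [vecsOfWeight]
  | succ k ih =>
    rcases v with _ | ⟨b, v⟩
    · cases j <;> simp [vecsOfWeight]
    · cases j <;> cases b <;> simp [vecsOfWeight, ih]

/-- The indicator vector of a finite set. -/
def vec {n : ℕ} (A : Finset (Fin n)) : List Bool := List.ofFn fun i => decide (i ∈ A)

theorem getD_vec {n : ℕ} (A : Finset (Fin n)) (i : Fin n) :
    (vec A).getD i false = decide (i ∈ A) := by
  simp [vec, List.getD]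

theorem count_vec {n : ℕ} (A : Finset (Fin n)) : (vec A).count true = A.card := by
  have h : ∀ l : List Bool, l.count true = (l.map Bool.toNat).sum := by
    intro l
    induction l with
    | nil => rfl
    | cons b l ih => cases b <;> simp [ih, add_comm]
  rw [h, vec, List.map_ofFn, List.sum_ofFn]
  simp [Bool.toNat, Bool.cond_decide]

theorem exists_eq_vec {n : ℕ} {v : List Bool} (h : v.length = n) :
    ∃ A : Finset (Fin n), v = vec A := by
  subst h
  refine ⟨Finset.univ.filter fun i => v[i] = true, List.ext_getElem (by simp [vec]) fun i h1 h2 => ?_⟩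
  simp [vec]

theorem toSyn_expo_lt_of_card_lt {n : ℕ} {A B : Finset (Fin n)} (h : A.card < B.card) :
    MonomialOrder.degLex.toSyn (expo A) < MonomialOrder.degLex.toSyn (expo B) := by
  rw [MonomialOrder.degLex_lt_iff, Finsupp.DegLex.lt_iff]
  left
  simpa [degree_expo] using h

theorem card_le_of_toSyn_le {n : ℕ} {A B : Finset (Fin n)}
    (h : MonomialOrder.degLex.toSyn (expo A) ≤ MonomialOrder.degLex.toSyn (expo B)) :
    A.card ≤ B.card := by
  by_contra h'
  exact absurd h (not_le.2 (toSyn_expo_lt_of_card_lt (not_le.1 h')))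

theorem toSyn_expo_lt_of_lexLt {n : ℕ} {A B : Finset (Fin n)} (h : A.card = B.card)
    (h' : LexLt (vec A) (vec B)) :
    MonomialOrder.degLex.toSyn (expo A) < MonomialOrder.degLex.toSyn (expo B) := by
  rw [MonomialOrder.degLex_lt_iff, Finsupp.DegLex.lt_iff]
  right
  refine ⟨by simpa [degree_expo] using h, ?_⟩
  obtain ⟨i, h1, h2, h3⟩ := h'
  have hi : i < n := by
    by_contra hi
    rw [List.getD_eq_default _ _ (by simpa [vec] using hi)] at h3
    exact absurd h3 (by simp)
  rw [Finsupp.Lex.lt_iff]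
  refine ⟨⟨i, hi⟩, fun j hj => ?_, ?_⟩
  · have h4 := h1 j hj
    rw [getD_vec, getD_vec, decide_eq_decide] at h4
    simp [expo_apply, h4]
  · have h4 := getD_vec A ⟨i, hi⟩
    have h5 := getD_vec B ⟨i, hi⟩
    simp only at h4 h5
    rw [h2] at h4
    rw [h3] at h5
    have h6 : ⟨i, hi⟩ ∉ A := by simpa using h4.symm
    have h7 : ⟨i, hi⟩ ∈ B := by simpa using h5.symm
    simp [expo_apply, h6, h7]

/-- The monomials of degree at most `d` are enumerated in increasing order. -/
theorem exists_monomials (n d : ℕ) : ∃ L : List (Finset (Fin n)),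
    (monomialRows (List.range n) (List.range d)).flatten = L.map vec ∧
    (∀ A, A ∈ L ↔ A.card ≤ d) ∧ L.Pairwise fun A B =>
      MonomialOrder.degLex.toSyn (expo A) < MonomialOrder.degLex.toSyn (expo B) := by
  set ms := (monomialRows (List.range n) (List.range d)).flatten with hms
  have hmem : ∀ v, v ∈ ms ↔ v.length = n ∧ v.count true ≤ d := by
    intro v
    simp [hms, monomialRows_eq, mem_vecsOfWeight, and_comm]
  have hpw : ms.Pairwise fun v w => v.count true < w.count true ∨
      (v.count true = w.count true ∧ LexLt v w) := by
    rw [hms, monomialRows_eq, List.pairwise_flatten]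
    constructor
    · intro l hl
      obtain ⟨j, -, rfl⟩ := List.mem_map.1 hl
      refine (pairwise_vecsOfWeight _ _).imp_of_mem fun hv hw h => Or.inr ⟨?_, h⟩
      rw [(mem_vecsOfWeight.1 hv).2, (mem_vecsOfWeight.1 hw).2]
    · refine List.pairwise_map.2 (List.pairwise_lt_range.imp fun h v hv w hw => Or.inl ?_)
      rwa [(mem_vecsOfWeight.1 hv).2, (mem_vecsOfWeight.1 hw).2]
  have hL : ∃ L : List (Finset (Fin n)), ms = L.map vec := by
    have : ∀ l : List (List Bool), (∀ v ∈ l, v.length = n) →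
        ∃ L : List (Finset (Fin n)), l = L.map vec := by
      intro l hl
      induction l with
      | nil => exact ⟨[], rfl⟩
      | cons v l ih =>
        obtain ⟨L, rfl⟩ := ih fun w hw => hl w (List.mem_cons_of_mem _ hw)
        obtain ⟨A, rfl⟩ := exists_eq_vec (hl v List.mem_cons_self)
        exact ⟨A :: L, rfl⟩
    exact this ms fun v hv => ((hmem v).1 hv).1
  obtain ⟨L, hL⟩ := hL
  have hinj : Function.Injective (vec (n := n)) := by
    intro A B h
    ext i
    rw [← decide_eq_decide, ← getD_vec, h, getD_vec]
  refine ⟨L, hL, fun A => ?_, ?_⟩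
  · rw [← List.mem_map_of_injective hinj, ← hL, hmem, count_vec]
    simp [vec]
  · rw [hL, List.pairwise_map] at hpw
    refine hpw.imp fun {A B} h => ?_
    rw [count_vec, count_vec] at h
    rcases h with h | ⟨h, h'⟩
    · exact toSyn_expo_lt_of_card_lt h
    · exact toSyn_expo_lt_of_lexLt h h'

open MvPolynomial

/-! ### Correctness of the computation of the Gröbner basis -/

theorem sgn_parity_vec {n : ℕ} (A : Finset (Fin n)) (φ : Fin n → Bool) :
    sgn (parity (vec A) (List.ofFn φ)) = chi A φ := by
  have h : chi A φ = ∏ i, if i ∈ A then (if φ i then (-1 : ℝ) else 1) else 1 := by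
    rw [chi, Finset.prod_ite_mem, Finset.univ_inter]
  rw [vec, sgn_parity, h]
  refine Finset.prod_congr rfl fun i _ => ?_
  by_cases hi : i ∈ A <;> simp [hi, sgn]

theorem subset_vec {n : ℕ} {A B : Finset (Fin n)} : subset (vec A) (vec B) = true ↔ A ⊆ B := by
  simp only [subset, vec, zip_ofFn, List.all_eq_true, List.mem_ofFn, forall_exists_index,
    forall_apply_eq_imp_iff, Finset.subset_iff]
  simp [imp_iff_not_or]

theorem vecEq_vec {n : ℕ} {A B : Finset (Fin n)} : vecEq (vec A) (vec B) = true ↔ A = B := by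
  simp only [vecEq, vec, zip_ofFn, List.all_eq_true, List.mem_ofFn, forall_exists_index,
    forall_apply_eq_imp_iff, Finset.ext_iff]
  refine forall_congr' fun i => ?_
  by_cases h1 : i ∈ A <;> by_cases h2 : i ∈ B <;> simp [h1, h2]

theorem weightedPow_vec {n : ℕ} (c : ℤ) (A : Finset (Fin n)) :
    weightedPow c (vec A) = c ^ A.card := by
  rw [weightedPow, vec, List.map_ofFn, List.prod_ofFn]
  simp [Bool.cond_decide]

theorem weight_vec {n : ℕ} (A : Finset (Fin n)) : weight (vec A) = A.card := by
  rw [weight, vec, List.map_ofFn, List.sum_ofFn]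
  simp [Bool.cond_decide]

theorem vecCode_eq {k : ℕ} (v : Fin k → ℕ) : vecCode v = enc (List.ofFn v) := by
  rw [vecCode]
  change _ = Data.list ((List.ofFn v).map enc)
  rw [List.map_ofFn]
  rfl

theorem codesSet_map {ι α β : Type} [Code β] {code : α → Data → Prop} {S : Set α} {l : List ι}
    {f : ι → α} {g : ι → β} (hnd : (l.map f).Nodup) (hmem : ∀ a, a ∈ S ↔ ∃ x ∈ l, f x = a)
    (hcode : ∀ x ∈ l, code (f x) (enc (g x))) : CodesSet code S (enc (l.map g)) := by
  refine ⟨l.map f, hnd, fun a => by rw [hmem, List.mem_map], (l.map g).map enc, ?_, rfl⟩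
  clear hmem hnd
  induction l with
  | nil => exact List.Forall₂.nil
  | cons x l ih =>
    exact List.Forall₂.cons (hcode x List.mem_cons_self)
      (ih fun y hy => hcode y (List.mem_cons_of_mem _ hy))

/-- The data on which the algorithm computes a basis: the solution set, generators of it and the
list of the monomials of degree at most `d`. -/
structure BasisContext (n d : ℕ) where
  S : Set (Fin n → Bool)
  L : List (Finset (Fin n))
  p : Fin n → Bool
  X : List (Fin n → Bool)
  mem_L : ∀ A, A ∈ L ↔ A.card ≤ d
  sorted : L.Pairwise fun A B =>
    MonomialOrder.degLex.toSyn (expo A) < MonomialOrder.degLex.toSyn (expo B)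
  span : ∀ φ, MinSpan {x | x ∈ p :: X} φ ↔ φ ∈ S

namespace BasisContext

variable {n d : ℕ} (c : BasisContext n d)

def ms : List (List Bool) := c.L.map vec

def P : List (List Bool) := (c.p :: c.X).map List.ofFn

/-- Standard monomials for the graded lexicographic order. -/
def Std (A : Finset (Fin n)) : Prop := IsStandard MonomialOrder.degLex c.S A

noncomputable def srep (A : Finset (Fin n)) : Finset (Fin n) := stdRep MonomialOrder.degLex c.S A

noncomputable def nf (A : Finset (Fin n)) : MvPolynomial (Fin n) ℝ :=
  nfPoly MonomialOrder.degLex c.S c.p A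

theorem p_mem : c.p ∈ c.S := (c.span _).1 (.mem List.mem_cons_self)

theorem nodup_L : c.L.Nodup := c.sorted.imp fun h => by rintro rfl; exact lt_irrefl _ h

theorem headD_P : c.P.headD [] = List.ofFn c.p := rfl

/-- The product of the two characters is multiplicative under minority, so from the common value c
at the generators one gets c^3 = c on the whole span. -/
theorem equivTest_iff (A B : Finset (Fin n)) :
    equivTest c.P (vec A) (vec B) = true ↔ CharEquiv c.S A B := by
  have h1 : equivTest c.P (vec A) (vec B) = true ↔
      ∀ x ∈ c.p :: c.X, chi A x * chi B x = chi A c.p * chi B c.p := by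
    rw [equivTest, headD_P, List.all_eq_true, P, List.forall_mem_map]
    refine forall₂_congr fun x _ => ?_
    rw [← sgn_parity_vec, ← sgn_parity_vec, ← sgn_parity_vec, ← sgn_parity_vec, ← sgn_xor,
      ← sgn_xor, sgn_injective.eq_iff]
    cases parity (vec A) (List.ofFn x) ^^ parity (vec B) (List.ofFn x) <;>
      cases parity (vec A) (List.ofFn c.p) ^^ parity (vec B) (List.ofFn c.p) <;> simp
  rw [h1]
  constructor
  · intro h
    have key : ∀ {φ}, MinSpan {x | x ∈ c.p :: c.X} φ →
        chi A φ * chi B φ = chi A c.p * chi B c.p := by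
      intro φ hφ
      induction hφ with
      | mem hφ => exact h _ hφ
      | @minority a b e _ _ _ h1 h2 h3 =>
        rw [chi_xor, chi_xor, chi_xor, chi_xor]
        have h4 := chi_mul_self A c.p
        have h5 := chi_mul_self B c.p
        calc chi A a * (chi A b * chi A e) * (chi B a * (chi B b * chi B e)) =
            (chi A a * chi B a) * (chi A b * chi B b) * (chi A e * chi B e) := by ring
          _ = (chi A c.p * chi A c.p) * (chi B c.p * chi B c.p) * (chi A c.p * chi B c.p) := by
            rw [h1, h2, h3]; ring
          _ = _ := by rw [h4, h5]; ring
    intro φ hφ ψ hψ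
    rw [key ((c.span φ).2 hφ), key ((c.span ψ).2 hψ)]
  · intro h x hx
    exact h x ((c.span x).1 (.mem hx)) c.p c.p_mem

/-- This uses that the order is graded; it ensures that representatives occur among the enumerated
monomials. -/
theorem card_srep_le (A : Finset (Fin n)) : (c.srep A).card ≤ A.card :=
  card_le_of_toSyn_le (stdRep_le _ _ _)

/-- The list is strictly increasing and contains the representative, so the first equivalent entry
is the minimal one and the default of `headD` is not reached. -/
theorem rep_eq {B : Finset (Fin n)} (hB : B.card ≤ d) : rep c.ms c.P (vec B) = vec (c.srep B) := by
  classical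
  have h1 : c.ms.filter (fun C => equivTest c.P (vec B) C) =
      (c.L.filter fun C => decide (CharEquiv c.S B C)).map vec := by
    rw [ms, List.filter_map]
    congr 1
    refine List.filter_congr fun C _ => ?_
    rw [Bool.eq_iff_iff, Function.comp, equivTest_iff, decide_eq_true_iff]
  have h2 : c.srep B ∈ c.L.filter fun C => decide (CharEquiv c.S B C) :=
    List.mem_filter.2 ⟨(c.mem_L _).2 ((c.card_srep_le B).trans hB),
      decide_eq_true (charEquiv_stdRep _ _ _)⟩
  have h3 := c.sorted.filter fun C => decide (CharEquiv c.S B C)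
  rw [rep, h1]
  rcases hl : c.L.filter fun C => decide (CharEquiv c.S B C) with _ | ⟨C, l⟩
  · rw [hl] at h2; simp at h2
  · have h4 : C ∈ c.L.filter fun C => decide (CharEquiv c.S B C) := hl ▸ List.mem_cons_self
    have h5 : CharEquiv c.S B C := by simpa using (List.mem_filter.1 h4).2
    rw [hl] at h2 h3
    rw [List.map_cons, List.headD_cons]
    rcases List.mem_cons.1 h2 with h6 | h6
    · rw [h6]
    · have h7 := (List.pairwise_cons.1 h3).1 _ h6
      exact absurd (isStandard_stdRep MonomialOrder.degLex c.S B C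
        ((charEquiv_stdRep MonomialOrder.degLex c.S B).symm.trans h5)) (not_le.2 h7)

theorem isStd_iff {A : Finset (Fin n)} (hA : A.card ≤ d) :
    isStd c.ms c.P (vec A) = true ↔ c.Std A := by
  rw [isStd, c.rep_eq hA, vecEq_vec]
  exact stdRep_eq_self_iff

theorem isMinimal_iff {A : Finset (Fin n)} (hA : A.card ≤ d) :
    isMinimal c.ms c.P (vec A) = true ↔ IsMinNonstandard MonomialOrder.degLex c.S A := by
  rw [isMinimal, Bool.and_eq_true, Bool.not_eq_true', ← Bool.not_eq_true, c.isStd_iff hA,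
    IsMinNonstandard]
  refine and_congr Iff.rfl ?_
  rw [List.all_eq_true, ms, List.forall_mem_map]
  constructor
  · intro h B hB hne
    have hBd := (Finset.card_le_card hB).trans hA
    have h1 := h B ((c.mem_L B).2 hBd)
    rw [Bool.or_eq_true, Bool.or_eq_true, Bool.not_eq_true', ← Bool.not_eq_true, subset_vec,
      vecEq_vec] at h1
    rcases h1 with h1 | h1 | h1
    · exact absurd hB h1
    · exact absurd h1 hne
    · exact (c.isStd_iff hBd).1 h1
  · intro h B hB
    rw [Bool.or_eq_true, Bool.or_eq_true, Bool.not_eq_true', ← Bool.not_eq_true, subset_vec,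
      vecEq_vec]
    by_cases h1 : B ⊆ A
    · by_cases h2 : B = A
      · exact Or.inr (Or.inl h2)
      · exact Or.inr (Or.inr ((c.isStd_iff ((c.mem_L B).1 hB)).2 (h B h1 h2)))
    · exact Or.inl h1

theorem signOf_eq {B : Finset (Fin n)} (hB : B.card ≤ d) :
    (signOf c.ms c.P (vec B) : ℝ) = chi B c.p * chi (c.srep B) c.p := by
  rw [signOf, c.rep_eq hB, headD_P, ← sgn_parity_vec, ← sgn_parity_vec, ← sgn_xor, sgn]
  cases parity (vec B) (List.ofFn c.p) ^^ parity (vec (c.srep B)) (List.ofFn c.p) <;> simp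

/-- The factor 2^|A| clears the denominators of the expansion into characters. Filtering the
enumerated monomials loses no summand, since all subsets of A have at most d elements. -/
theorem coef_eq {A D : Finset (Fin n)} (hA : A.card ≤ d) :
    (coef c.ms c.P (vec A) (vec D) : ℝ) = 2 ^ A.card * coeff (expo D) (c.nf A) := by
  classical
  have h1 : (bif vecEq (vec D) (vec A) then weightedPow 2 (vec A) else 0 : ℤ) =
      if D = A then 2 ^ A.card else 0 := by
    rw [weightedPow_vec]
    by_cases h : D = A
    · rw [vecEq_vec.2 h, if_pos h, cond_true]
    · rw [if_neg h, Bool.eq_false_iff.2 (fun h' => h (vecEq_vec.1 h')), cond_false]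
  have h2 : c.ms.filter (fun B => subset B (vec A) && subset (vec D) (rep c.ms c.P B)) =
      (c.L.filter fun B => decide (B ⊆ A ∧ D ⊆ c.srep B)).map vec := by
    conv_lhs => rw [ms, List.filter_map]
    congr 1
    refine List.filter_congr fun B hB => ?_
    have hB' := (c.mem_L B).1 hB
    rw [Bool.eq_iff_iff, Function.comp, Bool.and_eq_true, subset_vec, decide_eq_true_iff]
    change _ ∧ subset (vec D) (rep c.ms c.P (vec B)) = true ↔ _
    rw [c.rep_eq hB', subset_vec]
  have h3 : (c.L.filter fun B => decide (B ⊆ A ∧ D ⊆ c.srep B)).toFinset =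
      A.powerset.filter fun B => D ⊆ c.srep B := by
    ext B
    simp only [List.mem_toFinset, List.mem_filter, decide_eq_true_iff, Finset.mem_filter,
      Finset.mem_powerset, c.mem_L]
    exact ⟨fun h => h.2, fun h => ⟨(Finset.card_le_card h.1).trans hA, h⟩⟩
  rw [coef, h1, h2, List.map_map, ← List.sum_toFinset _ (c.nodup_L.filter _), h3, nf,
    coeff_nfPoly_expo, mul_sub, Finset.mul_sum]
  push_cast
  congr 1
  · by_cases h : D = A <;> simp [h]
  · refine Finset.sum_congr rfl fun B hB => ?_
    have hB' : B.card ≤ d :=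
      (Finset.card_le_card (Finset.mem_powerset.1 (Finset.mem_filter.1 hB).1)).trans hA
    rw [Function.comp, Int.cast_mul, Int.cast_mul, c.signOf_eq hB', weightedPow_vec,
      weightedPow_vec]
    have h4 : (2 : ℝ) ^ A.card * (1 / 2) ^ A.card = 1 := by rw [← mul_pow]; norm_num
    push_cast
    change _ = 2 ^ A.card * ((1 / 2) ^ A.card * (-1) ^ B.card *
      (chi B c.p * chi (c.srep B) c.p) * (-2) ^ D.card)
    linear_combination (-((-1) ^ B.card * (chi B c.p * chi (c.srep B) c.p) * (-2) ^ D.card)) * h4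

theorem map_toNat_vec (A : Finset (Fin n)) : (vec A).map Bool.toNat = List.ofFn (expo A) := by
  rw [vec, List.map_ofFn]
  congr 1
  funext i
  by_cases h : i ∈ A <;> simp [expo_apply, h]

theorem degree_le_of_mem_support {A : Finset (Fin n)} {a : Fin n →₀ ℕ}
    (ha : a ∈ (c.nf A).support) : ∃ D, a = expo D ∧ D.card ≤ A.card := by
  rcases mem_support_nfPoly ha with rfl | ⟨D, rfl, -, h⟩
  · exact ⟨A, rfl, le_rfl⟩
  · exact ⟨D, rfl, card_le_of_toSyn_le h⟩

theorem codesPoly_nf {A : Finset (Fin n)} (hA : A.card ≤ d) :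
    CodesPoly (c.nf A) (enc (poly c.ms c.P (vec A))) := by
  have h1 : c.ms.filter (fun D => !decide (coef c.ms c.P (vec A) D = 0)) =
      (c.L.filter fun D => !decide (coef c.ms c.P (vec A) (vec D) = 0)).map vec := by
    conv_lhs => rw [ms, List.filter_map]
    rfl
  have h2 : ∀ D, coef c.ms c.P (vec A) (vec D) = 0 ↔ coeff (expo D) (c.nf A) = 0 := by
    intro D
    have h := c.coef_eq (D := D) hA
    have h' : (2 : ℝ) ^ A.card ≠ 0 := by positivity
    rw [← Int.cast_eq_zero (α := ℝ), h, mul_eq_zero, or_iff_right h']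
  rw [poly, h1, List.map_map]
  refine codesSet_map (f := expo) ?_ ?_ ?_
  · exact (c.nodup_L.filter _).map expo_injective
  · intro a
    simp only [Finset.mem_coe, List.mem_filter, Bool.not_eq_true', decide_eq_false_iff_not, h2]
    constructor
    · intro ha
      obtain ⟨D, rfl, hD⟩ := c.degree_le_of_mem_support ha
      exact ⟨D, ⟨(c.mem_L D).2 (hD.trans hA), mem_support_iff.1 ha⟩, rfl⟩
    · rintro ⟨D, ⟨-, h⟩, rfl⟩
      exact mem_support_iff.2 h
  · intro D hD
    refine ⟨coef c.ms c.P (vec A) (vec D), weightedPow 2 (vec A), ?_, ?_, ?_⟩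
    · rw [weightedPow_vec]; positivity
    · rw [c.coef_eq hA, weightedPow_vec]
      push_cast
      field_simp
    · simp only [Function.comp, enc_pair, map_toNat_vec, vecCode_eq]
      rfl

theorem expo_singleton_eq_single (i : Fin n) (k : ℕ) :
    (List.ofFn fun j => bif decide (j ∈ ({i} : Finset (Fin n))) then k else 0) =
      List.ofFn (Finsupp.single i k) := by
  congr 1
  funext j
  by_cases h : j = i <;> simp [h]

/-- The code of `x_i ^ 2 - x_i`, where `A` is the vector of `x_i`. -/
def sqList (A : List Bool) : List ((ℤ × ℤ) × List ℕ) :=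
  [((1, 1), A.map fun b => bif b then 2 else 0), ((-1, 1), A.map Bool.toNat)]

theorem codesPoly_sq (i : Fin n) : CodesPoly (sqPoly i) (enc (sqList (vec {i}))) := by
  have h1 : sqList (vec {i}) = [(((1, 1), 2) : (ℤ × ℤ) × ℕ), ((-1, 1), 1)].map
      fun t => (t.1, List.ofFn (Finsupp.single i t.2)) := by
    simp only [sqList, List.map_cons, List.map_nil, map_toNat_vec, expo_singleton]
    rw [vec, List.map_ofFn, ← expo_singleton_eq_single i 2]
    rfl
  have hne := single_one_ne_single_two i
  rw [h1]
  refine codesSet_map (f := fun t => Finsupp.single i t.2) ?_ ?_ ?_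
  · simpa using hne.symm
  · intro a
    rw [support_sqPoly]
    simp [eq_comm]
  · intro t ht
    refine ⟨t.1.1, t.1.2, ?_, ?_, ?_⟩
    · rcases List.mem_cons.1 ht with rfl | ht
      · simp
      · rw [List.mem_singleton.1 ht]; simp
    · rcases List.mem_cons.1 ht with rfl | ht
      · simp [coeff_sqPoly, hne]
      · rw [List.mem_singleton.1 ht]; simp [coeff_sqPoly, hne.symm]
    · rw [vecCode_eq]; rfl

/-- The order is graded, so no tail monomial has degree above |A|, and truncation reduces to a
condition on A. -/
theorem totalDegree_nf_le_iff {A : Finset (Fin n)}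
    (hA : IsMinNonstandard MonomialOrder.degLex c.S A) :
    (c.nf A).totalDegree ≤ d ↔ A.card ≤ d := by
  rw [totalDegree, Finset.sup_le_iff]
  constructor
  · intro h
    have h1 : expo A ∈ (c.nf A).support := by
      rw [mem_support_iff, nf, coeff_nfPoly_self hA.1]; exact one_ne_zero
    exact (degree_expo A).ge.trans (h _ h1)
  · intro h a ha
    obtain ⟨D, rfl, hD⟩ := c.degree_le_of_mem_support ha
    exact (degree_expo D).le.trans (hD.trans h)

theorem totalDegree_sqPoly (i : Fin n) : (sqPoly i).totalDegree = 2 := by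
  rw [totalDegree, support_sqPoly]
  simp

end BasisContext

theorem forall₂_append {α β : Type} {R : α → β → Prop} {l l' : List α} {m m' : List β}
    (h : List.Forall₂ R l m) (h' : List.Forall₂ R l' m') :
    List.Forall₂ R (l ++ l') (m ++ m') := by
  induction h with
  | nil => exact h'
  | cons h _ ih => exact .cons h ih

/-- Needed for concatenation: `CodesSet` provides some list of codes, which has to be identified
with the codes of the given list. -/
theorem list_injective : Function.Injective Data.list := by
  intro l
  induction l with
  | nil => intro m h; cases m <;> simp_all [Data.list]
  | cons a l ih =>
    intro m h
    cases m with
    | nil => simp [Data.list] at h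
    | cons b m =>
      simp only [Data.list, Data.pair.injEq] at h
      rw [h.1, ih h.2]

theorem CodesSet.append {α β : Type} [Code β] {code : α → Data → Prop} {S T : Set α}
    {l m : List β} (h : CodesSet code S (enc l)) (h' : CodesSet code T (enc m))
    (hd : Disjoint S T) : CodesSet code (S ∪ T) (enc (l ++ m)) := by
  obtain ⟨u, hu, hS, ws, hw, he⟩ := h
  obtain ⟨v, hv, hT, ws', hw', he'⟩ := h'
  refine ⟨u ++ v, List.Nodup.append hu hv fun a ha ha' =>
      Set.disjoint_left.1 hd ((hS a).1 ha) ((hT a).1 ha'), fun a => ?_, ws ++ ws',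
    forall₂_append hw hw', ?_⟩
  · rw [List.mem_append, hS, hT]; rfl
  · have e1 : l.map enc = ws := list_injective he
    have e2 : m.map enc = ws' := list_injective he'
    rw [← e1, ← e2, ← List.map_append]; rfl

namespace BasisContext

variable {n d : ℕ} (c : BasisContext n d)

theorem codesSet_nf : CodesSet CodesPoly
    (c.nf '' {A | IsMinNonstandard MonomialOrder.degLex c.S A ∧ A.card ≤ d})
    (enc ((c.ms.filter fun A => isMinimal c.ms c.P A).map fun A => poly c.ms c.P A)) := by
  have h1 : c.ms.filter (fun A => isMinimal c.ms c.P A) =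
      (c.L.filter fun A => isMinimal c.ms c.P (vec A)).map vec := by
    conv_lhs => rw [ms, List.filter_map]
    rfl
  have hmem : ∀ {A}, A ∈ (c.L.filter fun A => isMinimal c.ms c.P (vec A)) ↔
      IsMinNonstandard MonomialOrder.degLex c.S A ∧ A.card ≤ d := by
    intro A
    rw [List.mem_filter, c.mem_L]
    exact ⟨fun h => ⟨(c.isMinimal_iff h.1).1 h.2, h.1⟩, fun h => ⟨h.2, (c.isMinimal_iff h.2).2 h.1⟩⟩
  rw [h1, List.map_map]
  refine codesSet_map (f := c.nf) ?_ ?_ ?_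
  · refine List.Nodup.map_on ?_ (c.nodup_L.filter _)
    intro A hA B hB hAB
    have h2 := congrArg (MonomialOrder.degLex (σ := Fin n)).degree hAB
    rw [nf, nf, degree_nfPoly (hmem.1 hA).1.1, degree_nfPoly (hmem.1 hB).1.1] at h2
    exact expo_injective h2
  · intro f
    constructor
    · rintro ⟨A, hA, rfl⟩
      exact ⟨A, hmem.2 hA, rfl⟩
    · rintro ⟨A, hA, rfl⟩
      exact ⟨A, hmem.1 hA, rfl⟩
  · intro A hA
    exact c.codesPoly_nf (hmem.1 hA).2

/-- The polynomial `x ^ 2 - x` for the monomial `x = A`. -/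
noncomputable def sqOf (A : Finset (Fin n)) : MvPolynomial (Fin n) ℝ :=
  monomial (expo A + expo A) 1 - monomial (expo A) 1

theorem sqOf_singleton (i : Fin n) : sqOf {i} = sqPoly i := by
  rw [sqOf, sqPoly, expo_singleton, ← Finsupp.single_add]

theorem codesSet_squares (hd : 2 ≤ d) : CodesSet CodesPoly
    (sqPoly '' {i | c.Std {i}}) (enc (squares c.ms c.P)) := by
  have h1 : squares c.ms c.P = ((c.L.filter fun A => decide (weight (vec A) = 1) &&
      isStd c.ms c.P (vec A)).map vec).map sqList := by
    rw [squares]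
    conv_lhs => rw [ms, List.filter_map]
    rfl
  have hmem : ∀ {A}, A ∈ (c.L.filter fun A => decide (weight (vec A) = 1) &&
      isStd c.ms c.P (vec A)) ↔ ∃ i, A = {i} ∧ c.Std {i} := by
    intro A
    rw [List.mem_filter, c.mem_L, Bool.and_eq_true, decide_eq_true_iff, weight_vec, Nat.cast_eq_one]
    constructor
    · rintro ⟨h2, h3, h4⟩
      obtain ⟨i, rfl⟩ := Finset.card_eq_one.1 h3
      exact ⟨i, rfl, (c.isStd_iff h2).1 h4⟩
    · rintro ⟨i, rfl, h⟩
      have h2 : ({i} : Finset (Fin n)).card ≤ d := by rw [Finset.card_singleton]; omega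
      exact ⟨h2, Finset.card_singleton i, (c.isStd_iff h2).2 h⟩
  rw [h1, List.map_map]
  -- The enumeration runs over sets, not variables, so the square polynomials are first indexed by
  -- sets.
  refine codesSet_map (f := sqOf) ?_ ?_ ?_
  · refine List.Nodup.map_on ?_ (c.nodup_L.filter _)
    intro A hA B hB hAB
    obtain ⟨i, rfl, -⟩ := hmem.1 hA
    obtain ⟨j, rfl, -⟩ := hmem.1 hB
    rw [sqOf_singleton, sqOf_singleton] at hAB
    have h2 := congrArg (MonomialOrder.degLex (σ := Fin n)).degree hAB
    rw [degree_sqPoly, degree_sqPoly] at h2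
    rw [Finsupp.single_left_injective two_ne_zero h2]
  · intro f
    constructor
    · rintro ⟨i, hi, rfl⟩
      exact ⟨{i}, hmem.2 ⟨i, rfl, hi⟩, sqOf_singleton i⟩
    · rintro ⟨A, hA, rfl⟩
      obtain ⟨i, rfl, hi⟩ := hmem.1 hA
      exact ⟨i, hi, (sqOf_singleton i).symm⟩
  · intro A hA
    obtain ⟨i, rfl, -⟩ := hmem.1 hA
    rw [sqOf_singleton]
    exact codesPoly_sq i

theorem truncate_eq : truncate d (reducedBasis MonomialOrder.degLex c.S c.p) =
    (if 2 ≤ d then sqPoly '' {i | c.Std {i}} else ∅) ∪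
      c.nf '' {A | IsMinNonstandard MonomialOrder.degLex c.S A ∧ A.card ≤ d} := by
  ext f
  constructor
  · rintro ⟨⟨A, hA, rfl⟩ | ⟨i, hi, rfl⟩, hf⟩
    · exact Or.inr ⟨A, ⟨hA, (c.totalDegree_nf_le_iff hA).1 hf⟩, rfl⟩
    · rw [totalDegree_sqPoly] at hf
      rw [if_pos hf]
      exact Or.inl ⟨i, hi, rfl⟩
  · rintro (hf | ⟨A, ⟨hA, hd⟩, rfl⟩)
    · split_ifs at hf with h
      · obtain ⟨i, hi, rfl⟩ := hf
        exact ⟨Or.inr ⟨i, hi, rfl⟩, by rwa [totalDegree_sqPoly]⟩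
      · exact absurd hf (Set.notMem_empty _)
    · exact ⟨Or.inl ⟨A, hA, rfl⟩, (c.totalDegree_nf_le_iff hA).2 hd⟩

theorem codesSet_basis : CodesSet CodesPoly
    (truncate d (reducedBasis MonomialOrder.degLex c.S c.p))
    (enc (basis d (List.range n) c.ms c.P)) := by
  rw [truncate_eq, basis, show c.P.isEmpty = false from rfl, cond_false]
  refine CodesSet.append ?_ c.codesSet_nf ?_
  · by_cases h : 2 ≤ d
    · rw [if_pos h, show decide ((1 : ℤ) < d) = true from decide_eq_true (by omega), cond_true]
      exact c.codesSet_squares h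
    · rw [if_neg h, show decide ((1 : ℤ) < d) = false by simpa using h, cond_false]
      exact ⟨[], List.nodup_nil, by simp, [], .nil, rfl⟩
  -- The two parts of the output have no common element: leading monomials are squares in one and
  -- squarefree in the other.
  · rw [Set.disjoint_left]
    rintro f hf ⟨A, ⟨hA, -⟩, rfl⟩
    split_ifs at hf
    · obtain ⟨i, -, hi⟩ := hf
      have h2 := congrArg (MonomialOrder.degLex (σ := Fin n)).degree hi
      rw [degree_sqPoly, nf, degree_nfPoly hA.1] at h2
      have h3 := DFunLike.congr_fun h2 i
      rw [expo_apply, Finsupp.single_eq_same] at h3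
      split_ifs at h3
      omega
    · exact absurd hf (Set.notMem_empty _)

end BasisContext

/-! ### Correctness of the program -/

theorem codesPoly_one {n : ℕ} : CodesPoly (1 : MvPolynomial (Fin n) ℝ)
    (enc [(((1 : ℤ), (1 : ℤ)), (List.range n).map fun _ => 0)]) := by
  refine codesSet_map (l := [()]) (f := fun _ => 0)
    (g := fun _ => (((1 : ℤ), (1 : ℤ)), (List.range n).map fun _ => 0)) (by simp) ?_ ?_
  · intro a
    simp [MvPolynomial.support_one, eq_comm]
  · intro _ _
    refine ⟨1, 1, one_ne_zero, by simp, ?_⟩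
    rw [vecCode_eq, show List.ofFn (0 : Fin n →₀ ℕ) = (List.range n).map fun _ => 0 from
      List.ext_getElem (by simp) fun i h1 h2 => by simp]
    rfl

theorem truncate_one {n : ℕ} (d : ℕ) : truncate d {(1 : MvPolynomial (Fin n) ℝ)} = {1} := by
  ext f
  constructor
  · exact fun h => h.1
  · rintro rfl
    exact ⟨rfl, by simp⟩

theorem codesSet_basis_of_generates {n d : ℕ} {S : Set (Fin n → Bool)} {P : List (List Bool)}
    (hS : MinorityClosed S) (hP : Generates P S) :
    ∃ G, IsReducedGroebnerBasis MonomialOrder.degLex (vanishingIdeal ℝ (toPoint '' S)) G ∧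
      CodesSet CodesPoly (truncate d G) (enc (basis d (List.range n)
        (monomialRows (List.range n) (List.range d)).flatten P)) := by
  obtain ⟨X, rfl, hX⟩ := hP
  rcases X with _ | ⟨p, X⟩
  · have hS' : S = ∅ := by
      ext φ
      rw [← hX]
      refine ⟨fun h => ?_, fun h => absurd h (Set.notMem_empty _)⟩
      simpa using h.nonempty
    refine ⟨{1}, ?_, ?_⟩
    · rw [hS', Set.image_empty, show vanishingIdeal ℝ (∅ : Set (Fin n → ℝ)) = ⊤ by
        ext f; simp [mem_vanishingIdeal_iff]]
      exact isReducedGroebnerBasis_top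
    · rw [truncate_one]
      exact codesSet_map (l := [()]) (f := fun _ => 1)
        (g := fun _ => [(((1 : ℤ), (1 : ℤ)), (List.range n).map fun _ => 0)]) (by simp)
        (by simp [eq_comm]) fun _ _ => codesPoly_one
  · obtain ⟨L, hL, hmem, hsorted⟩ := exists_monomials n d
    let c : BasisContext n d := ⟨S, L, p, X, hmem, hsorted, hX⟩
    exact ⟨_, isReducedGroebnerBasis_reducedBasis hS c.p_mem, by
      rw [hL]; exact c.codesSet_basis⟩

/-- Among three Boolean arguments two coincide, so the identities leave no freedom. -/
theorem isMinority_eq {f : (Fin 3 → Bool) → Bool} (hf : IsMinority f) (a b c : Bool) :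
    f ![a, b, c] = (a ^^ (b ^^ c)) := by
  have h1 := hf a b
  have h2 := hf a c
  have h3 := hf b a
  have h4 := hf b c
  have h5 := hf c a
  cases a <;> cases b <;> cases c <;> simp_all

theorem minority_mem_tuples {Γ : Set (Relation Bool)} (hΓ : ClosedUnderMinority Γ)
    {R : Relation Bool} (hR : R ∈ Γ) : MinorityClosed R.tuples := by
  obtain ⟨f, hf, hpol⟩ := hΓ
  intro φ hφ ψ hψ θ hθ
  have h := hpol R hR ![φ, ψ, θ] (by intro i; fin_cases i <;> assumption)
  convert h using 2 with j
  rw [← isMinority_eq hf]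
  congr 1
  funext i
  fin_cases i <;> rfl

theorem minorityClosed_sol {Γ : Set (Relation Bool)} (hΓ : ClosedUnderMinority Γ) {n : ℕ}
    (𝒞 : Instance Γ n) : MinorityClosed (Sol 𝒞) :=
  fun _ hφ _ hψ _ hθ c hc =>
    minority_mem_tuples hΓ (𝒞.mem_language c hc) _ (hφ c hc) _ (hψ c hc) _ (hθ c hc)

theorem MinSpan.mem_of_closed {k : ℕ} {T : Set (Fin k → Bool)} (hT : MinorityClosed T)
    {X : Set (Fin k → Bool)} (hX : X ⊆ T) {φ : Fin k → Bool} (h : MinSpan X φ) : φ ∈ T := by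
  induction h with
  | mem h => exact hX h
  | minority _ _ _ h1 h2 h3 => exact hT _ h1 _ h2 _ h3

/-- The tuples listed in the input already form a generating list, because a minority-closed
relation is its own span. -/
theorem exists_of_codesConstraint {n : ℕ} {c : Constraint Bool n} {w : Data}
    (h : CodesConstraint c w) (hc : MinorityClosed c.rel.tuples) :
    ∃ R : List (List Bool), w = enc (List.ofFn fun j => (c.scope j : ℕ), R) ∧
      Generates R c.rel.tuples := by
  obtain ⟨r, ⟨l, -, hl, ws, hws, rfl⟩, rfl⟩ := h
  refine ⟨l.map List.ofFn, ?_, l, rfl, fun φ => ⟨fun h => ?_, fun h => .mem ((hl φ).2 h)⟩⟩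
  · have h2 : ws = (l.map List.ofFn).map enc := by
      clear hl
      induction hws with
      | nil => rfl
      | @cons t w l ws h _ ih =>
        rw [List.map_cons, List.map_cons, ih, h]
        congr 1
        change Data.list _ = Data.list ((List.ofFn t).map enc)
        rw [List.map_ofFn]
        rfl
    rw [vecCode_eq, h2]
    rfl
  · exact h.mem_of_closed hc fun ψ hψ => (hl ψ).1 hψ

theorem generates_foldl {n : ℕ} {l : List (Constraint Bool n)} {ws : List Data}
    (h : List.Forall₂ CodesConstraint l ws) (hl : ∀ c ∈ l, MinorityClosed c.rel.tuples) :
    ∃ cs : List (List ℕ × List (List Bool)), ws = cs.map enc ∧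
      ∀ (P : List (List Bool)) (S : Set (Fin n → Bool)), Generates P S →
        Generates (cs.foldl (addConstraint (List.range n)) P)
          {φ | φ ∈ S ∧ ∀ c ∈ l, (fun j => φ (c.scope j)) ∈ c.rel.tuples} := by
  induction h with
  | nil => exact ⟨[], rfl, fun P S h => by simpa using h⟩
  | @cons c w l ws h _ ih =>
    obtain ⟨cs, rfl, hcs⟩ := ih fun c hc => hl c (List.mem_cons_of_mem _ hc)
    obtain ⟨R, rfl, hR⟩ := exists_of_codesConstraint h (hl c List.mem_cons_self)
    refine ⟨(List.ofFn fun j => (c.scope j : ℕ), R) :: cs, rfl, fun P S hP => ?_⟩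
    refine (hcs _ _ (hP.addConstraint hR c.scope)).congr fun φ => ?_
    simp [and_assoc]

theorem exists_input {Γ : Set (Relation Bool)} (hΓ : ClosedUnderMinority Γ) {n d : ℕ}
    {𝒞 : Instance Γ n} {w : Data} (h : CodesInput d 𝒞 w) :
    ∃ cs, w = enc (Input.mk n d cs) ∧ Generates (generators (List.range n) cs) (Sol 𝒞) := by
  obtain ⟨r, ⟨l, -, hl, ws, hws, rfl⟩, rfl⟩ := h
  obtain ⟨cs, rfl, hcs⟩ := generates_foldl hws fun c hc =>
    minority_mem_tuples hΓ (𝒞.mem_language c ((hl c).1 hc))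
  refine ⟨cs, rfl, (hcs _ _ (generates_univ n)).congr fun φ => ?_⟩
  simp [Sol, hl]

/-- The factor 2 is due to `false`, whose code has size 1 but length 2. -/
theorem len_list_le_two_mul_size {α : Type} [Code α] (h : ∀ a : α, len a ≤ 2 * (enc a).size)
    (l : List α) : len l ≤ 2 * (enc l).size := by
  induction l with
  | nil => simp [len_nil, enc, Data.list, Data.size]
  | cons b l ih =>
    have := h b
    rw [len_cons, enc_cons, Data.size]; omega

theorem len_pair_le_two_mul_size {α β : Type} [Code α] [Code β]
    (h : ∀ a : α, len a ≤ 2 * (enc a).size) (h' : ∀ a : β, len a ≤ 2 * (enc a).size) (p : α × β) :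
    len p ≤ 2 * (enc p).size := by
  have h1 := h p.1
  have h2 := h' p.2
  rcases p with ⟨a, b⟩
  rw [len_pair, enc_pair, Data.size]; simp only at h1 h2; omega

theorem len_input_le (w : Input) : len w ≤ 2 * (enc w).size + max w.n 2 ^ max w.d 1 := by
  have hn : ∀ k : ℕ, len k ≤ 2 * (enc k).size := fun k => by simp [len, enc, Data.size]
  exact Nat.add_le_add_right (len_pair_le_two_mul_size hn (len_pair_le_two_mul_size hn
    (len_list_le_two_mul_size (len_pair_le_two_mul_size (len_list_le_two_mul_size hn)
      (len_list_le_two_mul_size (len_list_le_two_mul_size fun b => by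
        have := one_le_size (enc b)
        have h : len b = 2 := rfl
        omega))))) (w.n, w.d, w.cs)) _

theorem exists_computes : ∃ (M : Prog) (c : ℕ), ∀ Γ : Set (Relation Bool), ClosedUnderMinority Γ →
    ComputesTruncatedBasis M Γ fun n d s => s ^ c * max n 2 ^ (c * max d 1) := by
  obtain ⟨M, B, ⟨c, hB⟩, hM⟩ := PolyTime.output
  refine ⟨M, 2 * c, fun Γ hΓ n d 𝒞 w hw => ?_⟩
  obtain ⟨cs, rfl, hgen⟩ := exists_input hΓ hw
  obtain ⟨-, t, ht, hr⟩ := hM ⟨n, d, cs⟩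
  obtain ⟨G, hG, hout⟩ := codesSet_basis_of_generates (d := d) (minorityClosed_sol hΓ 𝒞) hgen
  refine ⟨_, t, G, hr, ?_, hG, hout⟩
  have h1 := len_input_le ⟨n, d, cs⟩
  simp only at h1
  set s := (enc (Input.mk n d cs)).size with hs
  set Q := max n 2 ^ max d 1 with hQ
  have hs1 : 3 ≤ s := by
    have e : s = (enc n).size + (enc (d, cs)).size + 1 := rfl
    have := one_le_size (enc n)
    have := one_le_size (enc (d, cs))
    omega
  have hQ2 : 2 ≤ Q :=
    calc 2 ≤ max n 2 := le_max_right _ _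
      _ ≤ Q := Nat.le_self_pow (by simp) _
  -- The sum 2s + Q + 1 becomes a product, using s ≥ 3 and Q ≥ 2; the square of Q is why the final
  -- exponent is 2c.
  have h2 : len (Input.mk n d cs) + 1 ≤ s * (Q * Q) := by
    have h3 : 2 * s ≤ s * Q := by rw [mul_comm]; exact Nat.mul_le_mul_left _ hQ2
    have h4 : 3 * Q ≤ s * Q := Nat.mul_le_mul_right _ hs1
    have h5 : 2 * (s * Q) ≤ s * Q * Q := by rw [mul_comm]; exact Nat.mul_le_mul_left _ hQ2
    rw [← mul_assoc]; omega
  calc t ≤ (len (Input.mk n d cs) + 1) ^ c := ht.trans (hB _)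
    _ ≤ (s * (Q * Q)) ^ c := Nat.pow_le_pow_left h2 c
    _ = s ^ c * max n 2 ^ (2 * c * max d 1) := by
      rw [mul_pow, ← pow_two, ← pow_mul, hQ, ← pow_mul]
      congr 2; ring
    _ ≤ s ^ (2 * c) * max n 2 ^ (2 * c * max d 1) :=
      Nat.mul_le_mul_right _ (Nat.pow_le_pow_right (by omega) (by omega))

/-! ### Instances over finite languages -/

theorem size_list_le {ws : List Data} {m b : ℕ} (h : ws.length ≤ m) (h' : ∀ w ∈ ws, w.size ≤ b) :
    (Data.list ws).size ≤ m * (b + 1) + 1 := by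
  induction ws generalizing m with
  | nil => simp [Data.list, Data.size]
  | cons w ws ih =>
    obtain ⟨m, rfl⟩ : ∃ m', m = m' + 1 := ⟨m - 1, by simp at h; omega⟩
    have h1 := ih (m := m) (by simpa using h) fun v hv => h' v (List.mem_cons_of_mem _ hv)
    have h2 := h' w List.mem_cons_self
    rw [Data.list, Data.size, Nat.succ_mul]; omega

theorem size_int_natCast_le (k : ℕ) : (Data.int k).size ≤ k + 1 := by
  have : Nat.size k ≤ k := Nat.size_le.2 Nat.lt_two_pow_self
  simpa [Data.size] using this

theorem size_vecCode_le {k b : ℕ} {v : Fin k → ℕ} (h : ∀ i, v i ≤ b) :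
    (vecCode v).size ≤ k * (b + 2) + 1 := by
  refine size_list_le (by simp) fun w hw => ?_
  obtain ⟨i, rfl⟩ := (List.mem_ofFn' _ _).1 hw
  exact (size_int_natCast_le _).trans (Nat.succ_le_succ (h i))

theorem exists_mem_of_forall₂ {α β : Type} {R : α → β → Prop} {l : List α} {m : List β}
    (h : List.Forall₂ R l m) {y : β} (hy : y ∈ m) : ∃ x ∈ l, R x y := by
  induction h with
  | nil => simp at hy
  | cons h _ ih =>
    rcases List.mem_cons.1 hy with rfl | hy
    · exact ⟨_, List.mem_cons_self, h⟩
    · obtain ⟨x, hx, hR⟩ := ih hy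
      exact ⟨x, List.mem_cons_of_mem _ hx, hR⟩

theorem size_codesConstraint_le {n K : ℕ} {c : Constraint Bool n} {w : Data}
    (h : CodesConstraint c w) (hK : c.rel.arity ≤ K) :
    w.size ≤ K * (n + 2) + 2 ^ K * (K * 3 + 2) + 3 := by
  obtain ⟨r, ⟨l, hnd, -, ws, hws, rfl⟩, rfl⟩ := h
  have h1 : (vecCode fun j => (c.scope j : ℕ)).size ≤ K * (n + 2) + 1 :=
    (size_vecCode_le fun j => (c.scope j).2.le).trans
      (Nat.succ_le_succ (Nat.mul_le_mul_right _ hK))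
  have h2 : (Data.list ws).size ≤ 2 ^ K * (K * 3 + 2) + 1 := by
    refine size_list_le ?_ fun w hw => ?_
    · rw [← hws.length_eq]
      refine hnd.length_le_card.trans ?_
      simpa using Nat.pow_le_pow_right two_pos hK
    · obtain ⟨t, -, ht⟩ := exists_mem_of_forall₂ hws hw
      rw [show w = _ from ht]
      exact (size_vecCode_le (b := 1) fun i => Bool.toNat_le _).trans
        (Nat.succ_le_succ (Nat.mul_le_mul_right _ hK))
  rw [Data.size]; omega

/-- A constraint is determined by its relation and its scope, and for each relation there are at
most max(n,2)^K scopes. -/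
theorem length_le_of_nodup {n K : ℕ} {Γ : Set (Relation Bool)} (hΓ : Γ.Finite)
    (hK : ∀ R ∈ Γ, R.arity ≤ K) {l : List (Constraint Bool n)} (hnd : l.Nodup)
    (hl : ∀ c ∈ l, c.rel ∈ Γ) : l.length ≤ hΓ.toFinset.card * max n 2 ^ K := by
  classical
  let f : Constraint Bool n → Σ R : Relation Bool, Fin R.arity → Fin n := fun c => ⟨c.rel, c.scope⟩
  have hf : Function.Injective f := by
    rintro ⟨R, s⟩ ⟨R', s'⟩ h
    simp only [f, Sigma.mk.injEq] at h
    obtain ⟨rfl, h⟩ := h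
    rw [eq_of_heq h]
  calc l.length = (l.map f).toFinset.card := by
        rw [List.toFinset_card_of_nodup (hnd.map hf), List.length_map]
    _ ≤ (hΓ.toFinset.sigma fun R => (Finset.univ : Finset (Fin R.arity → Fin n))).card := by
        refine Finset.card_le_card fun x hx => ?_
        obtain ⟨c, hc, rfl⟩ := List.mem_map.1 (List.mem_toFinset.1 hx)
        simpa [f] using hl c hc
    _ = ∑ R ∈ hΓ.toFinset, n ^ R.arity := by simp [Finset.card_sigma]
    _ ≤ ∑ R ∈ hΓ.toFinset, max n 2 ^ K := by
        refine Finset.sum_le_sum fun R hR => ?_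
        exact (Nat.pow_le_pow_left (le_max_left _ _) _).trans
          (Nat.pow_le_pow_right (by simp) (hK R (hΓ.mem_toFinset.1 hR)))
    _ = _ := by simp

theorem exists_size_le {Γ : Set (Relation Bool)} (hΓ : Γ.Finite) :
    ∃ k, ∀ (n d : ℕ) (𝒞 : Instance Γ n) (w : Data), CodesInput d 𝒞 w →
      w.size ≤ max n 2 ^ (k * max d 1) := by
  obtain ⟨K, hK⟩ : ∃ K, ∀ R ∈ Γ, R.arity ≤ K := by
    obtain ⟨K, hK⟩ := (hΓ.image Relation.arity).bddAbove
    exact ⟨K, fun R hR => hK ⟨R, hR, rfl⟩⟩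
  set g := hΓ.toFinset.card with hg
  set b := 2 ^ K * (K * 3 + 2) + 4 with hb
  -- With Q = max(n,2)^max(d,1), the K of K + 1 counts scopes and the 1 pays for one constraint. The
  -- rest is a constant factor, absorbed through a ≤ 2^a ≤ Q^a; its 5 covers the codes of n and d
  -- and the nodes.
  refine ⟨g * (2 * K + b) + 5 + (K + 1), fun n d 𝒞 w hw => ?_⟩
  obtain ⟨r, ⟨l, hnd, hl, ws, hws, rfl⟩, rfl⟩ := hw
  set Q := max n 2 ^ max d 1 with hQ
  have hQ1 : max n 2 ≤ Q := Nat.le_self_pow (by simp) _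
  have hQ2 : 2 ≤ Q := (le_max_right _ _).trans hQ1
  have hnQ : n ≤ Q := (le_max_left _ _).trans hQ1
  have hdQ : d ≤ Q :=
    calc d ≤ max d 1 := le_max_left _ _
      _ ≤ 2 ^ max d 1 := Nat.lt_two_pow_self.le
      _ ≤ Q := Nat.pow_le_pow_left (le_max_right _ _) _
  have h1 : ws.length ≤ g * Q ^ K := by
    rw [← hws.length_eq]
    refine (length_le_of_nodup hΓ hK hnd fun c hc => 𝒞.mem_language c ((hl c).1 hc)).trans ?_
    exact Nat.mul_le_mul_left _ (Nat.pow_le_pow_left hQ1 _)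
  have h2 : (Data.list ws).size ≤
      g * Q ^ K * (K * (n + 2) + 2 ^ K * (K * 3 + 2) + 3 + 1) + 1 := by
    refine size_list_le h1 fun w hw => ?_
    obtain ⟨c, hc, hcw⟩ := exists_mem_of_forall₂ hws hw
    exact size_codesConstraint_le hcw (hK _ (𝒞.mem_language c ((hl c).1 hc)))
  have h3 : K * (n + 2) + 2 ^ K * (K * 3 + 2) + 3 + 1 ≤ (2 * K + b) * Q := by
    have e1 : K * (n + 2) ≤ K * (2 * Q) := Nat.mul_le_mul_left _ (by omega)
    have e2 : b ≤ b * Q := Nat.le_mul_of_pos_right _ (by omega)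
    calc K * (n + 2) + 2 ^ K * (K * 3 + 2) + 3 + 1 = K * (n + 2) + b := by rw [hb]; ring
      _ ≤ K * (2 * Q) + b * Q := Nat.add_le_add e1 e2
      _ = _ := by ring
  have h4 : (Data.list ws).size ≤ g * (2 * K + b) * Q ^ (K + 1) + 1 := by
    refine h2.trans (Nat.succ_le_succ ?_)
    calc _ ≤ g * Q ^ K * ((2 * K + b) * Q) := Nat.mul_le_mul_left _ h3
      _ = _ := by ring
  have h5 : Q ≤ Q ^ (K + 1) := Nat.le_self_pow (by omega) _
  have h6 := size_int_natCast_le n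
  have h7 := size_int_natCast_le d
  calc _ ≤ (g * (2 * K + b) + 5) * Q ^ (K + 1) := by
        have e : ∀ x y z : Data, (Data.pair x (.pair y z)).size =
          x.size + (y.size + z.size + 1) + 1 := fun _ _ _ => rfl
        rw [e, Nat.add_mul]; omega
    _ ≤ Q ^ (g * (2 * K + b) + 5) * Q ^ (K + 1) := by
        refine Nat.mul_le_mul_right _ (Nat.lt_two_pow_self.le.trans ?_)
        exact Nat.pow_le_pow_left hQ2 _
    _ = max n 2 ^ ((g * (2 * K + b) + 5 + (K + 1)) * max d 1) := by
        rw [← pow_add, hQ, ← pow_mul, mul_comm (max d 1)]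

end BoolIMP

theorem theorem1 :
    ∃ M : BoolIMP.Prog,
      (∀ Γ : Set (BoolIMP.Relation Bool), Γ.Finite → BoolIMP.ClosedUnderMinority Γ →
        ∃ c : ℕ, BoolIMP.ComputesTruncatedBasis M Γ
          (fun n d _ => (max n 2) ^ (c * max d 1))) ∧
      (∃ c : ℕ, ∀ Γ : Set (BoolIMP.Relation Bool), BoolIMP.ClosedUnderMinority Γ →
        BoolIMP.ComputesTruncatedBasis M Γ
          (fun n d s => s ^ c * (max n 2) ^ (c * max d 1))) := by
  obtain ⟨M, c, h⟩ := BoolIMP.exists_computes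
  refine ⟨M, fun Γ hfin hΓ => ?_, c, h⟩
  obtain ⟨k, hk⟩ := BoolIMP.exists_size_le hfin
  -- The term k * c comes from inserting the bound on the input size into s^c.
  refine ⟨k * c + c, fun n d 𝒞 w hw => ?_⟩
  obtain ⟨out, t, G, hr, ht, hG, hout⟩ := h Γ hΓ n d 𝒞 w hw
  refine ⟨out, t, G, hr, ht.trans ?_, hG, hout⟩
  calc w.size ^ c * max n 2 ^ (c * max d 1)
      ≤ (max n 2 ^ (k * max d 1)) ^ c * max n 2 ^ (c * max d 1) :=
        Nat.mul_le_mul_right _ (Nat.pow_le_pow_left (hk n d 𝒞 w hw) c)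
    _ = max n 2 ^ ((k * c + c) * max d 1) := by
        rw [← pow_mul, ← pow_add]
        congr 1; ring
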